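/- Let $\underline\lambda=(\lambda_n)_{n\ge1}$ be a sequence in $\mathbb C\setminus\{0\}$, let $E_\lambda(z)=\lambda e^z$, and let $\underline a=(a_n)_{n\ge1}$, $\underline b=(b_n)_{n\ge1}$ be real sequences with $0<a_n<b_n$. Put $$I_{\underline a}^{\underline b}(E_{\underline\lambda})=\{z\in\mathbb C:\ a_n\le|E_{\lambda_n}\circ\cdots\circ E_{\lambda_1}(z)|\le b_n\text{ for all sufficiently large }n\},\qquad \Delta_n=\log\frac{b_n}{a_n}.$$ For every $q\in(0,1)$ and every $\Delta>0$ there is a constant $a=a(q,\Delta)$ such that the following holds for all such $\underline\lambda,\underline a,\underline b$. Assume that (a) $\underline a,\underline b$ are admissible with constant $q$, that is, for all sufficiently large $n$, $a_{n+1}\le|\lambda_{n+1}|e^{qa_n}$ and $b_{n+1}\ge|\lambda_{n+1}|e^{-qa_n}$; (b) $(a_1\cdots a_n)^{1/n}\to\infty$ as $n\to\infty$; (c) $\Delta_n>\Delta$ for every $n\ge1$; (d) $\liminf_{n\to\infty}a_n>a$. For $x=(x_1,x_2,\ldots)\in[a_1,b_1]\times[a_2,b_2]\times\cdots$ let $$\phi_n(x)=\frac{\log\big(\min(\Delta_2,x_1)\cdots\min(\Delta_n,x_{n-1})\big)}{\log(x_1\cdots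 x_n)-\log\min(\Delta_{n+1},x_n)},\qquad \psi_n(x)=\frac{\log\big(\min(\Delta_2,x_1)\cdots\min(\Delta_{n+1},x_n)\big)}{\log(x_1\cdots x_n)}$$ (the denominators are positive for all large $n$). Then $$1+\inf_x\liminf_{n\to\infty}\phi_n(x)\ \le\ \dim_H I_{\underline a}^{\underline b}(E_{\underline\lambda})\ \le\ 1+\sup_x\liminf_{n\to\infty}\phi_n(x),$$ $$1+\inf_x\limsup_{n\to\infty}\psi_n(x)\ \le\ \dim_P I_{\underline a}^{\underline b}(E_{\underline\lambda})\ \le\ 1+\sup_x\limsup_{n\to\infty}\psi_n(x),$$ where $\dim_H$ and $\dim_P$ denote Hausdorff and packing dimension and the infima and suprema are over all $x\in[a_1,b_1]\times[a_2,b_2]\times\cdots$. -/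

import Mathlib

open Filter Topology
open scoped ENNReal NNReal

/-! ### Packing dimension -/

/-- Upper box (Minkowski) dimension
`limsup_{ε → 0+} log N(A, ε) / (-log ε)`, where `N(A, ε)` is the least number of closed balls of
radius `ε` with centres in `A` which cover `A` (infinite if there is no finite cover).
With this convention the empty set has dimension `0`. -/
noncomputable def upperBoxDim {X : Type*} [MetricSpace X] (A : Set X) : ℝ≥0∞ :=
  limsup (fun ε : ℝ≥0 =>
    (ENNReal.log ((Metric.coveringNumber ε A : ℕ∞) : ℝ≥0∞) /
      ((-Real.log (ε : ℝ) : ℝ) : EReal)).toENNReal) (𝓝[>] (0 : ℝ≥0))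

/-- Packing dimension (in the sense of Tricot): the infimum, over all countable covers of `A`,
of the supremum of the upper box dimensions of the members of the cover. -/
noncomputable def packingDim {X : Type*} [MetricSpace X] (A : Set X) : ℝ≥0∞ :=
  ⨅ (F : ℕ → Set X) (_ : A ⊆ ⋃ i, F i), ⨆ i, upperBoxDim (F i)

/-! ### Non-autonomous exponential iteration

All sequences are indexed by `n = 1, 2, 3, …`; their value at `0` plays no role. -/

/-- `nonautExp lam n = E_{lam n} ∘ ⋯ ∘ E_{lam 1}`, where `E_c z = c * exp z`. -/
noncomputable def nonautExp (lam : ℕ → ℂ) : ℕ → ℂ → ℂ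
  | 0, z => z
  | n + 1, z => lam (n + 1) * Complex.exp (nonautExp lam n z)

/-- The points `z` with `a n ≤ |E_{lam n} ∘ ⋯ ∘ E_{lam 1} (z)| ≤ b n` for all large `n`. -/
def escapeRateSet (lam : ℕ → ℂ) (a b : ℕ → ℝ) : Set ℂ :=
  {z | ∀ᶠ n in atTop, a n ≤ ‖nonautExp lam n z‖ ∧ ‖nonautExp lam n z‖ ≤ b n}

/-- The normalized modulus `Δ_n = log (b n / a n)` of the annulus `a n ≤ |z| ≤ b n`. -/
noncomputable def annulusModulus (a b : ℕ → ℝ) (n : ℕ) : ℝ := Real.log (b n / a n)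

/-- Admissibility of `a`, `b` (with respect to `lam`) with the constant `q`. -/
def IsAdmissible (lam : ℕ → ℂ) (a b : ℕ → ℝ) (q : ℝ) : Prop :=
  ∀ᶠ n in atTop,
    a (n + 1) ≤ ‖lam (n + 1)‖ * Real.exp (q * a n) ∧
    ‖lam (n + 1)‖ * Real.exp (-(q * a n)) ≤ b (n + 1)

/-- The sequences `x` in `[a 1, b 1] × [a 2, b 2] × ⋯`. -/
def seqBox (a b : ℕ → ℝ) : Set (ℕ → ℝ) :=
  {x | ∀ n, 1 ≤ n → x n ∈ Set.Icc (a n) (b n)}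

/-- `φ_n(x)`: the numerator is `log (min(Δ_2, x_1) ⋯ min(Δ_n, x_{n-1}))`, the denominator is
`log (x_1 ⋯ x_n) - log min(Δ_{n+1}, x_n)`. -/
noncomputable def phiRatio (a b : ℕ → ℝ) (n : ℕ) (x : ℕ → ℝ) : ℝ :=
  Real.log (∏ k ∈ Finset.Ico 1 n, min (annulusModulus a b (k + 1)) (x k)) /
    (Real.log (∏ k ∈ Finset.Icc 1 n, x k) -
      Real.log (min (annulusModulus a b (n + 1)) (x n)))

/-- `ψ_n(x)`: the numerator is `log (min(Δ_2, x_1) ⋯ min(Δ_{n+1}, x_n))`, the denominator is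
`log (x_1 ⋯ x_n)`. -/
noncomputable def psiRatio (a b : ℕ → ℝ) (n : ℕ) (x : ℕ → ℝ) : ℝ :=
  Real.log (∏ k ∈ Finset.Icc 1 n, min (annulusModulus a b (k + 1)) (x k)) /
    Real.log (∏ k ∈ Finset.Icc 1 n, x k)

/-! Let z_k be the k-th point of the orbit of z and x_k = |z_k|. The n-th iterate has derivative of
modulus P_n = x_1⋯x_n at z, and the condition on z_{k+1} says that z_k lies in a vertical strip of
width Δ_{k+1}. Once z_n is known up to a bounded error, z_{n+1} therefore ranges over the part of an
annulus of radius about x_{n+1} inside a strip of width Δ_{n+2}, a region of size about min(Δ_{n+2},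
x_{n+1}) by x_{n+1}. This region holds about x_{n+1} min(Δ_{n+2}, x_{n+1}) cells of unit size, and
it pulls back to a region of size w_n by 1/P_n near z, where w_n = min(Δ_{n+2}, x_{n+1})/P_{n+1}.
With M_n = ∏_{k≤n} min(Δ_{k+1}, x_k), the natural mass of a piece of generation n is 1/(P_n M_n). In
these terms φ_{n+1} = log M_n / log(1/w_n) and ψ_n = log M_n / log P_n. Errors K^n are harmless
because P_n grows superexponentially (`exists_pow_le_of_superexponential`).

Upper bounds: orbits are sorted by their itineraries through a fixed grid. Counting successors of
cells shows that the weights 1/(P_n M_n) of the classes of generation n sum to at most K^n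
(`sum_prod_inv_le_one`, `exists_sum_weight_le`), and each class is covered as the picture suggests
(`exists_class_cover`). Balls of radius w_n contribute about w_n^t/P_n to a sum of (1+t)-th powers,
which is at most the weight when φ_{n+1} ≤ t; infinitely many such n suffice for the Hausdorff
dimension (`dimH_le_of_class_covers`). For the box dimension every scale r counts; it lies between
1/P_{n+1} and 1/P_n for some n, and ψ_n, ψ_{n+1} control the count there
(`upperBoxDim_le_of_class_covers`).

Lower bounds: admissibility makes the strip meet the zone |Re w| ≤ qX of the circle |w| = X, so for
large X a thin annulus contains a fixed proportion of X min(Δ, X) separated boxes inside the strip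
(`exists_boxes`). The boxes form a tree, and mass spread uniformly over it obeys the same heuristics
(`IsBoxTree.treeMeasure_closedBall_le`, `AnnulusData.exists_mass_distribution`). Mass distribution
principles conclude: ball estimates at all small radii for dim_H, at arbitrarily small radii for
dim_P. -/

section
open MeasureTheory Set

/-! ### Absorbing exponential factors; box dimension in terms of covering numbers. -/

/-- A sequence of superexponential growth absorbs exponential factors. -/
lemma exists_pow_le_of_superexponential {G : ℕ → ℝ} (hG0 : ∀ n, 0 < G n)
    (hG : ∀ B : ℝ, ∀ᶠ n in atTop, B ^ n ≤ G n) {B ε : ℝ} (hB : 0 < B) (hε : 0 < ε) :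
    ∃ C : ℝ, 0 < C ∧ ∀ n r, 0 < r → r ≤ 1 / G n → B ^ n ≤ C * r ^ (-ε) := by
  obtain ⟨n1, h1⟩ := eventually_atTop.1 (hG (B ^ (1 / ε)))
  have hq : ∀ n, 0 < B ^ n / G n ^ ε := fun n => by
    have := Real.rpow_pos_of_pos (hG0 n) ε
    positivity
  refine ⟨1 + ∑ n ∈ Finset.range n1, B ^ n / G n ^ ε, ?_, fun n r hr hrG => ?_⟩
  · have : 0 ≤ ∑ n ∈ Finset.range n1, B ^ n / G n ^ ε :=
      Finset.sum_nonneg fun n _ => (hq n).le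
    linarith
  · have hGp := Real.rpow_pos_of_pos (hG0 n) ε
    have hle : G n ^ ε ≤ r ^ (-ε) := by
      rw [Real.rpow_neg hr.le, ← Real.inv_rpow hr.le]
      refine Real.rpow_le_rpow (hG0 n).le ?_ hε.le
      rw [le_inv_comm₀ (hG0 n) hr]; simpa using hrG
    have hC : B ^ n / G n ^ ε ≤ 1 + ∑ n ∈ Finset.range n1, B ^ n / G n ^ ε := by
      have hs : 0 ≤ ∑ n ∈ Finset.range n1, B ^ n / G n ^ ε :=
        Finset.sum_nonneg fun n _ => (hq n).le
      by_cases hn : n < n1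
      · have := Finset.single_le_sum (f := fun n => B ^ n / G n ^ ε)
          (fun n _ => (hq n).le) (Finset.mem_range.2 hn)
        linarith
      · have h2 := h1 n (not_lt.1 hn)
        have h3 : ((B ^ (1 / ε)) ^ n) ^ ε ≤ G n ^ ε :=
          Real.rpow_le_rpow (by positivity) h2 hε.le
        have h4 : ((B ^ (1 / ε)) ^ n) ^ ε = B ^ n := by
          rw [← Real.rpow_natCast, ← Real.rpow_natCast, ← Real.rpow_mul hB.le,
            ← Real.rpow_mul hB.le]
          congr 1; field_simp
        rw [h4] at h3
        have : B ^ n / G n ^ ε ≤ 1 := (div_le_one hGp).2 h3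
        linarith
    calc B ^ n = B ^ n / G n ^ ε * G n ^ ε := by field_simp
      _ ≤ _ := mul_le_mul hC hle hGp.le ((hq n).le.trans hC)

/-- The gap between d and d' absorbs the constant, as C r^(d'-d) tends to 0. -/
lemma upperBoxDim_le_of_coveringNumber_le {X : Type*} [MetricSpace X] {F : Set X} {C d d' : ℝ}
    (hd : d < d')
    (h : ∀ᶠ r : ℝ≥0 in 𝓝[>] 0,
      ((Metric.coveringNumber r F : ℕ∞) : ℝ≥0∞) ≤ ENNReal.ofReal (C * (r : ℝ) ^ (-d))) :
    upperBoxDim F ≤ ENNReal.ofReal d' := by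
  have hsmall : ∀ᶠ r : ℝ≥0 in 𝓝[>] 0, C * (r : ℝ) ^ (d' - d) ≤ 1 := by
    have h1 : Tendsto (fun r : ℝ≥0 => C * (r : ℝ) ^ (d' - d)) (𝓝[>] 0) (𝓝 0) := by
      have h2 : Tendsto (fun r : ℝ≥0 => (r : ℝ)) (𝓝[>] 0) (𝓝 0) := by
        have := (NNReal.continuous_coe.tendsto 0).mono_left (nhdsWithin_le_nhds (s := Set.Ioi 0))
        simpa using this
      have h3 := (h2.rpow_const (p := d' - d) (Or.inr (by linarith))).const_mul C
      rwa [Real.zero_rpow (by linarith), mul_zero] at h3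
    exact (h1.eventually (gt_mem_nhds zero_lt_one)).mono fun _ h => le_of_lt h
  have hlt1 : ∀ᶠ r : ℝ≥0 in 𝓝[>] 0, r < 1 :=
    (gt_mem_nhds (zero_lt_one : (0 : ℝ≥0) < 1)).filter_mono nhdsWithin_le_nhds
  refine limsup_le_of_le (by isBoundedDefault) ?_
  filter_upwards [h, hsmall, hlt1, self_mem_nhdsWithin] with r h1 h2 h3 h0
  have h0' : (0 : ℝ) < r := h0
  have hlog : 0 < -Real.log r := by
    have := Real.log_neg h0' (by exact_mod_cast h3)
    linarith
  have h4 : C * (r : ℝ) ^ (-d) ≤ (r : ℝ) ^ (-d') := by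
    have : (r : ℝ) ^ (-d) = (r : ℝ) ^ (d' - d) * (r : ℝ) ^ (-d') := by
      rw [← Real.rpow_add h0']; ring_nf
    rw [this, ← mul_assoc]
    exact mul_le_of_le_one_left (by positivity) h2
  have h5 := h1.trans (ENNReal.ofReal_le_ofReal h4)
  have h6 := ENNReal.log_le_log h5
  rw [ENNReal.log_ofReal_of_pos (by positivity), Real.log_rpow h0'] at h6
  rw [ENNReal.ofReal]
  have h7 : ENNReal.log ((Metric.coveringNumber r F : ℕ∞) : ℝ≥0∞) /
      ((-Real.log (r : ℝ) : ℝ) : EReal) ≤ ((d' : ℝ) : EReal) := by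
    refine (EReal.div_le_iff_le_mul (by exact_mod_cast hlog) (EReal.coe_ne_top _)).2 ?_
    refine h6.trans ?_
    rw [← EReal.coe_mul]
    exact_mod_cast (by ring_nf; rfl)
  simpa [ENNReal.ofReal] using EReal.toENNReal_le_toENNReal h7

lemma eventually_coveringNumber_le_of_upperBoxDim_lt {X : Type*} [MetricSpace X] {F : Set X}
    {d : ℝ} (h : upperBoxDim F < ENNReal.ofReal d) :
    ∀ᶠ r : ℝ≥0 in 𝓝[>] 0,
      ((Metric.coveringNumber r F : ℕ∞) : ℝ≥0∞) ≤ ENNReal.ofReal ((r : ℝ) ^ (-d)) := by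
  have hlt1 : ∀ᶠ r : ℝ≥0 in 𝓝[>] 0, r < 1 :=
    (gt_mem_nhds (zero_lt_one : (0 : ℝ≥0) < 1)).filter_mono nhdsWithin_le_nhds
  filter_upwards [eventually_lt_of_limsup_lt h, hlt1, self_mem_nhdsWithin] with r h1 h3 h0
  have h0' : (0 : ℝ) < r := h0
  have hlog : 0 < -Real.log r := by
    have := Real.log_neg h0' (by exact_mod_cast h3)
    linarith
  have h2 : ENNReal.log ((Metric.coveringNumber r F : ℕ∞) : ℝ≥0∞) /
      ((-Real.log (r : ℝ) : ℝ) : EReal) ≤ ((d : ℝ) : EReal) := by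
    by_contra hcon
    have := EReal.toENNReal_le_toENNReal (not_le.1 hcon).le
    rw [EReal.real_coe_toENNReal] at this
    exact absurd h1 (not_lt.2 this)
  rw [EReal.div_le_iff_le_mul (by exact_mod_cast hlog) (EReal.coe_ne_top _)] at h2
  rw [← ENNReal.log_le_log_iff, ENNReal.log_ofReal_of_pos (by positivity), Real.log_rpow h0']
  refine h2.trans ?_
  rw [← EReal.coe_mul]
  exact_mod_cast (by ring_nf; rfl)

end

/-! ### Hausdorff dimension bounded by class covers. -/

section
open MeasureTheory Set Metric

/-- Weight bounds are available for finite sets with at most one point per class. The partial sums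
of a series over classes, one representative each, are of this kind. -/
lemma tsum_ofReal_le_of_injOn {Z T : Type*} {τ : Z → T} {F : Set Z} {W : Z → ℝ} {K : ℝ}
    (hW0 : ∀ z ∈ F, 0 ≤ W z)
    (hW : ∀ S : Finset Z, (S : Set Z) ⊆ F → InjOn τ S → ∑ z ∈ S, W z ≤ K)
    {A : Set T} (rep : A → Z) (hrep : ∀ t, rep t ∈ F ∧ τ (rep t) = t) :
    ∑' t : A, ENNReal.ofReal (W (rep t)) ≤ ENNReal.ofReal K := by
  classical
  rw [ENNReal.tsum_eq_iSup_sum]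
  refine iSup_le fun s => ?_
  have hinj : InjOn rep s := fun t _ t' _ h => by
    have := (hrep t).2.symm.trans ((congrArg τ h).trans (hrep t').2)
    exact Subtype.ext this
  rw [← ENNReal.ofReal_sum_of_nonneg fun t _ => hW0 _ (hrep t).1]
  refine ENNReal.ofReal_le_ofReal ?_
  rw [← Finset.sum_image (f := W) hinj]
  refine hW _ ?_ ?_
  · intro z hz
    simp only [Finset.coe_image, mem_image] at hz
    obtain ⟨t, -, rfl⟩ := hz
    exact (hrep t).1
  · intro z hz z' hz' h
    simp only [Finset.coe_image, mem_image] at hz hz'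
    obtain ⟨t, -, rfl⟩ := hz
    obtain ⟨t', -, rfl⟩ := hz'
    rw [(hrep t).2, (hrep t').2] at h
    exact congrArg rep (Subtype.ext h)

/-- This is the cost of covering one class by balls of radius w. About 1/(P w) balls are needed
since w ≤ 1/P, so the cost is about w^t/P ≤ 1/(P M). The surplus power w^(t'-t) pays for the factor
(2K)^(-n), of which K^(-n) will cancel the total weight of the classes and 2^(-n) will make the
generations summable. -/
lemma card_mul_rpow_le {n : ℕ} {N P M w K C t t' : ℝ} (hK : 1 ≤ K) (hP : 0 < P) (hw : 0 < w)
    (hwP : w ≤ 1 / P) (hM : 0 < M) (hN : N ≤ K ^ n * (1 / (P * w) + 1) * (w / w + 1))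
    (hMw : M ≤ w ^ (-t)) (hC : (2 * K ^ 2) ^ n ≤ C * w ^ (-(t' - t))) :
    N * (2 * w) ^ (1 + t') ≤ 4 * 2 ^ (1 + t') * C * ((2 * K) ^ n)⁻¹ * (1 / (P * M)) := by
  have hK0 : 0 < K := by linarith
  have h1 : N ≤ 4 * K ^ n / (P * w) := by
    refine hN.trans ?_
    rw [div_self hw.ne']
    have : 1 ≤ 1 / (P * w) := by
      rw [le_div_iff₀ (by positivity)]
      rw [le_div_iff₀ hP] at hwP
      linarith
    have h2 : K ^ n * (1 / (P * w) + 1) * (1 + 1) ≤ K ^ n * (1 / (P * w) + 1 / (P * w)) * (1 + 1) := by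
      gcongr
    refine h2.trans (le_of_eq ?_)
    field_simp; ring
  have h2 : w ^ t ≤ 1 / M := by
    rw [le_div_iff₀ hM, mul_comm]
    rw [Real.rpow_neg hw.le, ← one_div, le_div_iff₀ (by positivity)] at hMw
    exact hMw
  have h3 : w ^ (t' - t) * (2 * K ^ 2) ^ n ≤ C := by
    rw [Real.rpow_neg hw.le, ← div_eq_mul_inv, le_div_iff₀ (by positivity)] at hC
    linarith
  have h4 : (2 * w) ^ (1 + t') = 2 ^ (1 + t') * (w * (w ^ (t' - t) * w ^ t)) := by
    rw [Real.mul_rpow (by norm_num) hw.le, ← Real.rpow_add hw]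
    congr 1
    nth_rw 2 [← Real.rpow_one w]
    rw [← Real.rpow_add hw]; ring_nf
  calc N * (2 * w) ^ (1 + t') ≤ 4 * K ^ n / (P * w) * (2 ^ (1 + t') * (w * (w ^ (t' - t) * (1 / M)))) := by
        rw [h4]; gcongr
    _ = 4 * 2 ^ (1 + t') * (w ^ (t' - t) * (2 * K ^ 2) ^ n) * ((2 * K) ^ n)⁻¹ * (1 / (P * M)) := by
        have : (2 * K ^ 2) ^ n = (2 * K) ^ n * K ^ n := by rw [← mul_pow]; ring
        rw [this]; field_simp
    _ ≤ _ := by gcongr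

/-- Here τ n labels the classes of generation n, which have size about w n by 1 / P n and weight 1 /
(P n * M n). A point has infinitely many good generations, those with M ≤ w^(-t), so the good
classes of all generations beyond any N cover F. Their total cost is bounded independently of N,
whence the (1+t')-dimensional measure is finite. -/
theorem dimH_le_of_class_covers {Z T : Type*} [MetricSpace Z] [Countable T] {F : Set Z}
    {τ : ℕ → Z → T} {P M w : ℕ → Z → ℝ} {G : ℕ → ℝ} {K t t' : ℝ} {n0 : ℕ}
    (hK : 1 ≤ K) (hG0 : ∀ n, 0 < G n) (hG : ∀ B : ℝ, ∀ᶠ n in atTop, B ^ n ≤ G n)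
    (hPG : ∀ n, n0 ≤ n → ∀ z ∈ F, G n ≤ P n z)
    (hw : ∀ n, n0 ≤ n → ∀ z ∈ F, 0 < w n z ∧ w n z ≤ 1 / P n z)
    (hM : ∀ n, n0 ≤ n → ∀ z ∈ F, 0 < M n z)
    (hW : ∀ n, n0 ≤ n → ∀ S : Finset Z, (S : Set Z) ⊆ F → InjOn (τ n) S →
      ∑ z ∈ S, 1 / (P n z * M n z) ≤ K ^ n)
    (hcov : ∀ n, n0 ≤ n → ∀ z ∈ F, ∀ r : ℝ, 0 < r → ∃ C : Finset Z, (C : Set Z) ⊆ F ∧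
      {z' ∈ F | τ n z' = τ n z} ⊆ ⋃ c ∈ C, closedBall c r ∧
      (C.card : ℝ) ≤ K ^ n * (1 / (P n z * r) + 1) * (w n z / r + 1))
    (htt : t < t') (ht' : 0 < t')
    (hφ : ∀ z ∈ F, ∃ᶠ n in atTop, M n z ≤ w n z ^ (-t)) :
    dimH F ≤ ENNReal.ofReal (1 + t') := by
  classical
  borelize Z
  set Fn : ℕ → Set Z := fun n => {z | z ∈ F ∧ n0 ≤ n ∧ M n z ≤ w n z ^ (-t)} with hFn
  have hA : ∀ n (a : τ n '' Fn n), ∃ z ∈ Fn n, τ n z = a := fun n a => a.2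
  choose rep hrepF hrepτ using hA
  have hC : ∀ n (a : τ n '' Fn n), ∃ C : Finset Z,
      {z' ∈ F | τ n z' = a} ⊆ ⋃ c ∈ C, closedBall c (w n (rep n a)) ∧
      (C.card : ℝ) ≤ K ^ n * (1 / (P n (rep n a) * w n (rep n a)) + 1) *
        (w n (rep n a) / w n (rep n a) + 1) := fun n a => by
    have hF := hrepF n a
    obtain ⟨C, -, h2, h3⟩ := hcov n hF.2.1 _ hF.1 _ (hw n hF.2.1 _ hF.1).1
    exact ⟨C, by rwa [hrepτ] at h2, h3⟩
  choose C hCcov hCcard using hC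
  obtain ⟨c, hc0, hc⟩ := exists_pow_le_of_superexponential hG0 hG
    -- K^n comes from the ball count, another K^n from the total weight, and 2^n is for summability
    -- over n.
    (B := 2 * K ^ 2) (by positivity) (sub_pos.2 htt)
  have hd : (0 : ℝ) ≤ 1 + t' := by linarith
  set D : ℝ := 4 * 2 ^ (1 + t') * c with hD
  have hD0 : 0 < D := by positivity
  -- The good generations of a point depend on the point, so the N-th cover has to use every
  -- generation n ≥ N.
  let ι : ℕ → Type _ := fun N => Σ n : {n // N ≤ n}, Σ a : τ n.1 '' Fn n.1, {y // y ∈ C n.1 a}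
  let B : ∀ N, ι N → Set Z := fun N i => closedBall i.2.2.1 (w i.1.1 (rep i.1.1 i.2.1))
  have hdiam : ∀ n (a : τ n '' Fn n) (y : Z), ediam (closedBall y (w n (rep n a))) ≤
      ENNReal.ofReal (2 * w n (rep n a)) := fun n a y => by
    have h0 := (hw n (hrepF n a).2.1 _ (hrepF n a).1).1.le
    rw [← closedEBall_ofReal h0, ENNReal.ofReal_mul (by norm_num)]
    simpa using ediam_closedEBall_le (x := y) (r := ENNReal.ofReal (w n (rep n a)))
  have hbound : μH[1 + t'] F ≤ liminf (fun N => ∑' i, ediam (B N i) ^ (1 + t')) atTop := by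
    refine Measure.hausdorffMeasure_le_liminf_tsum (1 + t') F
      (fun N => ENNReal.ofReal (2 * (1 / 2) ^ N)) ?_ B ?_ ?_
    · have : Tendsto (fun N : ℕ => 2 * (1 / 2 : ℝ) ^ N) atTop (𝓝 (2 * 0)) :=
        (tendsto_pow_atTop_nhds_zero_of_lt_one (by norm_num) (by norm_num)).const_mul 2
      simpa using ENNReal.tendsto_ofReal this
    · obtain ⟨N0, hN0⟩ := eventually_atTop.1 (hG 2)
      filter_upwards [eventually_ge_atTop N0] with N hN i
      refine (hdiam _ _ _).trans (ENNReal.ofReal_le_ofReal ?_)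
      obtain ⟨⟨n, hn⟩, a, y⟩ := i
      have hF := hrepF n a
      have h1 := (hw n hF.2.1 _ hF.1).2
      have h2 := hPG n hF.2.1 _ hF.1
      have h3 := hN0 n (hN.trans hn)
      simp only
      have h4 : (2 : ℝ) ^ N ≤ 2 ^ n := pow_le_pow_right₀ (by norm_num) hn
      have h5 : w n (rep n a) ≤ 1 / 2 ^ N :=
        h1.trans (one_div_le_one_div_of_le (by positivity) (h4.trans (h3.trans h2)))
      rw [one_div_pow]; linarith
    · refine Eventually.of_forall fun N z hz => ?_
      obtain ⟨n, hn, hzn⟩ := (frequently_atTop.1 (hφ z hz)) (max N n0)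
      have hzF : z ∈ Fn n := ⟨hz, (le_max_right _ _).trans hn, hzn⟩
      have := hCcov n ⟨τ n z, mem_image_of_mem _ hzF⟩ (show z ∈ _ from ⟨hz, rfl⟩)
      simp only [mem_iUnion] at this
      obtain ⟨y, hy, hzy⟩ := this
      exact mem_iUnion.2 ⟨⟨⟨n, (le_max_left _ _).trans hn⟩, ⟨τ n z, mem_image_of_mem _ hzF⟩,
        ⟨y, hy⟩⟩, hzy⟩
  have hsum : ∀ N, ∑' i, ediam (B N i) ^ (1 + t') ≤ ENNReal.ofReal D * 2 := fun N => by
    have hn : ∀ n, ∑' (a : τ n '' Fn n) (y : {y // y ∈ C n a}),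
        ediam (closedBall y.1 (w n (rep n a))) ^ (1 + t') ≤ ENNReal.ofReal D * 2⁻¹ ^ n := fun n => by
      by_cases hnn : n0 ≤ n
      · calc _ ≤ ∑' (a : τ n '' Fn n), ENNReal.ofReal (D * ((2 * K) ^ n)⁻¹) *
              ENNReal.ofReal (1 / (P n (rep n a) * M n (rep n a))) := by
              refine ENNReal.tsum_le_tsum fun a => ?_
              have hF := hrepF n a
              have hwp := hw n hnn _ hF.1
              have hPp := (hG0 n).trans_le (hPG n hnn _ hF.1)
              calc _ ≤ ∑' (y : {y // y ∈ C n a}),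
                  ENNReal.ofReal (2 * w n (rep n a)) ^ (1 + t') :=
                    ENNReal.tsum_le_tsum fun y =>
                      ENNReal.rpow_le_rpow (hdiam n a y) hd
                _ = ENNReal.ofReal ((C n a).card * (2 * w n (rep n a)) ^ (1 + t')) := by
                    rw [tsum_fintype]
                    simp only [Finset.sum_const, Finset.card_univ, Fintype.card_coe, nsmul_eq_mul]
                    rw [ENNReal.ofReal_rpow_of_nonneg (by linarith [hwp.1]) hd,
                      ENNReal.ofReal_mul (Nat.cast_nonneg _), ENNReal.ofReal_natCast]
                _ ≤ _ := by
                    rw [← ENNReal.ofReal_mul (by positivity)]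
                    refine ENNReal.ofReal_le_ofReal ?_
                    exact card_mul_rpow_le hK hPp hwp.1 hwp.2 (hM n hnn _ hF.1) (hCcard n a)
                      hF.2.2 (hc n _ hwp.1 (hwp.2.trans
                        (one_div_le_one_div_of_le (hG0 n) (hPG n hnn _ hF.1))))
          _ ≤ ENNReal.ofReal (D * ((2 * K) ^ n)⁻¹) * ENNReal.ofReal (K ^ n) := by
              rw [ENNReal.tsum_mul_left]
              gcongr
              refine tsum_ofReal_le_of_injOn (τ := τ n) (F := F)
                (W := fun z => 1 / (P n z * M n z)) (fun z hz => ?_)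
                (hW n hnn) (rep n) (fun a => ⟨(hrepF n a).1, hrepτ n a⟩)
              have := (hG0 n).trans_le (hPG n hnn _ hz)
              have := hM n hnn _ hz
              positivity
          _ = _ := by
              rw [← ENNReal.ofReal_mul (by positivity)]
              rw [show D * ((2 * K) ^ n)⁻¹ * K ^ n = D * (2⁻¹ : ℝ) ^ n by
                rw [mul_pow, inv_pow]; field_simp]
              rw [ENNReal.ofReal_mul hD0.le, ENNReal.ofReal_pow (by norm_num),
                ENNReal.ofReal_inv_of_pos (by norm_num)]
              norm_num
      · have : IsEmpty (τ n '' Fn n) := ⟨fun a => hnn (hrepF n a).2.1⟩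
        simp
    calc ∑' i, ediam (B N i) ^ (1 + t') = ∑' (n : {n // N ≤ n}) (a : τ n.1 '' Fn n.1)
          (y : {y // y ∈ C n.1 a}), ediam (closedBall y.1 (w n.1 (rep n.1 a))) ^ (1 + t') := by
          refine (ENNReal.tsum_sigma' _).trans (tsum_congr fun n => ?_)
          exact ENNReal.tsum_sigma' _
      _ ≤ ∑' (n : {n // N ≤ n}), ENNReal.ofReal D * 2⁻¹ ^ n.1 :=
          ENNReal.tsum_le_tsum fun n => hn n.1
      _ ≤ ∑' (n : ℕ), ENNReal.ofReal D * 2⁻¹ ^ n :=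
          ENNReal.tsum_comp_le_tsum_of_injective Subtype.val_injective _
      _ = _ := by
          rw [ENNReal.tsum_mul_left, ENNReal.tsum_geometric, ENNReal.one_sub_inv_two, inv_inv]
  have hfin : μH[((⟨1 + t', hd⟩ : ℝ≥0) : ℝ)] F ≠ ∞ := by
    refine ne_top_of_le_ne_top (b := ENNReal.ofReal D * 2) (by finiteness) ?_
    refine hbound.trans ?_
    exact liminf_le_of_le (by isBoundedDefault) fun b hb => by
      obtain ⟨N, hN⟩ := hb.exists
      exact hN.trans (hsum N)
  refine (dimH_le_of_hausdorffMeasure_ne_top hfin).trans (le_of_eq ?_)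
  rw [ENNReal.ofReal, Real.toNNReal_of_nonneg hd]
  rfl

end

/-! ### Upper box dimension bounded by class covers. -/

section
open MeasureTheory Set Metric

/-- For 1/P' ≤ r < 1/P the count is at most about (1/(P r)) (w/r + 1), and both terms of the
bracket, multiplied by M, are at most r^(-t). For the term 1 this is M ≤ P^t ≤ r^(-t). For the
other, w M = M'/P' ≤ (1/P')^(1-t) ≤ r^(1-t), which uses t ≤ 1. -/
lemma card_le_of_between {n : ℕ} {N P M w P' M' K t r : ℝ} (hK : 1 ≤ K) (hP : 0 < P)
    (hP' : 0 < P') (hM : 0 < M) (hr : 0 < r) (hw : 0 < w)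
    (hN : N ≤ K ^ n * (1 / (P * r) + 1) * (w / r + 1)) (hrP : r < 1 / P) (hrP' : 1 / P' ≤ r)
    (ht0 : 0 ≤ t) (ht1 : t ≤ 1) (hMP : M ≤ P ^ t) (hMP' : M' ≤ P' ^ t)
    (hwM : w * M = M' / P') :
    N ≤ 4 * K ^ n * r ^ (-(1 + t)) * (1 / (P * M)) := by
  have hK0 : 0 < K := by linarith
  have h1 : 1 ≤ 1 / (P * r) := by
    rw [le_div_iff₀ (by positivity)]
    rw [lt_div_iff₀ hP] at hrP
    linarith
  have h2 : M ≤ r ^ (-t) := by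
    refine hMP.trans ?_
    rw [Real.rpow_neg hr.le, ← Real.inv_rpow hr.le]
    refine Real.rpow_le_rpow hP.le ?_ ht0
    rw [le_inv_comm₀ hP hr]; simpa using hrP.le
  have h3 : w * M / r ≤ r ^ (-t) := by
    rw [hwM, div_le_iff₀ hr]
    have h4 : M' / P' ≤ (1 / P') ^ (1 - t) := by
      rw [one_div, Real.inv_rpow hP'.le, ← Real.rpow_neg hP'.le, neg_sub, Real.rpow_sub hP',
        Real.rpow_one]
      gcongr
    refine (h4.trans (Real.rpow_le_rpow (by positivity) hrP' (by linarith))).trans (le_of_eq ?_)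
    nth_rw 3 [← Real.rpow_one r]
    rw [← Real.rpow_add hr]; ring_nf
  have h5 : r ^ (-(1 + t)) = r ^ (-t) / r := by
    rw [neg_add, add_comm, ← sub_eq_add_neg, Real.rpow_sub hr, Real.rpow_one]
  calc N ≤ K ^ n * (1 / (P * r) + 1 / (P * r)) * (w / r + 1) := by
        refine hN.trans ?_
        gcongr
    _ = 2 * K ^ n / r * (1 / (P * M)) * (w * M / r + M) := by field_simp; ring
    _ ≤ 2 * K ^ n / r * (1 / (P * M)) * (r ^ (-t) + r ^ (-t)) := by gcongr
    _ = _ := by rw [h5]; ring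

/-- At a given scale r each point is treated in its own generation n, determined by 1/P_{n+1} ≤ r <
1/P_n. The uniform bound `hL` at the starting generation guarantees n ≥ n0 for all points at once as
soon as r is small. -/
theorem upperBoxDim_le_of_class_covers {Z T : Type*} [MetricSpace Z] [Countable T] {F : Set Z}
    {τ : ℕ → Z → T} {P M w : ℕ → Z → ℝ} {G : ℕ → ℝ} {K t t' L : ℝ} {n0 : ℕ}
    (hK : 1 ≤ K) (hG0 : ∀ n, 0 < G n) (hG : ∀ B : ℝ, ∀ᶠ n in atTop, B ^ n ≤ G n)
    (hPG : ∀ n, n0 ≤ n → ∀ z ∈ F, G n ≤ P n z)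
    (hw : ∀ n, n0 ≤ n → ∀ z ∈ F, 0 < w n z ∧ w n z ≤ 1 / P n z)
    (hM : ∀ n, n0 ≤ n → ∀ z ∈ F, 0 < M n z)
    (hW : ∀ n, n0 ≤ n → ∀ S : Finset Z, (S : Set Z) ⊆ F → InjOn (τ n) S →
      ∑ z ∈ S, 1 / (P n z * M n z) ≤ K ^ n)
    (hcov : ∀ n, n0 ≤ n → ∀ z ∈ F, ∀ r : ℝ, 0 < r → ∃ C : Finset Z, (C : Set Z) ⊆ F ∧
      {z' ∈ F | τ n z' = τ n z} ⊆ ⋃ c ∈ C, closedBall c r ∧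
      (C.card : ℝ) ≤ K ^ n * (1 / (P n z * r) + 1) * (w n z / r + 1))
    (hwM : ∀ n, n0 ≤ n → ∀ z ∈ F, w n z * M n z = M (n + 1) z / P (n + 1) z)
    (ht0 : 0 ≤ t) (ht1 : t ≤ 1) (htt : t < t')
    (hψ : ∀ n, n0 ≤ n → ∀ z ∈ F, M n z ≤ P n z ^ t)
    (hL : ∀ z ∈ F, P n0 z ≤ L) :
    upperBoxDim F ≤ ENNReal.ofReal (1 + t') := by
  classical
  set ε : ℝ := (t' - t) / 2 with hε
  have hε0 : 0 < ε := by linarith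
  obtain ⟨c, hc0, hc⟩ := exists_pow_le_of_superexponential hG0 hG
    (B := 2 * K ^ 2) (by positivity) hε0
  refine upperBoxDim_le_of_coveringNumber_le (C := 8 * c) (d := 1 + t + ε) (by linarith) ?_
  have hrL : ∀ᶠ r : ℝ≥0 in 𝓝[>] 0, (r : ℝ) < 1 / (max L 1) := by
    have h2 : Tendsto (fun r : ℝ≥0 => (r : ℝ)) (𝓝[>] 0) (𝓝 0) := by
      have := (NNReal.continuous_coe.tendsto 0).mono_left (nhdsWithin_le_nhds (s := Set.Ioi 0))
      simpa using this
    exact h2.eventually (gt_mem_nhds (by positivity))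
  filter_upwards [hrL, self_mem_nhdsWithin] with r hrL hr0'
  have hr0 : (0 : ℝ) < r := hr0'
  have hPpos : ∀ n, n0 ≤ n → ∀ z ∈ F, 0 < P n z := fun n hn z hz =>
    (hG0 n).trans_le (hPG n hn z hz)
  set Fn : ℕ → Set Z := fun n =>
    {z | z ∈ F ∧ n0 ≤ n ∧ 1 / P (n + 1) z ≤ r ∧ (r : ℝ) < 1 / P n z} with hFn
  have hA : ∀ n (a : τ n '' Fn n), ∃ z ∈ Fn n, τ n z = a := fun n a => a.2
  choose rep hrepF hrepτ using hA
  have hC : ∀ n (a : τ n '' Fn n), ∃ C : Finset Z, (C : Set Z) ⊆ F ∧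
      {z' ∈ F | τ n z' = a} ⊆ ⋃ c ∈ C, closedBall c r ∧
      (C.card : ℝ) ≤ K ^ n * (1 / (P n (rep n a) * r) + 1) *
        (w n (rep n a) / r + 1) := fun n a => by
    have hF := hrepF n a
    obtain ⟨C, h1, h2, h3⟩ := hcov n hF.2.1 _ hF.1 _ hr0
    exact ⟨C, h1, by rwa [hrepτ] at h2, h3⟩
  choose C hCF hCcov hCcard using hC
  have hcover : F ⊆ ⋃ n, ⋃ a : τ n '' Fn n, ⋃ y ∈ C n a, closedBall y r := fun z hz => by
    have hex : ∃ n, n0 ≤ n ∧ 1 / P n z ≤ r := by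
      obtain ⟨N, hN⟩ := eventually_atTop.1 (hG 2)
      obtain ⟨k, hk⟩ := exists_pow_lt_of_lt_one hr0 (show (1 / 2 : ℝ) < 1 by norm_num)
      refine ⟨max n0 (max N k), le_max_left _ _, ?_⟩
      set n := max n0 (max N k)
      have h1 := hN n ((le_max_left _ _).trans (le_max_right _ _))
      have h2 := hPG n (le_max_left _ _) z hz
      have h3 : (2 : ℝ) ^ k ≤ 2 ^ n :=
        pow_le_pow_right₀ (by norm_num) ((le_max_right _ _).trans (le_max_right _ _))
      have h4 : 1 / P n z ≤ 1 / 2 ^ k :=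
        one_div_le_one_div_of_le (by positivity) (h3.trans (h1.trans h2))
      rw [← one_div_pow] at h4
      linarith
    have hspec := Nat.find_spec hex
    -- Since r < 1 / max L 1 ≤ 1 / P n0 z, the first generation finer than r is not n0, and its
    -- predecessor is the generation wanted.
    have hne : Nat.find hex ≠ n0 := fun h => by
      rw [h] at hspec
      have h1 : P n0 z ≤ max L 1 := (hL z hz).trans (le_max_left _ _)
      have h2 := one_div_le_one_div_of_le (hPpos n0 le_rfl z hz) h1
      linarith [hspec.2]
    obtain ⟨n, hn⟩ : ∃ n, Nat.find hex = n + 1 :=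
      Nat.exists_eq_succ_of_ne_zero (by omega)
    have hn0 : n0 ≤ n := by omega
    have hmin := Nat.find_min hex (m := n) (by omega)
    push Not at hmin
    rw [hn] at hspec
    have hzF : z ∈ Fn n := ⟨hz, hn0, hspec.2, hmin hn0⟩
    have := hCcov n ⟨τ n z, mem_image_of_mem _ hzF⟩ (show z ∈ _ from ⟨hz, rfl⟩)
    exact mem_iUnion.2 ⟨n, mem_iUnion.2 ⟨_, this⟩⟩
  set U : Set Z := ⋃ n, ⋃ a : τ n '' Fn n, (C n a : Set Z) with hU
  have hcn : coveringNumber r F ≤ U.encard := by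
    refine IsCover.coveringNumber_le_encard ?_ ?_
    · exact iUnion_subset fun n => iUnion_subset fun a => hCF n a
    · rw [isCover_iff_subset_iUnion_closedBall]
      refine hcover.trans ?_
      refine iUnion_subset fun n => iUnion_subset fun a => iUnion₂_subset fun y hy => ?_
      exact subset_biUnion_of_mem (u := fun y => closedBall y (r : ℝ))
        (mem_iUnion.2 ⟨n, mem_iUnion.2 ⟨a, hy⟩⟩)
  have hcount : ((U.encard : ℕ∞) : ℝ≥0∞) ≤ ∑' n, ∑' a : τ n '' Fn n, ((C n a).card : ℝ≥0∞) := by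
    -- Counting measure on the discrete σ-algebra turns countable subadditivity into a bound for the
    -- cardinality of the union.
    let _ : MeasurableSpace Z := ⊤
    rw [← Measure.count_apply MeasurableSpace.measurableSet_top]
    refine (measure_iUnion_le _).trans (ENNReal.tsum_le_tsum fun n => ?_)
    refine (measure_iUnion_le _).trans (ENNReal.tsum_le_tsum fun a => ?_)
    rw [Measure.count_apply MeasurableSpace.measurableSet_top]
    simp
  set D : ℝ := 4 * c * (r : ℝ) ^ (-(1 + t + ε)) with hD
  have hD0 : 0 ≤ D := by positivity
  have hn : ∀ n, ∑' (a : τ n '' Fn n), ((C n a).card : ℝ≥0∞) ≤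
      ENNReal.ofReal D * 2⁻¹ ^ n := fun n => by
    by_cases hnn : n0 ≤ n
    · calc _ ≤ ∑' (a : τ n '' Fn n), ENNReal.ofReal (D * ((2 * K) ^ n)⁻¹) *
            ENNReal.ofReal (1 / (P n (rep n a) * M n (rep n a))) := by
            refine ENNReal.tsum_le_tsum fun a => ?_
            have hF := hrepF n a
            have hPp := hPpos n hnn _ hF.1
            have hMp := hM n hnn _ hF.1
            rw [← ENNReal.ofReal_mul (by positivity), ← ENNReal.ofReal_natCast]
            refine ENNReal.ofReal_le_ofReal ?_
            refine (card_le_of_between hK hPp (hPpos (n + 1) (by omega) _ hF.1) hMp hr0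
              (hw n hnn _ hF.1).1 (hCcard n a) hF.2.2.2 hF.2.2.1 ht0 ht1 (hψ n hnn _ hF.1)
              (hψ (n + 1) (by omega) _ hF.1) (hwM n hnn _ hF.1)).trans ?_
            have h1 := hc n r hr0 (hF.2.2.2.le.trans
              (one_div_le_one_div_of_le (hG0 n) (hPG n hnn _ hF.1)))
            have h2 : K ^ n ≤ c * (r : ℝ) ^ (-ε) * ((2 * K) ^ n)⁻¹ := by
              rw [← div_eq_mul_inv, le_div_iff₀ (by positivity), ← mul_pow]
              refine le_trans (le_of_eq ?_) h1
              congr 1; ring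
            have h3 : (r : ℝ) ^ (-(1 + t + ε)) = (r : ℝ) ^ (-(1 + t)) * (r : ℝ) ^ (-ε) := by
              rw [← Real.rpow_add hr0]; ring_nf
            calc 4 * K ^ n * (r : ℝ) ^ (-(1 + t)) * (1 / (P n (rep n a) * M n (rep n a)))
                ≤ 4 * (c * (r : ℝ) ^ (-ε) * ((2 * K) ^ n)⁻¹) * (r : ℝ) ^ (-(1 + t)) *
                  (1 / (P n (rep n a) * M n (rep n a))) := by gcongr
              _ = _ := by rw [hD, h3]; ring
        _ ≤ ENNReal.ofReal (D * ((2 * K) ^ n)⁻¹) * ENNReal.ofReal (K ^ n) := by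
            rw [ENNReal.tsum_mul_left]
            gcongr
            refine tsum_ofReal_le_of_injOn (τ := τ n) (F := F)
              (W := fun z => 1 / (P n z * M n z)) (fun z hz => ?_)
              (hW n hnn) (rep n) (fun a => ⟨(hrepF n a).1, hrepτ n a⟩)
            have := hPpos n hnn _ hz
            have := hM n hnn _ hz
            positivity
        _ = _ := by
            rw [← ENNReal.ofReal_mul (by positivity)]
            rw [show D * ((2 * K) ^ n)⁻¹ * K ^ n = D * (2⁻¹ : ℝ) ^ n by
              rw [mul_pow, inv_pow]; field_simp]
            rw [ENNReal.ofReal_mul hD0, ENNReal.ofReal_pow (by norm_num),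
              ENNReal.ofReal_inv_of_pos (by norm_num)]
            norm_num
    · have : IsEmpty (τ n '' Fn n) := ⟨fun a => hnn (hrepF n a).2.1⟩
      simp
  calc ((coveringNumber r F : ℕ∞) : ℝ≥0∞) ≤ ((U.encard : ℕ∞) : ℝ≥0∞) := by exact_mod_cast hcn
    _ ≤ _ := hcount
    _ ≤ ∑' n, ENNReal.ofReal D * 2⁻¹ ^ n := ENNReal.tsum_le_tsum hn
    _ = ENNReal.ofReal D * ENNReal.ofReal 2 := by
        rw [ENNReal.tsum_mul_left, ENNReal.tsum_geometric, ENNReal.one_sub_inv_two, inv_inv]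
        norm_num
    _ = _ := by
        rw [← ENNReal.ofReal_mul hD0]
        congr 1; rw [hD]; ring

end

/-! ### Mass distribution principles for Hausdorff and packing dimension. -/

section
open MeasureTheory Set Metric

/-- Mass distribution principle. -/
lemma measure_le_mul_hausdorffMeasure {Z : Type*} [MetricSpace Z] [MeasurableSpace Z]
    [BorelSpace Z] {μ : Measure Z} {E : Set Z} {C d r0 : ℝ} (hC : 0 < C) (hd : 0 < d)
    (hr0 : 0 < r0)
    (h : ∀ z ∈ E, ∀ r, 0 < r → r ≤ r0 → μ (closedBall z r) ≤ ENNReal.ofReal (C * r ^ d)) :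
    μ E ≤ ENNReal.ofReal C * μH[d] E := by
  rw [mul_comm, ← ENNReal.div_le_iff (by simpa using hC) (by simp), Measure.hausdorffMeasure_apply]
  refine le_iSup₂_of_le (ENNReal.ofReal r0) (by simpa using hr0) ?_
  refine le_iInf fun t => le_iInf fun ht => le_iInf fun hdiam => ?_
  rw [ENNReal.div_le_iff (by simpa using hC) (by simp), mul_comm, ← ENNReal.tsum_mul_left]
  have hcov : E ⊆ ⋃ n, t n ∩ E := fun z hz => by
    obtain ⟨n, hn⟩ := mem_iUnion.1 (ht hz)
    exact mem_iUnion.2 ⟨n, hn, hz⟩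
  refine (measure_mono hcov).trans ((measure_iUnion_le _).trans (ENNReal.tsum_le_tsum fun n => ?_))
  rcases (t n ∩ E).eq_empty_or_nonempty with hemp | ⟨z, hzt, hzE⟩
  · simp [hemp]
  have hne : (t n).Nonempty := ⟨z, hzt⟩
  simp only [hne, iSup_pos]
  have hfin : ediam (t n) ≠ ∞ := ne_top_of_le_ne_top ENNReal.ofReal_ne_top (hdiam n)
  have hsub : ∀ r : ℝ, ediam (t n) ≤ ENNReal.ofReal r → 0 < r → t n ∩ E ⊆ closedBall z r :=
    fun r hr hr' y hy => by
      rw [mem_closedBall, dist_edist]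
      exact ENNReal.toReal_le_of_le_ofReal hr'.le ((edist_le_ediam_of_mem hy.1 hzt).trans hr)
  rcases eq_or_ne (ediam (t n)) 0 with h0 | h0
  -- A covering set of diameter zero contributes nothing, so its trace on E must be shown to be
  -- null: it lies in balls of radius r about z for every r, and their mass tends to 0.
  · rw [h0, ENNReal.zero_rpow_of_pos hd, mul_zero]
    have hlim : Tendsto (fun r : ℝ => ENNReal.ofReal (C * r ^ d)) (𝓝[>] 0) (𝓝 0) := by
      have h1 : Tendsto (fun r : ℝ => C * r ^ d) (𝓝[>] 0) (𝓝 (C * (0 : ℝ) ^ d)) :=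
        ((tendsto_id.mono_left nhdsWithin_le_nhds).rpow_const (Or.inr hd.le)).const_mul C
      rw [Real.zero_rpow hd.ne', mul_zero] at h1
      simpa using ENNReal.tendsto_ofReal h1
    refine ge_of_tendsto hlim ?_
    filter_upwards [self_mem_nhdsWithin, Ioo_mem_nhdsGT hr0] with r hr hr'
    exact (measure_mono (hsub r (by simp [h0]) hr)).trans (h z hzE r hr hr'.2.le)
  · set ρ := (ediam (t n)).toReal with hρ
    have hρ0 : 0 < ρ := ENNReal.toReal_pos h0 hfin
    have hρe : ediam (t n) = ENNReal.ofReal ρ := (ENNReal.ofReal_toReal hfin).symm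
    have hρr : ρ ≤ r0 := ENNReal.toReal_le_of_le_ofReal hr0.le (hdiam n)
    rw [hρe, ENNReal.ofReal_rpow_of_pos hρ0, ← ENNReal.ofReal_mul hC.le]
    exact (measure_mono (hsub ρ hρe.le hρ0)).trans (h z hzE ρ hρ0 hρr)

/-- This is a Borel–Cantelli argument. Let S j be the set of points of F ∩ E whose ball of dyadic
radius s j has small mass. Covering F at half that scale gives μ (S j) at most a constant times
2^(-j(d-d')), which is summable, while every point of F ∩ E lies in infinitely many S j. -/
lemma measure_inter_eq_zero_of_upperBoxDim_lt {Z : Type*} [MetricSpace Z] [MeasurableSpace Z]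
    {μ : Measure Z} {E F : Set Z} {C d d' : ℝ} (hC : 0 < C) (hd : 0 ≤ d) (hdd : d' < d)
    (h : ∀ z ∈ E, ∀ ρ, 0 < ρ → ∃ r, 0 < r ∧ r < ρ ∧
      μ (closedBall z r) ≤ ENNReal.ofReal (C * r ^ d))
    (hF : upperBoxDim F < ENNReal.ofReal d') : μ (F ∩ E) = 0 := by
  classical
  set s : ℕ → ℝ := fun j => (1 / 2) ^ j with hs
  have hs0 : ∀ j, 0 < s j := fun j => by positivity
  have hev := eventually_coveringNumber_le_of_upperBoxDim_lt hF
  obtain ⟨J, hJ⟩ : ∃ J : ℕ, ∀ j, J ≤ j →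
      ((coveringNumber (Real.toNNReal (s j)) F : ℕ∞) : ℝ≥0∞) ≤ ENNReal.ofReal (s j ^ (-d')) := by
    have h1 : Tendsto (fun j => Real.toNNReal (s j)) atTop (𝓝[>] 0) := by
      refine tendsto_nhdsWithin_iff.2 ⟨?_, Eventually.of_forall fun j => by simp [hs]⟩
      have := tendsto_real_toNNReal (tendsto_pow_atTop_nhds_zero_of_lt_one
        (show (0 : ℝ) ≤ 1 / 2 by norm_num) (by norm_num))
      rwa [Real.toNNReal_zero] at this
    obtain ⟨J, hJ⟩ := eventually_atTop.1 (h1.eventually hev)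
    refine ⟨J, fun j hj => ?_⟩
    have := hJ j hj
    rwa [Real.coe_toNNReal _ (hs0 j).le] at this
  -- The factor 2^d is the price of replacing a good radius r by the dyadic radius in [r/2, r].
  set S : ℕ → Set Z := fun j =>
    {z ∈ F ∩ E | μ (closedBall z (s j)) ≤ ENNReal.ofReal (C * 2 ^ d * s j ^ d)} with hS
  have hSμ : ∀ j, J ≤ j → μ (S j) ≤
      ENNReal.ofReal (C * 2 ^ d * 2 ^ d') * ENNReal.ofReal ((1 / 2) ^ (d - d')) ^ j := fun j hj => by
    have hN := hJ (j + 1) (by omega)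
    have hne : coveringNumber (Real.toNNReal (s (j + 1))) F ≠ ⊤ := fun h => by
      rw [h] at hN; simp at hN
    obtain ⟨D, -, hDf, hDc, hDe⟩ := exists_set_encard_eq_coveringNumber hne
    rw [isCover_iff_subset_iUnion_closedBall, Real.coe_toNNReal _ (hs0 _).le] at hDc
    have hsub : S j ⊆ ⋃ y ∈ D, (closedBall y (s (j + 1)) ∩ S j) := fun z hz => by
      have := hDc hz.1.1
      simp only [mem_iUnion] at this ⊢
      obtain ⟨y, hy, hzy⟩ := this
      exact ⟨y, hy, hzy, hz⟩
    -- A ball of half the radius that meets S j in z is contained in the ball of radius s j about z.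
    have hball : ∀ y, μ (closedBall y (s (j + 1)) ∩ S j) ≤ ENNReal.ofReal (C * 2 ^ d * s j ^ d) :=
      fun y => by
        rcases (closedBall y (s (j + 1)) ∩ S j).eq_empty_or_nonempty with hemp | ⟨z, hzy, hzS⟩
        · simp [hemp]
        refine (measure_mono ?_).trans hzS.2
        intro x hx
        have h1 := hx.1
        rw [mem_closedBall] at h1 hzy ⊢
        have h2 : s (j + 1) = s j / 2 := by simp only [hs, pow_succ]; ring
        have h3 := dist_triangle_right x z y
        linarith
    calc μ (S j) ≤ μ (⋃ y ∈ D, (closedBall y (s (j + 1)) ∩ S j)) := measure_mono hsub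
      _ ≤ ∑ y ∈ hDf.toFinset, μ (closedBall y (s (j + 1)) ∩ S j) := by
          have := measure_biUnion_finset_le (μ := μ) hDf.toFinset
            (fun y => closedBall y (s (j + 1)) ∩ S j)
          simpa using this
      _ ≤ ∑ y ∈ hDf.toFinset, ENNReal.ofReal (C * 2 ^ d * s j ^ d) :=
          Finset.sum_le_sum fun y _ => hball y
      _ = ((coveringNumber (Real.toNNReal (s (j + 1))) F : ℕ∞) : ℝ≥0∞) *
            ENNReal.ofReal (C * 2 ^ d * s j ^ d) := by
          rw [Finset.sum_const, nsmul_eq_mul, ← hDe, hDf.encard_eq_coe_toFinset_card]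
          simp
      _ ≤ ENNReal.ofReal (s (j + 1) ^ (-d')) * ENNReal.ofReal (C * 2 ^ d * s j ^ d) := by gcongr
      _ = _ := by
          have := hs0 j
          have := hs0 (j + 1)
          rw [← ENNReal.ofReal_pow (by positivity), ← ENNReal.ofReal_mul (by positivity),
            ← ENNReal.ofReal_mul (by positivity)]
          congr 1
          have h2 : s (j + 1) = 2⁻¹ * s j := by simp only [hs, pow_succ]; ring
          rw [h2, Real.mul_rpow (by norm_num) (hs0 j).le, Real.inv_rpow (by norm_num),
            ← Real.rpow_neg (by norm_num), neg_neg]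
          have h3 : (((1 : ℝ) / 2) ^ (d - d')) ^ j = s j ^ d * s j ^ (-d') := by
            rw [← Real.rpow_add (hs0 j), ← sub_eq_add_neg]
            change _ = ((1 / 2 : ℝ) ^ j) ^ (d - d')
            rw [← Real.rpow_natCast,
              ← Real.rpow_mul (by norm_num), ← Real.rpow_natCast, ← Real.rpow_mul (by norm_num),
              mul_comm]
          rw [h3]; ring
  have hlim : F ∩ E ⊆ limsup (fun j => S (j + J)) atTop := fun z hz => by
    rw [mem_limsup_iff_frequently_mem, frequently_atTop]
    intro N
    obtain ⟨r, hr0, hr1, hr⟩ := h z hz.2 (s (N + J)) (hs0 _)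
    have hr1' : r ≤ 1 := hr1.le.trans (pow_le_one₀ (by norm_num) (by norm_num))
    obtain ⟨j, hj1, hj2⟩ := exists_nat_pow_near_of_lt_one hr0 hr1' (show (0 : ℝ) < 1 / 2 by norm_num)
      (by norm_num)
    have hjN : N + J < j + 1 := by
      by_contra hcon
      have := pow_le_pow_of_le_one (show (0 : ℝ) ≤ 1 / 2 by norm_num) (by norm_num) (not_lt.1 hcon)
      exact absurd (hj1.trans hr1) (not_lt.2 this)
    refine ⟨j + 1 - J, by omega, ?_⟩
    rw [show j + 1 - J + J = j + 1 by omega]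
    refine ⟨hz, (measure_mono (closedBall_subset_closedBall (by exact hj1.le))).trans
      (hr.trans (ENNReal.ofReal_le_ofReal ?_))⟩
    rw [mul_assoc, ← Real.mul_rpow (by norm_num) (hs0 _).le]
    have : r ≤ 2 * s (j + 1) := by
      refine hj2.trans (le_of_eq ?_)
      simp only [hs, pow_succ]; ring
    gcongr
  refine measure_mono_null hlim (measure_limsup_atTop_eq_zero (ne_top_of_le_ne_top ?_
    (ENNReal.tsum_le_tsum fun j => hSμ (j + J) (by omega))))
  have hlt : ENNReal.ofReal ((1 / 2 : ℝ) ^ (d - d')) < 1 := by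
    rw [ENNReal.ofReal_lt_one]
    exact Real.rpow_lt_one (by norm_num) (by norm_num) (by linarith)
  rw [ENNReal.tsum_mul_left]
  refine ENNReal.mul_ne_top ENNReal.ofReal_ne_top ?_
  simp_rw [pow_add]
  rw [ENNReal.tsum_mul_right, ENNReal.tsum_geometric]
  refine ENNReal.mul_ne_top (ENNReal.inv_ne_top.2 ?_) (by finiteness)
  exact (tsub_pos_of_lt hlt).ne'

/-- If some countable cover of A had box dimensions with supremum below d', each member would meet E
in a null set, and E would be null. -/
lemma le_packingDim_of_measure {Z : Type*} [MetricSpace Z] [MeasurableSpace Z]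
    {μ : Measure Z} {E A : Set Z} {C d d' : ℝ} (hC : 0 < C) (hd : 0 ≤ d) (hdd : d' < d)
    (hEA : E ⊆ A) (hE : μ E ≠ 0)
    (h : ∀ z ∈ E, ∀ ρ, 0 < ρ → ∃ r, 0 < r ∧ r < ρ ∧
      μ (closedBall z r) ≤ ENNReal.ofReal (C * r ^ d)) :
    ENNReal.ofReal d' ≤ packingDim A := by
  refine le_iInf₂ fun F hF => ?_
  by_contra hcon
  refine hE (measure_mono_null (t := ⋃ i, F i ∩ E) ?_ (measure_iUnion_null fun i => ?_))
  · intro z hz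
    obtain ⟨i, hi⟩ := mem_iUnion.1 (hF (hEA hz))
    exact mem_iUnion.2 ⟨i, hi, hz⟩
  · exact measure_inter_eq_zero_of_upperBoxDim_lt hC hd hdd h
      ((le_iSup (fun i => upperBoxDim (F i)) i).trans_lt (not_le.1 hcon))

end

/-! ### Dimension bounds from estimates of the mass of balls. -/

section
open MeasureTheory Set Metric

/-- Up to powers of K the summands 1 are absorbed by P' r and P' min(r, w), both of which are at
least K^(-(n+1)). What remains is r min(r, w) / (w M), and 1/M is at most K^n w^t. Finally w^t
min(r, w) / w ≤ r^t: for r ≤ w because t ≤ 1, for w ≤ r because t ≥ 0. -/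
lemma ball_mass_le {n : ℕ} {K M w P' M' t r : ℝ} (hK : 1 ≤ K) (hP' : 0 < P') (hM : 0 < M)
    (hr : 0 < r) (hw : 0 < w) (hKr : 1 / P' < K ^ (n + 1) * r) (hm : 1 / K ≤ w * P')
    (hwM : w * M = M' / P') (ht0 : 0 ≤ t) (ht1 : t ≤ 1) (hMw : w ^ (-t) ≤ K ^ n * M) :
    K ^ n * (1 + P' * r) * (1 + min (P' * r) (w * P')) / (P' * M') ≤
      4 * K ^ 2 * (K ^ 4) ^ n * r ^ (1 + t) := by
  have hK0 : 0 < K := by linarith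
  have hR : 1 ≤ K ^ (n + 1) * (P' * r) := by
    rw [div_lt_iff₀ hP'] at hKr
    linarith
  have hm1 : 1 ≤ K ^ (n + 1) * (w * P') := by
    rw [div_le_iff₀ hK0] at hm
    have : K ≤ K ^ (n + 1) := le_self_pow₀ hK (by omega)
    calc 1 ≤ w * P' * K := hm
      _ ≤ w * P' * K ^ (n + 1) := by gcongr
      _ = _ := by ring
  have hmin : 1 ≤ K ^ (n + 1) * min (P' * r) (w * P') := by
    rw [mul_min_of_nonneg _ _ (by positivity)]
    exact le_min hR hm1
  have hM' : M' = w * M * P' := by rw [hwM]; field_simp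
  have hmin' : min (P' * r) (w * P') = P' * min r w := by
    rw [mul_comm w, mul_min_of_nonneg _ _ hP'.le]
  have hminr : 0 < min r w := lt_min hr hw
  have h1 : 1 / M ≤ K ^ n * w ^ t := by
    rw [Real.rpow_neg hw.le, ← one_div, div_le_iff₀ (by positivity)] at hMw
    rw [div_le_iff₀ hM]; linarith
  have h2 : w ^ t * min r w / w ≤ r ^ t := by
    rcases le_total r w with h | h
    · rw [min_eq_left h]
      have h3 : w ^ (t - 1) ≤ r ^ (t - 1) :=
        Real.rpow_le_rpow_of_nonpos hr h (by linarith)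
      rw [Real.rpow_sub hw, Real.rpow_sub hr, Real.rpow_one, Real.rpow_one] at h3
      calc w ^ t * r / w = w ^ t / w * r := by ring
        _ ≤ r ^ t / r * r := by gcongr
        _ = r ^ t := by field_simp
    · rw [min_eq_right h, mul_div_assoc, div_self hw.ne', mul_one]
      exact Real.rpow_le_rpow hw.le h ht0
  rw [hmin'] at hmin ⊢
  calc K ^ n * (1 + P' * r) * (1 + P' * min r w) / (P' * M')
      ≤ K ^ n * (K ^ (n + 1) * (P' * r) + K ^ (n + 1) * (P' * r)) *
        (K ^ (n + 1) * (P' * min r w) + K ^ (n + 1) * (P' * min r w)) / (P' * M') := by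
        have hKn : 1 ≤ K ^ (n + 1) := one_le_pow₀ hK
        have : 0 < P' * M' := by rw [hM']; positivity
        have e1 : 1 + P' * r ≤ K ^ (n + 1) * (P' * r) + K ^ (n + 1) * (P' * r) :=
          add_le_add hR (le_mul_of_one_le_left (by positivity) hKn)
        have e2 : 1 + P' * min r w ≤
            K ^ (n + 1) * (P' * min r w) + K ^ (n + 1) * (P' * min r w) :=
          add_le_add hmin (le_mul_of_one_le_left (by positivity) hKn)
        refine div_le_div_of_nonneg_right ?_ this.le
        exact mul_le_mul (mul_le_mul_of_nonneg_left e1 (by positivity)) e2 (by positivity)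
          (by positivity)
    _ = 4 * (K ^ n * K ^ (n + 1) * K ^ (n + 1)) * r * (min r w / w) * (1 / M) := by
        rw [hM']; field_simp; ring
    _ ≤ 4 * (K ^ n * K ^ (n + 1) * K ^ (n + 1)) * r * (min r w / w) * (K ^ n * w ^ t) := by
        gcongr
    _ = 4 * K ^ 2 * (K ^ 4) ^ n * r * (w ^ t * min r w / w) := by ring
    _ ≤ 4 * K ^ 2 * (K ^ 4) ^ n * r * r ^ t := by gcongr
    _ = _ := by rw [Real.rpow_add hr, Real.rpow_one]; ring

/-- The inequality in `hφ` starts at an index depending on the point. E is a countable union of sets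
on which it holds from a fixed j on and P j is bounded; one of them has positive mass, and there the
bound for balls is uniform, so that the mass distribution principle applies. -/
theorem le_dimH_of_ball_mass {Z : Type*} [MetricSpace Z] [MeasurableSpace Z] [BorelSpace Z]
    {μ : Measure Z} {E : Set Z} {P M w : ℕ → Z → ℝ} {G : ℕ → ℝ} {K t t' : ℝ} {n0 : ℕ}
    (hE : μ E ≠ 0)
    (hK : 1 ≤ K) (hG0 : ∀ n, 0 < G n) (hG : ∀ B : ℝ, ∀ᶠ n in atTop, B ^ n ≤ G n)
    (hPG : ∀ n, n0 ≤ n → ∀ z ∈ E, G n ≤ P n z)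
    (hw : ∀ n, n0 ≤ n → ∀ z ∈ E, 0 < w n z)
    (hM : ∀ n, n0 ≤ n → ∀ z ∈ E, 0 < M n z)
    (hm : ∀ n, n0 ≤ n → ∀ z ∈ E, 1 / K ≤ w n z * P (n + 1) z)
    (hwM : ∀ n, n0 ≤ n → ∀ z ∈ E, w n z * M n z = M (n + 1) z / P (n + 1) z)
    (hball : ∀ n, n0 ≤ n → ∀ z ∈ E, ∀ r, 0 < r → K ^ n * r ≤ 1 / P n z →
      μ (closedBall z r) ≤ ENNReal.ofReal (K ^ n * (1 + P (n + 1) z * r) *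
        (1 + min (P (n + 1) z * r) (w n z * P (n + 1) z)) / (P (n + 1) z * M (n + 1) z)))
    (ht0 : 0 ≤ t) (ht1 : t ≤ 1) (htt : t' < t) (ht' : 0 < 1 + t')
    (hφ : ∀ z ∈ E, ∀ᶠ n in atTop, w n z ^ (-t) ≤ K ^ n * M n z) :
    ENNReal.ofReal (1 + t') ≤ dimH E := by
  have hPpos : ∀ n, n0 ≤ n → ∀ z ∈ E, 0 < P n z := fun n hn z hz =>
    (hG0 n).trans_le (hPG n hn z hz)
  have hK0 : 0 < K := by linarith
  set S : ℕ × ℕ → Set Z := fun p =>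
    {z ∈ E | n0 ≤ p.1 ∧ (∀ n, p.1 ≤ n → w n z ^ (-t) ≤ K ^ n * M n z) ∧ P p.1 z ≤ p.2} with hS
  have hES : E ⊆ ⋃ p, S p := fun z hz => by
    obtain ⟨j, hj⟩ := eventually_atTop.1 (hφ z hz)
    obtain ⟨L, hL⟩ := exists_nat_ge (P (max j n0) z)
    exact mem_iUnion.2 ⟨(max j n0, L), hz, le_max_right _ _,
      fun n hn => hj n ((le_max_left _ _).trans hn), hL⟩
  obtain ⟨⟨j, L⟩, hjL⟩ : ∃ p, μ (S p) ≠ 0 := by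
    by_contra hcon
    push Not at hcon
    exact hE (measure_mono_null hES (measure_iUnion_null hcon))
  obtain ⟨c, hc0, hc⟩ := exists_pow_le_of_superexponential hG0 hG
    (B := K ^ 4) (by positivity) (sub_pos.2 htt)
  have hbound : ∀ z ∈ S (j, L), ∀ r, 0 < r → r ≤ 1 / (K ^ j * (L + 1)) →
      μ (closedBall z r) ≤ ENNReal.ofReal (4 * K ^ 2 * c * r ^ (1 + t')) := fun z hz r hr hrr => by
    obtain ⟨hzE, hj0, hzM, hzL⟩ := hz
    simp only at hj0 hzM hzL
    have hPj := hPpos j hj0 z hzE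
    have hjr : K ^ j * r ≤ 1 / P j z := by
      rw [le_div_iff₀ (by positivity)] at hrr ⊢
      refine le_trans ?_ hrr
      calc K ^ j * r * P j z ≤ K ^ j * r * (L + 1) := by gcongr; linarith
        _ = _ := by ring
    -- The first such n is not j, by the choice of the maximal radius. Its predecessor n satisfies
    -- K^n r ≤ 1/P_n, as `hball` requires, and 1/P_{n+1} < K^(n+1) r, as `ball_mass_le` requires.
    have hex : ∃ n, j ≤ n ∧ 1 / P n z < K ^ n * r := by
      obtain ⟨N, hN⟩ := eventually_atTop.1 (hG 2)
      obtain ⟨k, hk⟩ := exists_pow_lt_of_lt_one hr (show (1 / 2 : ℝ) < 1 by norm_num)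
      refine ⟨max j (max N k), le_max_left _ _, ?_⟩
      set n := max j (max N k)
      have h1 := hN n ((le_max_left _ _).trans (le_max_right _ _))
      have h2 := hPG n (hj0.trans (le_max_left _ _)) z hzE
      have h3 : (2 : ℝ) ^ k ≤ 2 ^ n :=
        pow_le_pow_right₀ (by norm_num) ((le_max_right _ _).trans (le_max_right _ _))
      have h4 : 1 / P n z ≤ 1 / 2 ^ k :=
        one_div_le_one_div_of_le (by positivity) (h3.trans (h1.trans h2))
      rw [← one_div_pow] at h4
      have h5 : r ≤ K ^ n * r := le_mul_of_one_le_left hr.le (one_le_pow₀ hK)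
      linarith
    classical
    have hspec := Nat.find_spec hex
    have hne : Nat.find hex ≠ j := fun h => by
      rw [h] at hspec
      linarith [hspec.2]
    obtain ⟨n, hn⟩ : ∃ n, Nat.find hex = n + 1 :=
      Nat.exists_eq_succ_of_ne_zero (by omega)
    have hnj : j ≤ n := by omega
    have hn0 : n0 ≤ n := hj0.trans hnj
    have hmin := Nat.find_min hex (m := n) (by omega)
    push Not at hmin
    rw [hn] at hspec
    have hrn := hmin hnj
    refine (hball n hn0 z hzE r hr hrn).trans (ENNReal.ofReal_le_ofReal ?_)
    refine (ball_mass_le hK (hPpos (n + 1) (by omega) z hzE) (hM n hn0 z hzE) hr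
      (hw n hn0 z hzE) hspec.2 (hm n hn0 z hzE) (hwM n hn0 z hzE) ht0 ht1 (hzM n hnj)).trans ?_
    have h5 : r ≤ 1 / G n := by
      have h6 : r ≤ K ^ n * r := le_mul_of_one_le_left hr.le (one_le_pow₀ hK)
      exact h6.trans (hrn.trans (one_div_le_one_div_of_le (hG0 n) (hPG n hn0 z hzE)))
    have h7 := hc n r hr h5
    calc 4 * K ^ 2 * (K ^ 4) ^ n * r ^ (1 + t)
        ≤ 4 * K ^ 2 * (c * r ^ (-(t - t'))) * r ^ (1 + t) := by gcongr
      _ = 4 * K ^ 2 * c * (r ^ (-(t - t')) * r ^ (1 + t)) := by ring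
      _ = _ := by rw [← Real.rpow_add hr]; ring_nf
  have hmass := measure_le_mul_hausdorffMeasure (C := 4 * K ^ 2 * c) (by positivity) ht'
    (by positivity) hbound
  have hpos : μH[((⟨1 + t', ht'.le⟩ : ℝ≥0) : ℝ)] E ≠ 0 := fun h0 => by
    have h1 : μH[1 + t'] (S (j, L)) = 0 := measure_mono_null (fun z hz => hz.1) h0
    rw [h1, mul_zero] at hmass
    exact hjL (le_antisymm hmass zero_le)
  refine le_trans (le_of_eq ?_) (le_dimH_of_hausdorffMeasure_ne_zero hpos)
  rw [ENNReal.ofReal, Real.toNNReal_of_nonneg ht'.le]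
  rfl

/-- One radius per good time is enough. At r about 1/P_{n+1} the two brackets in `hball` are
bounded, so the mass is about 1/(P_{n+1} M_{n+1}), which the inequality in `hψ` turns into
P_{n+1}^(-1-t). -/
theorem le_packingDim_of_ball_mass {Z : Type*} [MetricSpace Z] [MeasurableSpace Z]
    {μ : Measure Z} {E A : Set Z} {P M w : ℕ → Z → ℝ} {G : ℕ → ℝ} {K t t' : ℝ} {n0 : ℕ}
    (hEA : E ⊆ A) (hE : μ E ≠ 0)
    (hK : 1 ≤ K) (hG0 : ∀ n, 0 < G n) (hG : ∀ B : ℝ, ∀ᶠ n in atTop, B ^ n ≤ G n)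
    (hPG : ∀ n, n0 ≤ n → ∀ z ∈ E, G n ≤ P n z)
    (hw : ∀ n, n0 ≤ n → ∀ z ∈ E, 0 < w n z)
    (hM : ∀ n, n0 ≤ n → ∀ z ∈ E, 0 < M n z)
    (hPP : ∀ n, n0 ≤ n → ∀ z ∈ E, P n z ≤ K * P (n + 1) z)
    (hball : ∀ n, n0 ≤ n → ∀ z ∈ E, ∀ r, 0 < r → K ^ n * r ≤ 1 / P n z →
      μ (closedBall z r) ≤ ENNReal.ofReal (K ^ n * (1 + P (n + 1) z * r) *
        (1 + min (P (n + 1) z * r) (w n z * P (n + 1) z)) / (P (n + 1) z * M (n + 1) z)))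
    (ht1 : t ≤ 1) (htt : t' < t)
    (hψ : ∀ z ∈ E, ∃ᶠ n in atTop, P n z ^ t ≤ K ^ n * M n z) :
    ENNReal.ofReal (1 + t') ≤ packingDim A := by
  set ε : ℝ := (t - t') / 2 with hε
  have hε0 : 0 < ε := by linarith
  have hK0 : 0 < K := by linarith
  by_cases htε : 1 + (t - ε) < 0
  · rw [ENNReal.ofReal_of_nonpos (by linarith)]; exact zero_le
  push Not at htε
  obtain ⟨c, hc0, hc⟩ := exists_pow_le_of_superexponential hG0 hG
    (B := K ^ 4) (by positivity) hε0
  refine le_packingDim_of_measure (C := 4 * c) (d := 1 + (t - ε)) (by positivity) htε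
    (by linarith) hEA hE fun z hz ρ hρ => ?_
  have hPpos : ∀ n, n0 ≤ n → 0 < P n z := fun n hn =>
    (hG0 n).trans_le (hPG n hn z hz)
  obtain ⟨N, hN⟩ := eventually_atTop.1 (hG 2)
  obtain ⟨k, hk⟩ := exists_pow_lt_of_lt_one hρ (show (1 / 2 : ℝ) < 1 by norm_num)
  obtain ⟨n', hn', hψn⟩ := frequently_atTop.1 (hψ z hz) (max (n0 + 1) (max N k))
  obtain ⟨n, rfl⟩ : ∃ n, n' = n + 1 :=
    Nat.exists_eq_succ_of_ne_zero (by have := (le_max_left _ _).trans hn'; omega)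
  have hn0 : n0 ≤ n := by have := (le_max_left _ _).trans hn'; omega
  have hNn : N ≤ n + 1 := ((le_max_left _ _).trans (le_max_right _ _)).trans hn'
  have hkn : k ≤ n + 1 := ((le_max_right _ _).trans (le_max_right _ _)).trans hn'
  have hP' := hPpos (n + 1) (by omega)
  have hM' := hM (n + 1) (by omega) z hz
  have hPG' := hPG (n + 1) (by omega) z hz
  set P' := P (n + 1) z with hP'def
  set M' := M (n + 1) z with hM'def
  -- With this power of K one has K^n r = 1/(K P'), which is at most 1/P_n by `hPP`.
  set r : ℝ := 1 / (K ^ (n + 1) * P') with hr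
  have hr0 : 0 < r := by positivity
  have hrG : r ≤ 1 / G (n + 1) := by
    refine one_div_le_one_div_of_le (hG0 _) (hPG'.trans ?_)
    exact le_mul_of_one_le_left hP'.le (one_le_pow₀ hK)
  refine ⟨r, hr0, ?_, ?_⟩
  · have h1 : r ≤ 1 / 2 ^ k := hrG.trans (one_div_le_one_div_of_le (by positivity)
      ((pow_le_pow_right₀ (by norm_num) hkn).trans (hN _ hNn)))
    rw [← one_div_pow] at h1
    linarith
  · have hKr : K ^ n * r ≤ 1 / P n z := by
      have h1 : K ^ n * r = 1 / (K * P') := by rw [hr, pow_succ]; field_simp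
      rw [h1]
      exact one_div_le_one_div_of_le (hPpos n hn0) (hPP n hn0 z hz)
    refine (hball n hn0 z hz r hr0 hKr).trans (ENNReal.ofReal_le_ofReal ?_)
    rw [← hP'def, ← hM'def]
    have hR : P' * r ≤ 1 := by
      rw [hr, mul_one_div, div_le_one (by positivity)]
      exact le_mul_of_one_le_left hP'.le (one_le_pow₀ hK)
    have hPr : P'⁻¹ = K ^ (n + 1) * r := by rw [hr]; field_simp
    have h2 : 1 / M' ≤ K ^ (n + 1) * P'⁻¹ ^ t := by
      rw [Real.inv_rpow hP'.le, div_le_iff₀ hM', ← div_eq_mul_inv, div_mul_eq_mul_div,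
        le_div_iff₀ (by positivity)]
      linarith
    have h3 : P'⁻¹ ^ t ≤ K ^ (n + 1) * r ^ t := by
      rw [hPr, Real.mul_rpow (by positivity) hr0.le]
      gcongr
      calc (K ^ (n + 1)) ^ t ≤ (K ^ (n + 1)) ^ (1 : ℝ) :=
            Real.rpow_le_rpow_of_exponent_le (one_le_pow₀ hK) ht1
        _ = _ := Real.rpow_one _
    have h4 := hc (n + 1) r hr0 hrG
    calc K ^ n * (1 + P' * r) * (1 + min (P' * r) (w n z * P')) / (P' * M')
        ≤ K ^ (n + 1) * (1 + 1) * (1 + 1) / (P' * M') := by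
          have hmin : 0 < min (P' * r) (w n z * P') :=
            lt_min (by positivity) (mul_pos (hw n hn0 z hz) hP')
          have e0 : K ^ n ≤ K ^ (n + 1) := pow_le_pow_right₀ hK (by omega)
          have e2 : 1 + min (P' * r) (w n z * P') ≤ 1 + 1 := by
            linarith [min_le_left (P' * r) (w n z * P')]
          refine div_le_div_of_nonneg_right ?_ (by positivity)
          exact mul_le_mul (mul_le_mul e0 (by linarith) (by positivity) (by positivity)) e2
            (by positivity) (by positivity)
      _ = 4 * K ^ (n + 1) * P'⁻¹ * (1 / M') := by field_simp; ring
      _ ≤ 4 * K ^ (n + 1) * (K ^ (n + 1) * r) * (K ^ (n + 1) * (K ^ (n + 1) * r ^ t)) := by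
          rw [hPr]
          gcongr
          refine h2.trans ?_
          gcongr
      _ = 4 * (K ^ 4) ^ (n + 1) * (r * r ^ t) := by ring
      _ ≤ 4 * (c * r ^ (-ε)) * (r * r ^ t) := by gcongr
      _ = 4 * c * (r ^ (-ε) * (r ^ (1 : ℝ) * r ^ t)) := by rw [Real.rpow_one]; ring
      _ = _ := by
          rw [← Real.rpow_add hr0, ← Real.rpow_add hr0]
          ring_nf

end

/-! ### The products P_n and M_n, the widths w_n, and the ratios φ_n and ψ_n. -/

section
open Set

/-- `x 1 * ⋯ * x n`. -/
noncomputable def modProd (x : ℕ → ℝ) (n : ℕ) : ℝ := ∏ k ∈ Finset.Icc 1 n, x k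

/-- `min(Δ_2, x_1) ⋯ min(Δ_{n+1}, x_n)`. -/
noncomputable def minProd (a b x : ℕ → ℝ) (n : ℕ) : ℝ :=
  ∏ k ∈ Finset.Icc 1 n, min (annulusModulus a b (k + 1)) (x k)

/-- `min(Δ_{n+2}, x_{n+1}) / (x_1 ⋯ x_{n+1})`. -/
noncomputable def stripWidth (a b x : ℕ → ℝ) (n : ℕ) : ℝ :=
  min (annulusModulus a b (n + 2)) (x (n + 1)) / modProd x (n + 1)

/-- The standing assumptions common to the upper and the lower estimates. -/
structure AnnulusData (lam : ℕ → ℂ) (a b : ℕ → ℝ) (D : ℝ) : Prop where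
  D_pos : 0 < D
  lam_ne : ∀ n, 1 ≤ n → lam n ≠ 0
  a_pos : ∀ n, 1 ≤ n → 0 < a n
  a_lt : ∀ n, 1 ≤ n → a n < b n
  growth : ∀ B : ℝ, ∀ᶠ n in atTop, B ^ n ≤ modProd a n
  modulus : ∀ n, 1 ≤ n → D < annulusModulus a b n
  one_le_a : ∀ᶠ n in atTop, 1 ≤ a n

lemma modProd_succ (x : ℕ → ℝ) (n : ℕ) : modProd x (n + 1) = modProd x n * x (n + 1) := by
  rw [modProd, Finset.prod_Icc_succ_top (by omega)]; rfl

lemma minProd_succ (a b x : ℕ → ℝ) (n : ℕ) :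
    minProd a b x (n + 1) = minProd a b x n * min (annulusModulus a b (n + 2)) (x (n + 1)) := by
  rw [minProd, Finset.prod_Icc_succ_top (by omega)]; rfl

lemma modProd_pos {x : ℕ → ℝ} (hx : ∀ k, 1 ≤ k → 0 < x k) (n : ℕ) : 0 < modProd x n :=
  Finset.prod_pos fun k hk => hx k (Finset.mem_Icc.1 hk).1

lemma one_le_pow_mul_minProd {a b : ℕ → ℝ} {K : ℝ} (hK : 1 ≤ K) (hKm : ∀ x ∈ seqBox a b, ∀ k, 1 ≤ k →
    1 / K ≤ min (annulusModulus a b (k + 1)) (x k)) {x : ℕ → ℝ} (hx : x ∈ seqBox a b) (n : ℕ) :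
    1 ≤ K ^ n * minProd a b x n := by
  have hK0 : 0 < K := by linarith
  induction n with
  | zero => simp [minProd]
  | succ n ih =>
    rw [minProd_succ, pow_succ]
    have h1 := hKm x hx (n + 1) (by omega)
    rw [div_le_iff₀ hK0] at h1
    have h2 := one_le_mul_of_one_le_of_one_le ih h1
    refine h2.trans (le_of_eq (by ring))

namespace AnnulusData

variable {lam : ℕ → ℂ} {a b : ℕ → ℝ} {D : ℝ} (h : AnnulusData lam a b D)
include h

lemma x_pos {x : ℕ → ℝ} (hx : x ∈ seqBox a b) (k : ℕ) (hk : 1 ≤ k) : 0 < x k :=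
  (h.a_pos k hk).trans_le (hx k hk).1

lemma min_pos {x : ℕ → ℝ} (hx : x ∈ seqBox a b) (k : ℕ) (hk : 1 ≤ k) :
    0 < min (annulusModulus a b (k + 1)) (x k) :=
  lt_min (h.D_pos.trans (h.modulus _ (by omega))) (h.x_pos hx k hk)

lemma modProd_le {x : ℕ → ℝ} (hx : x ∈ seqBox a b) (n : ℕ) : modProd a n ≤ modProd x n :=
  Finset.prod_le_prod (fun k hk => (h.a_pos k (Finset.mem_Icc.1 hk).1).le)
    fun k hk => (hx k (Finset.mem_Icc.1 hk).1).1

lemma minProd_pos {x : ℕ → ℝ} (hx : x ∈ seqBox a b) (n : ℕ) : 0 < minProd a b x n :=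
  Finset.prod_pos fun k hk => h.min_pos hx k (Finset.mem_Icc.1 hk).1

lemma minProd_le_modProd {x : ℕ → ℝ} (hx : x ∈ seqBox a b) (n : ℕ) :
    minProd a b x n ≤ modProd x n :=
  Finset.prod_le_prod (fun k hk => (h.min_pos hx k (Finset.mem_Icc.1 hk).1).le)
    fun _ _ => min_le_right _ _

lemma stripWidth_pos {x : ℕ → ℝ} (hx : x ∈ seqBox a b) (n : ℕ) : 0 < stripWidth a b x n :=
  div_pos (h.min_pos hx (n + 1) (by omega)) (modProd_pos (h.x_pos hx) _)

lemma stripWidth_le {x : ℕ → ℝ} (hx : x ∈ seqBox a b) (n : ℕ) :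
    stripWidth a b x n ≤ 1 / modProd x n := by
  have h1 := h.x_pos hx (n + 1) (by omega)
  have h2 := modProd_pos (h.x_pos hx) n
  rw [stripWidth, modProd_succ, div_le_div_iff₀ (by positivity) h2, one_mul, mul_comm]
  exact mul_le_mul_of_nonneg_left (min_le_right _ _) h2.le

lemma stripWidth_mul_modProd {x : ℕ → ℝ} (hx : x ∈ seqBox a b) (n : ℕ) :
    stripWidth a b x n * modProd x (n + 1) = min (annulusModulus a b (n + 2)) (x (n + 1)) :=
  div_mul_cancel₀ _ (modProd_pos (h.x_pos hx) _).ne'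

omit h in
lemma stripWidth_mul_minProd {x : ℕ → ℝ} (n : ℕ) :
    stripWidth a b x n * minProd a b x n = minProd a b x (n + 1) / modProd x (n + 1) := by
  rw [minProd_succ, stripWidth]; ring

/-- A uniform lower bound for all factors `min(Δ_{k+1}, x_k)`. -/
lemma exists_le_min : ∃ K : ℝ, 1 ≤ K ∧ ∀ x ∈ seqBox a b, ∀ k, 1 ≤ k →
    1 / K ≤ min (annulusModulus a b (k + 1)) (x k) := by
  obtain ⟨N, hN⟩ := eventually_atTop.1 h.one_le_a
  have hs : ∀ k ∈ Finset.Icc 1 N, 0 ≤ 1 / a k := fun k hk =>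
    (one_div_pos.2 (h.a_pos k (Finset.mem_Icc.1 hk).1)).le
  have hs0 := Finset.sum_nonneg hs
  have hD := h.D_pos
  have hD' : 0 < 1 / D := by positivity
  refine ⟨1 + 1 / D + ∑ k ∈ Finset.Icc 1 N, 1 / a k, by linarith, fun x hx k hk => ?_⟩
  refine le_min ?_ ?_
  · refine le_trans ?_ (h.modulus (k + 1) (by omega)).le
    rw [one_div_le (by positivity) hD]; linarith
  · refine le_trans ?_ (hx k hk).1
    have ha := h.a_pos k hk
    rw [one_div_le (by positivity) ha]
    by_cases hkN : k ≤ N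
    · have := Finset.single_le_sum hs (Finset.mem_Icc.2 ⟨hk, hkN⟩)
      linarith
    · have : 1 / a k ≤ 1 := by
        rw [div_le_one ha]; exact hN k (by omega)
      linarith

lemma eventually_one_lt_modProd : ∀ᶠ n in atTop, ∀ x ∈ seqBox a b, 1 < modProd x n := by
  filter_upwards [h.growth 2, eventually_ge_atTop 1] with n hn h1 x hx
  have : (1 : ℝ) < 2 ^ n := one_lt_pow₀ (by norm_num) (by omega)
  linarith [h.modProd_le hx n]

/-- The shift of index occurs because the numerator of φ_{n+1} stops at the factor min(Δ_{n+1},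
x_n), whereas its denominator already contains x_{n+1} and min(Δ_{n+2}, x_{n+1}). -/
lemma phiRatio_succ {x : ℕ → ℝ} (hx : x ∈ seqBox a b) (n : ℕ) :
    phiRatio a b (n + 1) x = Real.log (minProd a b x n) / -Real.log (stripWidth a b x n) := by
  rw [phiRatio, stripWidth, Real.log_div (h.min_pos hx (n + 1) (by omega)).ne'
    (modProd_pos (h.x_pos hx) _).ne', neg_sub]
  rfl

lemma phiRatio_succ_le_iff {x : ℕ → ℝ} (hx : x ∈ seqBox a b) {n : ℕ} (hn : 1 < modProd x n)
    {t : ℝ} : phiRatio a b (n + 1) x ≤ t ↔ minProd a b x n ≤ stripWidth a b x n ^ (-t) := by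
  have hw := h.stripWidth_pos hx n
  have hw1 : stripWidth a b x n < 1 :=
    (h.stripWidth_le hx n).trans_lt ((div_lt_one (by linarith)).2 hn)
  have hl := Real.log_neg hw hw1
  rw [h.phiRatio_succ hx, div_le_iff₀ (by linarith),
    ← Real.log_le_log_iff (h.minProd_pos hx n) (Real.rpow_pos_of_pos hw _), Real.log_rpow hw]
  ring_nf

lemma le_phiRatio_succ_iff {x : ℕ → ℝ} (hx : x ∈ seqBox a b) {n : ℕ} (hn : 1 < modProd x n)
    {t : ℝ} : t ≤ phiRatio a b (n + 1) x ↔ stripWidth a b x n ^ (-t) ≤ minProd a b x n := by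
  have hw := h.stripWidth_pos hx n
  have hw1 : stripWidth a b x n < 1 :=
    (h.stripWidth_le hx n).trans_lt ((div_lt_one (by linarith)).2 hn)
  have hl := Real.log_neg hw hw1
  rw [h.phiRatio_succ hx, le_div_iff₀ (by linarith),
    ← Real.log_le_log_iff (Real.rpow_pos_of_pos hw _) (h.minProd_pos hx n), Real.log_rpow hw]
  ring_nf

lemma psiRatio_le_iff {x : ℕ → ℝ} (hx : x ∈ seqBox a b) {n : ℕ} (hn : 1 < modProd x n)
    {t : ℝ} : psiRatio a b n x ≤ t ↔ minProd a b x n ≤ modProd x n ^ t := by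
  have hp : 0 < modProd x n := by linarith
  rw [← Real.log_le_log_iff (h.minProd_pos hx n) (Real.rpow_pos_of_pos hp _), Real.log_rpow hp,
    ← div_le_iff₀ (Real.log_pos hn)]
  rfl

lemma le_psiRatio_iff {x : ℕ → ℝ} (hx : x ∈ seqBox a b) {n : ℕ} (hn : 1 < modProd x n)
    {t : ℝ} : t ≤ psiRatio a b n x ↔ modProd x n ^ t ≤ minProd a b x n := by
  have hp : 0 < modProd x n := by linarith
  rw [← Real.log_le_log_iff (Real.rpow_pos_of_pos hp _) (h.minProd_pos hx n), Real.log_rpow hp,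
    ← le_div_iff₀ (Real.log_pos hn)]
  rfl

lemma psiRatio_le_one {x : ℕ → ℝ} (hx : x ∈ seqBox a b) {n : ℕ} (hn : 1 < modProd x n) :
    psiRatio a b n x ≤ 1 := by
  rw [h.psiRatio_le_iff hx hn, Real.rpow_one]
  exact h.minProd_le_modProd hx n

lemma phiRatio_succ_le_one {x : ℕ → ℝ} (hx : x ∈ seqBox a b) {n : ℕ} (hn : 1 < modProd x n) :
    phiRatio a b (n + 1) x ≤ 1 := by
  rw [h.phiRatio_succ_le_iff hx hn, Real.rpow_neg (h.stripWidth_pos hx n).le, Real.rpow_one]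
  refine (h.minProd_le_modProd hx n).trans ?_
  rw [le_inv_comm₀ (modProd_pos (h.x_pos hx) n) (h.stripWidth_pos hx n), ← one_div]
  exact h.stripWidth_le hx n

/-- The products `min(Δ_2, x_1) ⋯ min(Δ_{n+1}, x_n)` decay slower than any negative power. -/
lemma eventually_rpow_neg_le_minProd {ε : ℝ} (hε : 0 < ε) : ∀ᶠ n in atTop, ∀ x ∈ seqBox a b,
    ∀ y, modProd x n ≤ y → y ^ (-ε) ≤ minProd a b x n := by
  obtain ⟨K, hK, hKm⟩ := h.exists_le_min
  have hK0 : 0 < K := by linarith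
  filter_upwards [h.growth (K ^ (1 / ε))] with n hn x hx y hy
  have hp := modProd_pos (h.x_pos hx) n
  have h1 := (hn.trans (h.modProd_le hx n)).trans hy
  have h2 := Real.rpow_le_rpow (by positivity) h1 hε.le
  have h4 : ((K ^ (1 / ε)) ^ n) ^ ε = K ^ n := by
    rw [← Real.rpow_natCast, ← Real.rpow_natCast, ← Real.rpow_mul hK0.le,
      ← Real.rpow_mul hK0.le]
    congr 1; field_simp
  rw [h4] at h2
  have h3 := one_le_pow_mul_minProd hK hKm hx n
  have hy0 : 0 < y := hp.trans_le hy
  rw [Real.rpow_neg hy0.le, inv_le_iff_one_le_mul₀ (Real.rpow_pos_of_pos hy0 _)]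
  refine h3.trans ?_
  rw [mul_comm]
  exact mul_le_mul_of_nonneg_left h2 (h.minProd_pos hx n).le

/-- Factors of M_n may be smaller than 1, so that φ_n may be negative. But M_n ≥ K^(-n), and K^n is
below every positive power of 1/w_n for large n. This makes the suprema in the upper bounds
nonnegative. -/
lemma liminf_phiRatio_nonneg {x : ℕ → ℝ} (hx : x ∈ seqBox a b) :
    (0 : EReal) ≤ liminf (fun n : ℕ => (phiRatio a b n x : EReal)) atTop := by
  refine le_of_forall_lt fun c hc => ?_
  obtain ⟨s, hcs, hs0⟩ := EReal.lt_iff_exists_real_btwn.1 hc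
  refine hcs.trans_le (le_liminf_of_le (by isBoundedDefault) ?_)
  have hs : (0 : ℝ) < -s := by
    have : s < 0 := by exact_mod_cast hs0
    linarith
  have hev : ∀ᶠ n in atTop, s ≤ phiRatio a b (n + 1) x := by
    filter_upwards [h.eventually_rpow_neg_le_minProd hs, h.eventually_one_lt_modProd] with n h1 h2
    have hw := h.stripWidth_pos hx n
    rw [h.le_phiRatio_succ_iff hx (h2 x hx)]
    have h3 := h1 x hx (stripWidth a b x n)⁻¹ (by
      rw [le_inv_comm₀ (modProd_pos (h.x_pos hx) n) hw, ← one_div]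
      exact h.stripWidth_le hx n)
    rw [Real.inv_rpow hw.le, ← Real.rpow_neg hw.le, neg_neg] at h3
    exact h3
  obtain ⟨N, hN⟩ := eventually_atTop.1 hev
  filter_upwards [eventually_ge_atTop (N + 1)] with n hn
  obtain ⟨m, rfl⟩ : ∃ m, n = m + 1 := Nat.exists_eq_succ_of_ne_zero (by omega)
  exact_mod_cast hN m (by omega)

lemma limsup_psiRatio_nonneg {x : ℕ → ℝ} (hx : x ∈ seqBox a b) :
    (0 : EReal) ≤ limsup (fun n : ℕ => (psiRatio a b n x : EReal)) atTop := by
  refine le_of_forall_lt fun c hc => ?_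
  obtain ⟨s, hcs, hs0⟩ := EReal.lt_iff_exists_real_btwn.1 hc
  have hs : (0 : ℝ) < -s := by
    have : s < 0 := by exact_mod_cast hs0
    linarith
  have hev : ∀ᶠ n in atTop, ((s : ℝ) : EReal) ≤ psiRatio a b n x := by
    filter_upwards [h.eventually_rpow_neg_le_minProd hs, h.eventually_one_lt_modProd] with n h1 h2
    have h3 := h1 x hx _ le_rfl
    rw [neg_neg, ← h.le_psiRatio_iff hx (h2 x hx)] at h3
    exact_mod_cast h3
  exact hcs.trans_le (le_limsup_of_frequently_le hev.frequently (by isBoundedDefault))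

end AnnulusData

end

/-! ### Grid cells, itineraries and distortion along an orbit. -/

section
open Set Metric

/-- The cell of the grid of mesh `1 / h` which contains `w`. -/
noncomputable def gridCell (h : ℝ) (w : ℂ) : ℤ × ℤ := (⌊h * w.re⌋, ⌊h * w.im⌋)

/-- The grid cell of mesh `1 / 4` of the `k`-th point of the orbit of `z`. -/
noncomputable def orbitCell (lam : ℕ → ℂ) (k : ℕ) (z : ℂ) : ℤ × ℤ :=
  gridCell 4 (nonautExp lam k z)

/-- The grid cells visited up to time `n`. -/
noncomputable def itinerary (lam : ℕ → ℂ) (n : ℕ) (z : ℂ) : List (ℤ × ℤ) :=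
  (List.range (n + 1)).map fun k => orbitCell lam k z

/-- The moduli of the orbit of `z` after time `N`, completed by `a`. -/
noncomputable def orbitSeq (lam : ℕ → ℂ) (a : ℕ → ℝ) (N : ℕ) (z : ℂ) (k : ℕ) : ℝ :=
  if k ≤ N then a k else ‖nonautExp lam k z‖

lemma itinerary_eq_iff {lam : ℕ → ℂ} {n : ℕ} {z z' : ℂ} :
    itinerary lam n z = itinerary lam n z' ↔ ∀ k ≤ n, orbitCell lam k z = orbitCell lam k z' := by
  rw [itinerary, itinerary, List.map_inj_left]
  simp

lemma norm_sub_le_of_gridCell_eq {h : ℝ} (hh : 0 < h) {w w' : ℂ}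
    (hc : gridCell h w = gridCell h w') : ‖w - w'‖ ≤ 2 / h := by
  simp only [gridCell, Prod.mk.injEq] at hc
  have h1 := Int.abs_sub_lt_one_of_floor_eq_floor hc.1
  have h2 := Int.abs_sub_lt_one_of_floor_eq_floor hc.2
  rw [← mul_sub, abs_mul, abs_of_pos hh] at h1 h2
  have h3 := Complex.norm_le_abs_re_add_abs_im (w - w')
  rw [Complex.sub_re, Complex.sub_im] at h3
  rw [le_div_iff₀ hh]
  nlinarith

lemma card_Icc_floor_le {u v : ℝ} (huv : 0 ≤ v - u + 2) :
    ((Finset.Icc ⌊u⌋ ⌊v⌋).card : ℝ) ≤ v - u + 2 := by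
  rw [Int.card_Icc]
  have h1 := Int.floor_le v
  have h2 := Int.lt_floor_add_one u
  rcases le_total 0 (⌊v⌋ + 1 - ⌊u⌋) with h | h
  · have : (((⌊v⌋ + 1 - ⌊u⌋).toNat : ℤ) : ℝ) = ((⌊v⌋ + 1 - ⌊u⌋ : ℤ) : ℝ) := by
      rw [Int.toNat_of_nonneg h]
    rw [Int.cast_natCast] at this
    rw [this]; push_cast; linarith
  · rw [Int.toNat_of_nonpos h]; simpa using huv

/-- The part of a vertical strip in a disc meets few cells. -/
lemma exists_finset_gridCell {h α β Y : ℝ} (hh : 0 < h) (hαβ : α ≤ β) (hY : 0 ≤ Y) :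
    ∃ T : Finset (ℤ × ℤ), (∀ w : ℂ, α ≤ w.re → w.re ≤ β → ‖w‖ ≤ Y → gridCell h w ∈ T) ∧
      (T.card : ℝ) ≤ (h * min (β - α) (2 * Y) + 2) * (2 * h * Y + 2) := by
  refine ⟨Finset.Icc ⌊h * max α (-Y)⌋ ⌊h * min β Y⌋ ×ˢ Finset.Icc ⌊h * (-Y)⌋ ⌊h * Y⌋,
    fun w h1 h2 h3 => ?_, ?_⟩
  · have h4 := abs_le.1 ((Complex.abs_re_le_norm w).trans h3)
    have h5 := abs_le.1 ((Complex.abs_im_le_norm w).trans h3)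
    simp only [gridCell, Finset.mem_product, Finset.mem_Icc]
    refine ⟨⟨?_, ?_⟩, ?_, ?_⟩ <;> apply Int.floor_le_floor <;>
      apply mul_le_mul_of_nonneg_left _ hh.le
    · exact max_le h1 h4.1
    · exact le_min h2 h4.2
    · exact h5.1
    · exact h5.2
  · rw [Finset.card_product]
    push_cast
    have e1 : h * min β Y - h * max α (-Y) ≤ h * min (β - α) (2 * Y) := by
      rw [← mul_sub]
      refine mul_le_mul_of_nonneg_left (le_min ?_ ?_) hh.le
      · linarith [min_le_left β Y, le_max_left α (-Y)]
      · linarith [min_le_right β Y, le_max_right α (-Y)]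
    have e3 : 0 ≤ h * min (β - α) (2 * Y) :=
      mul_nonneg hh.le (le_min (by linarith) (by linarith))
    have e2 : h * Y - h * (-Y) = 2 * h * Y := by ring
    refine mul_le_mul ?_ ?_ (Nat.cast_nonneg _) (by linarith)
    · by_cases hn : 0 ≤ h * min β Y - h * max α (-Y) + 2
      · exact (card_Icc_floor_le hn).trans (by linarith)
      · have : ⌊h * min β Y⌋ < ⌊h * max α (-Y)⌋ := by
          rw [Int.floor_lt]
          have := Int.lt_floor_add_one (h * max α (-Y))
          linarith
        rw [Finset.Icc_eq_empty (by omega)]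
        simp; linarith
    · rw [← e2]; exact card_Icc_floor_le (by nlinarith)

lemma nonautExp_succ (lam : ℕ → ℂ) (k : ℕ) (z : ℂ) :
    nonautExp lam (k + 1) z = lam (k + 1) * Complex.exp (nonautExp lam k z) := rfl

lemma norm_nonautExp_succ (lam : ℕ → ℂ) (k : ℕ) (z : ℂ) :
    ‖nonautExp lam (k + 1) z‖ = ‖lam (k + 1)‖ * Real.exp (nonautExp lam k z).re := by
  rw [nonautExp_succ, norm_mul, Complex.norm_exp]

lemma norm_nonautExp_pos {lam : ℕ → ℂ} (hlam : ∀ n, 1 ≤ n → lam n ≠ 0) (k : ℕ) (hk : 1 ≤ k)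
    (z : ℂ) : 0 < ‖nonautExp lam k z‖ := by
  obtain ⟨k, rfl⟩ : ∃ m, k = m + 1 := Nat.exists_eq_succ_of_ne_zero (by omega)
  rw [norm_nonautExp_succ]
  exact mul_pos (norm_pos_iff.2 (hlam _ hk)) (Real.exp_pos _)

/-- Points of one cell differ by at most 1/2, and e^(1/2) < 2. -/
lemma norm_nonautExp_succ_le_two_mul {lam : ℕ → ℂ} {k : ℕ} {z z' : ℂ}
    (hc : orbitCell lam k z = orbitCell lam k z') :
    ‖nonautExp lam (k + 1) z‖ ≤ 2 * ‖nonautExp lam (k + 1) z'‖ := by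
  rw [norm_nonautExp_succ, norm_nonautExp_succ]
  have h1 := norm_sub_le_of_gridCell_eq (by norm_num) hc
  have h2 := (Complex.abs_re_le_norm _).trans h1
  rw [Complex.sub_re] at h2
  have h3 := (abs_le.1 h2).2
  have h4 : Real.exp (nonautExp lam k z).re ≤ 2 * Real.exp (nonautExp lam k z').re := by
    have : Real.exp (nonautExp lam k z).re ≤
        Real.exp (1 / 2) * Real.exp (nonautExp lam k z').re := by
      rw [← Real.exp_add]; exact Real.exp_le_exp.2 (by linarith)
    refine this.trans (mul_le_mul_of_nonneg_right ?_ (Real.exp_pos _).le)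
    have h5 : Real.exp (1 / 2) ^ 2 = Real.exp 1 := by
      rw [← Real.exp_nat_mul]; norm_num
    have h6 := Real.exp_one_lt_d9
    nlinarith [Real.exp_pos (1 / 2)]
  calc _ ≤ ‖lam (k + 1)‖ * (2 * Real.exp (nonautExp lam k z').re) := by gcongr
    _ = _ := by ring

/-- For |w| ≤ 1/2 one has |e^w - 1 - w| ≤ |w|² ≤ |w|/2, hence |w| ≤ 2 |e^w - 1|: on a cell the
exponential expands by its derivative up to the factor 2. -/
lemma norm_sub_le_of_orbitCell_eq {lam : ℕ → ℂ} (hlam : ∀ n, 1 ≤ n → lam n ≠ 0) {k : ℕ} {z z' : ℂ}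
    (hc : orbitCell lam k z = orbitCell lam k z') :
    ‖nonautExp lam k z - nonautExp lam k z'‖ ≤ 2 / ‖nonautExp lam (k + 1) z'‖ *
      ‖nonautExp lam (k + 1) z - nonautExp lam (k + 1) z'‖ := by
  have h1 := norm_sub_le_of_gridCell_eq (by norm_num) hc
  have hpos := norm_nonautExp_pos hlam (k + 1) (by omega) z'
  set w := nonautExp lam k z - nonautExp lam k z' with hw
  have h2 : nonautExp lam (k + 1) z - nonautExp lam (k + 1) z' =
      nonautExp lam (k + 1) z' * (Complex.exp w - 1) := by
    rw [nonautExp_succ, nonautExp_succ, hw, Complex.exp_sub]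
    field_simp [Complex.exp_ne_zero]
  have h3 := Complex.norm_exp_sub_one_sub_id_le (x := w) (by linarith)
  have h4 : ‖w‖ ≤ 2 * ‖Complex.exp w - 1‖ := by
    have h5 : ‖w‖ ≤ ‖Complex.exp w - 1‖ + ‖Complex.exp w - 1 - w‖ := by
      have := norm_sub_le (Complex.exp w - 1) (Complex.exp w - 1 - w)
      simpa using this
    nlinarith [norm_nonneg w]
  rw [h2, norm_mul]
  calc ‖w‖ ≤ 2 * ‖Complex.exp w - 1‖ := h4
    _ = _ := by field_simp

/-- In each factor 4, one 2 is the distortion of the exponential on a cell, and the other compares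
the modulus along the orbit of z' with that along the reference orbit of y. -/
lemma norm_sub_le_prod {lam : ℕ → ℂ} (hlam : ∀ n, 1 ≤ n → lam n ≠ 0) {y z z' : ℂ} (n : ℕ)
    (hc : ∀ k < n, orbitCell lam k z = orbitCell lam k y)
    (hc' : ∀ k < n, orbitCell lam k z' = orbitCell lam k y) :
    ‖z - z'‖ ≤ (∏ k ∈ Finset.Icc 1 n, 4 / ‖nonautExp lam k y‖) *
      ‖nonautExp lam n z - nonautExp lam n z'‖ := by
  induction n with
  | zero => simp [nonautExp]
  | succ n ih =>
    refine (ih (fun k hk => hc k (by omega)) (fun k hk => hc' k (by omega))).trans ?_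
    rw [Finset.prod_Icc_succ_top (by omega), mul_assoc]
    refine mul_le_mul_of_nonneg_left ?_ (Finset.prod_nonneg fun k _ => by positivity)
    have h1 := norm_sub_le_of_orbitCell_eq hlam ((hc n (by omega)).trans (hc' n (by omega)).symm)
    refine h1.trans (mul_le_mul_of_nonneg_right ?_ (norm_nonneg _))
    have h2 := norm_nonautExp_succ_le_two_mul (hc' n (by omega)).symm
    have h3 := norm_nonautExp_pos hlam (n + 1) (by omega) y
    have h4 := norm_nonautExp_pos hlam (n + 1) (by omega) z'
    rw [div_le_div_iff₀ h4 h3]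
    linarith

/-- If each cell has at most `κ` successors, the weights `∏ κ⁻¹` of distinct finite itineraries
from a given cell sum to at most `1`. -/
lemma sum_prod_inv_le_one {Z α : Type*} [DecidableEq α] {c : ℕ → Z → α} {κ : ℕ → α → ℝ}
    {F : Set Z} {N : ℕ} (hκ0 : ∀ k q, 0 ≤ κ k q)
    (hκ : ∀ k, N ≤ k → ∀ q, ∀ S : Finset Z, (S : Set Z) ⊆ F → (∀ z ∈ S, c k z = q) →
      ((S.image (c (k + 1))).card : ℝ) ≤ κ k q) (j : ℕ) :
    ∀ k, N ≤ k → ∀ q, ∀ S : Finset Z, (S : Set Z) ⊆ F → (∀ z ∈ S, c k z = q) →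
      (∀ z ∈ S, ∀ z' ∈ S, (∀ i, k < i → i ≤ k + j → c i z = c i z') → z = z') →
      ∑ z ∈ S, ∏ i ∈ Finset.range j, (κ (k + i) (c (k + i) z))⁻¹ ≤ 1 := by
  induction j with
  | zero =>
    intro k _ q S _ _ hinj
    simp only [Finset.range_zero, Finset.prod_empty, Finset.sum_const, nsmul_eq_mul, mul_one]
    have : S.card ≤ 1 := Finset.card_le_one.2 fun z hz z' hz' =>
      hinj z hz z' hz' fun i h1 h2 => by omega
    exact_mod_cast this
  | succ j ih =>
    intro k hk q S hSF hSq hinj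
    have h1 : ∑ z ∈ S, ∏ i ∈ Finset.range (j + 1), (κ (k + i) (c (k + i) z))⁻¹ =
        (κ k q)⁻¹ * ∑ z ∈ S, ∏ i ∈ Finset.range j,
          (κ (k + 1 + i) (c (k + 1 + i) z))⁻¹ := by
      rw [Finset.mul_sum]
      refine Finset.sum_congr rfl fun z hz => ?_
      rw [Finset.prod_range_succ', mul_comm, add_zero, hSq z hz]
      congr 1
      refine Finset.prod_congr rfl fun i _ => ?_
      rw [show k + (i + 1) = k + 1 + i by ring]
    rw [h1, ← Finset.sum_fiberwise_of_maps_to (t := S.image (c (k + 1))) (g := c (k + 1))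
      (fun z hz => Finset.mem_image_of_mem _ hz)]
    have h2 : ∑ q' ∈ S.image (c (k + 1)), ∑ z ∈ S with c (k + 1) z = q',
        ∏ i ∈ Finset.range j, (κ (k + 1 + i) (c (k + 1 + i) z))⁻¹ ≤
        ∑ q' ∈ S.image (c (k + 1)), 1 := by
      refine Finset.sum_le_sum fun q' _ => ?_
      refine ih (k + 1) (by omega) q' _ (fun z hz => hSF ?_) (fun z hz => ?_) ?_
      · exact (Finset.mem_filter.1 hz).1
      · exact (Finset.mem_filter.1 hz).2
      · intro z hz z' hz' he
        rw [Finset.mem_filter] at hz hz'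
        refine hinj z hz.1 z' hz'.1 fun i hi1 hi2 => ?_
        rcases eq_or_ne i (k + 1) with rfl | hne
        · rw [hz.2, hz'.2]
        · exact he i (by omega) (by omega)
    rw [Finset.sum_const, nsmul_eq_mul, mul_one] at h2
    have h3 := h2.trans (hκ k hk q S hSF hSq)
    exact inv_mul_le_one_of_le₀ h3 (hκ0 k q)

end

/-! ### Weights and covers of itinerary classes. -/

section
open Set Metric

/-- Points whose orbit stays in the annuli from time `N` on, with prescribed initial itinerary. -/
def itineraryPiece (lam : ℕ → ℂ) (a b : ℕ → ℝ) (N : ℕ) (σ : List (ℤ × ℤ)) : Set ℂ :=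
  {z | (∀ n, N ≤ n → a n ≤ ‖nonautExp lam n z‖ ∧ ‖nonautExp lam n z‖ ≤ b n) ∧
    itinerary lam N z = σ}

lemma orbitSeq_of_le {lam : ℕ → ℂ} {a : ℕ → ℝ} {N k : ℕ} {z : ℂ} (hk : k ≤ N) :
    orbitSeq lam a N z k = a k := if_pos hk

lemma orbitSeq_of_lt {lam : ℕ → ℂ} {a : ℕ → ℝ} {N k : ℕ} {z : ℂ} (hk : N < k) :
    orbitSeq lam a N z k = ‖nonautExp lam k z‖ := if_neg (not_le.2 hk)

lemma modProd_orbitSeq_self {lam : ℕ → ℂ} {a : ℕ → ℝ} {N : ℕ} {z : ℂ} :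
    modProd (orbitSeq lam a N z) N = modProd a N :=
  Finset.prod_congr rfl fun _ hk => orbitSeq_of_le (Finset.mem_Icc.1 hk).2

lemma minProd_orbitSeq_self {lam : ℕ → ℂ} {a b : ℕ → ℝ} {N : ℕ} {z : ℂ} :
    minProd a b (orbitSeq lam a N z) N = minProd a b a N :=
  Finset.prod_congr rfl fun _ hk => by rw [orbitSeq_of_le (Finset.mem_Icc.1 hk).2]

/-- The lower bound for `‖nonautExp lam (k + 1) z‖` given by the cell of the previous point. -/
noncomputable def cellModulus (lam : ℕ → ℂ) (k : ℕ) (q : ℤ × ℤ) : ℝ :=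
  ‖lam (k + 1)‖ * Real.exp ((q.1 : ℝ) / 4)

lemma cellModulus_nonneg (lam : ℕ → ℂ) (k : ℕ) (q : ℤ × ℤ) : 0 ≤ cellModulus lam k q := by
  unfold cellModulus; positivity

lemma cellModulus_le (lam : ℕ → ℂ) (k : ℕ) (z : ℂ) :
    cellModulus lam k (orbitCell lam k z) ≤ ‖nonautExp lam (k + 1) z‖ := by
  rw [norm_nonautExp_succ, cellModulus]
  gcongr
  have := Int.floor_le (4 * (nonautExp lam k z).re)
  simp only [orbitCell, gridCell]
  linarith

lemma norm_nonautExp_le_two_mul_cellModulus (lam : ℕ → ℂ) (k : ℕ) (z : ℂ) :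
    ‖nonautExp lam (k + 1) z‖ ≤ 2 * cellModulus lam k (orbitCell lam k z) := by
  rw [norm_nonautExp_succ, cellModulus]
  have h1 := (Int.lt_floor_add_one (4 * (nonautExp lam k z).re)).le
  simp only [orbitCell, gridCell]
  set q := ⌊4 * (nonautExp lam k z).re⌋
  have h2 : Real.exp (nonautExp lam k z).re ≤ Real.exp (Real.log 2) * Real.exp ((q : ℝ) / 4) := by
    rw [← Real.exp_add]
    have := Real.log_two_gt_d9
    exact Real.exp_le_exp.2 (by linarith)
  rw [Real.exp_log (by norm_num)] at h2
  calc _ ≤ ‖lam (k + 1)‖ * (2 * Real.exp ((q : ℝ) / 4)) := by gcongr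
    _ = _ := by ring

lemma min_mul_le_mul_min {x y c : ℝ} (hc : 1 ≤ c) (hx : 0 ≤ x) :
    min x (c * y) ≤ c * min x y := by
  rw [mul_min_of_nonneg _ _ (by linarith)]
  exact min_le_min (le_mul_of_one_le_left hx hc) le_rfl

namespace AnnulusData

variable {lam : ℕ → ℂ} {a b : ℕ → ℝ} {D : ℝ} (h : AnnulusData lam a b D)
include h

/-- An orbit of the escape rate set is confined to the annuli only from some time on. Replacing its
earlier moduli by those of a gives an element of the box, at the price of constants depending on N
and on the initial itinerary. -/
lemma orbitSeq_mem {N : ℕ} {z : ℂ}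
    (hz : ∀ n, N ≤ n → a n ≤ ‖nonautExp lam n z‖ ∧ ‖nonautExp lam n z‖ ≤ b n) :
    orbitSeq lam a N z ∈ seqBox a b := fun k hk => by
  by_cases hkN : k ≤ N
  · rw [orbitSeq_of_le hkN]; exact ⟨le_rfl, (h.a_lt k hk).le⟩
  · rw [orbitSeq_of_lt (not_le.1 hkN)]; exact hz k (by omega)

/-- The annulus of level k pulls back under w ↦ λ_k e^w to a vertical strip of width Δ_k; the
modulus of λ_k only translates it. -/
lemma log_div_sub {k : ℕ} (hk : 1 ≤ k) :
    Real.log (b k / ‖lam k‖) - Real.log (a k / ‖lam k‖) = annulusModulus a b k := by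
  have h1 := norm_pos_iff.2 (h.lam_ne k hk)
  have h2 := h.a_pos k hk
  have h3 := h2.trans (h.a_lt k hk)
  rw [annulusModulus, Real.log_div h3.ne' h1.ne', Real.log_div h2.ne' h1.ne',
    Real.log_div h3.ne' h2.ne']
  ring

lemma re_mem_strip {k : ℕ} {z : ℂ} (hz1 : a (k + 1) ≤ ‖nonautExp lam (k + 1) z‖)
    (hz2 : ‖nonautExp lam (k + 1) z‖ ≤ b (k + 1)) :
    Real.log (a (k + 1) / ‖lam (k + 1)‖) ≤ (nonautExp lam k z).re ∧
      (nonautExp lam k z).re ≤ Real.log (b (k + 1) / ‖lam (k + 1)‖) := by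
  have h1 := norm_pos_iff.2 (h.lam_ne (k + 1) (by omega))
  have h2 := h.a_pos (k + 1) (by omega)
  have h3 := h2.trans (h.a_lt (k + 1) (by omega))
  rw [norm_nonautExp_succ] at hz1 hz2
  rw [Real.log_le_iff_le_exp (by positivity), Real.le_log_iff_exp_le (by positivity),
    div_le_iff₀ h1, le_div_iff₀ h1, mul_comm]
  exact ⟨hz1, hz2⟩

/-- The successors lie in a disc of radius 2X and in a strip of width Δ_{k+2}. The additive
constants of the grid count are absorbed because X ≥ 1/2 and min(Δ_{k+2}, X) ≥ min(D, 1/2). -/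
lemma card_image_orbitCell_le {N : ℕ} (hN : ∀ n, N ≤ n → 1 ≤ a n) {F : Set ℂ}
    (hF : ∀ z ∈ F, ∀ n, N ≤ n → a n ≤ ‖nonautExp lam n z‖ ∧ ‖nonautExp lam n z‖ ≤ b n)
    {k : ℕ} (hk : N ≤ k) (q : ℤ × ℤ) (S : Finset ℂ) (hS : (S : Set ℂ) ⊆ F)
    (hq : ∀ z ∈ S, orbitCell lam k z = q) :
    ((S.image (orbitCell lam (k + 1))).card : ℝ) ≤ 20 * (16 + 2 / min D (1 / 2)) *
      (cellModulus lam k q * min (annulusModulus a b (k + 2)) (cellModulus lam k q)) := by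
  have hD := h.D_pos
  have hδ : 0 < min D (1 / 2) := lt_min hD (by norm_num)
  have hΔ := h.modulus (k + 2) (by omega)
  set X := cellModulus lam k q with hX
  have hX0 : 0 ≤ X := cellModulus_nonneg _ _ _
  rcases S.eq_empty_or_nonempty with rfl | ⟨z0, hz0⟩
  · simp only [Finset.image_empty, Finset.card_empty, Nat.cast_zero]
    have : 0 ≤ min (annulusModulus a b (k + 2)) X := le_min (hD.trans hΔ).le hX0
    positivity
  have hX1 : 1 / 2 ≤ X := by
    have h1 := norm_nonautExp_le_two_mul_cellModulus lam k z0
    rw [hq z0 hz0] at h1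
    have h2 := (hF z0 (hS hz0) (k + 1) (by omega)).1
    have h3 := hN (k + 1) (by omega)
    linarith
  have hstrip := h.log_div_sub (k := k + 2) (by omega)
  obtain ⟨T, hT, hcard⟩ := exists_finset_gridCell (h := 4)
    (α := Real.log (a (k + 2) / ‖lam (k + 2)‖)) (β := Real.log (b (k + 2) / ‖lam (k + 2)‖))
    (Y := 2 * X) (by norm_num) (by linarith) (by linarith)
  rw [hstrip] at hcard
  have hsub : S.image (orbitCell lam (k + 1)) ⊆ T := fun p hp => by
    obtain ⟨z, hz, rfl⟩ := Finset.mem_image.1 hp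
    have h1 := hF z (hS hz) (k + 2) (by omega)
    have h2 := h.re_mem_strip h1.1 h1.2
    refine hT _ h2.1 h2.2 ?_
    rw [hX, ← hq z hz]
    exact norm_nonautExp_le_two_mul_cellModulus lam k z
  have h1 : ((S.image (orbitCell lam (k + 1))).card : ℝ) ≤ T.card := by
    exact_mod_cast Finset.card_le_card hsub
  refine (h1.trans hcard).trans ?_
  set m := min (annulusModulus a b (k + 2)) X with hm
  have hmδ : min D (1 / 2) ≤ m := min_le_min hΔ.le hX1
  have h2 : min (annulusModulus a b (k + 2)) (2 * (2 * X)) ≤ 4 * m := by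
    have := min_mul_le_mul_min (x := annulusModulus a b (k + 2)) (y := X) (c := 4) (by norm_num)
      (hD.trans hΔ).le
    rw [show 2 * (2 * X) = 4 * X by ring]; exact this
  have h3 : 2 ≤ 2 / min D (1 / 2) * m := by
    rw [div_mul_eq_mul_div, le_div_iff₀ hδ]; linarith
  calc (4 * min (annulusModulus a b (k + 2)) (2 * (2 * X)) + 2) * (2 * 4 * (2 * X) + 2)
      ≤ (4 * (4 * m) + 2 / min D (1 / 2) * m) * (20 * X) := by
        have : 0 < m := hδ.trans_le hmδ
        apply mul_le_mul
        · linarith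
        · linarith
        · positivity
        · positivity
    _ = _ := by ring

/-- From time N on, each factor of the weight 1/(P_n M_n) is at most C times the reciprocal of the
bound κ for the number of successors, so `sum_prod_inv_le_one` applies. Prescribing σ puts all
points in the same cell at time N. -/
lemma exists_sum_weight_le {N : ℕ} (hN : ∀ n, N ≤ n → 1 ≤ a n) (σ : List (ℤ × ℤ)) :
    ∃ K : ℝ, 1 ≤ K ∧ ∀ n, max N 1 ≤ n → ∀ S : Finset ℂ,
      (S : Set ℂ) ⊆ itineraryPiece lam a b N σ → InjOn (itinerary lam n) S →
      ∑ z ∈ S, 1 / (modProd (orbitSeq lam a N z) n * minProd a b (orbitSeq lam a N z) n) ≤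
        K ^ n := by
  have hD := h.D_pos
  have hδ : 0 < min D (1 / 2) := lt_min hD (by norm_num)
  have ha_mem : a ∈ seqBox a b := fun k hk => ⟨le_rfl, (h.a_lt k hk).le⟩
  set C : ℝ := 20 * (16 + 2 / min D (1 / 2)) with hC
  have hC1 : 1 ≤ C := by
    have : 0 < 2 / min D (1 / 2) := by positivity
    linarith
  -- The part of the weight that belongs to the first N moduli is the same for all points, since
  -- these moduli are those of a.
  set c0 : ℝ := 1 / (modProd a N * minProd a b a N) with hc0
  have hc0p : 0 < c0 := by
    have := modProd_pos h.a_pos N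
    have := h.minProd_pos ha_mem N
    positivity
  set κ : ℕ → ℤ × ℤ → ℝ := fun k q =>
    C * (cellModulus lam k q * min (annulusModulus a b (k + 2)) (cellModulus lam k q)) with hκ
  have hκ0 : ∀ k q, 0 ≤ κ k q := fun k q => by
    have h1 := cellModulus_nonneg lam k q
    have h2 : 0 ≤ min (annulusModulus a b (k + 2)) (cellModulus lam k q) :=
      le_min (hD.trans (h.modulus _ (by omega))).le h1
    positivity
  refine ⟨max c0 1 * C, one_le_mul_of_one_le_of_one_le (le_max_right _ _) hC1,
    fun n hn S hS hinj => ?_⟩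
  obtain ⟨j, rfl⟩ : ∃ j, n = N + j := Nat.exists_eq_add_of_le ((le_max_left _ _).trans hn)
  have hprod : ∀ z ∈ itineraryPiece lam a b N σ, ∀ j,
      1 / (modProd (orbitSeq lam a N z) (N + j) * minProd a b (orbitSeq lam a N z) (N + j)) ≤
        c0 * (C ^ j * ∏ i ∈ Finset.range j, (κ (N + i) (orbitCell lam (N + i) z))⁻¹) := by
    intro z hz j
    have hmem := h.orbitSeq_mem hz.1
    induction j with
    | zero => simp [modProd_orbitSeq_self, minProd_orbitSeq_self, hc0]
    | succ j ih =>
      rw [← add_assoc, modProd_succ, minProd_succ, Finset.prod_range_succ]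
      have hx := orbitSeq_of_lt (lam := lam) (a := a) (z := z) (show N < N + j + 1 by omega)
      rw [hx]
      set y := ‖nonautExp lam (N + j + 1) z‖ with hy
      set X := cellModulus lam (N + j) (orbitCell lam (N + j) z) with hX
      have hXy : X ≤ y := cellModulus_le lam (N + j) z
      have hX0 : 0 < X := by
        have := norm_nonautExp_le_two_mul_cellModulus lam (N + j) z
        have := norm_nonautExp_pos h.lam_ne (N + j + 1) (by omega) z
        linarith
      have hΔ0 := hD.trans (h.modulus (N + j + 2) (by omega))
      have hstep : 1 / (y * min (annulusModulus a b (N + j + 2)) y) ≤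
          C * (κ (N + j) (orbitCell lam (N + j) z))⁻¹ := by
        have h1 : C * (κ (N + j) (orbitCell lam (N + j) z))⁻¹ =
            1 / (X * min (annulusModulus a b (N + j + 2)) X) := by
          have : 0 < min (annulusModulus a b (N + j + 2)) X := lt_min hΔ0 hX0
          simp only [hκ, ← hX]
          field_simp
        rw [h1]
        have : 0 < min (annulusModulus a b (N + j + 2)) X := lt_min hΔ0 hX0
        refine one_div_le_one_div_of_le (by positivity) ?_
        exact mul_le_mul hXy (min_le_min le_rfl hXy) this.le (hX0.le.trans hXy)
      have hPp := modProd_pos (h.x_pos hmem) (N + j)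
      have hMp := h.minProd_pos hmem (N + j)
      calc _ = 1 / (modProd (orbitSeq lam a N z) (N + j) *
              minProd a b (orbitSeq lam a N z) (N + j)) *
            (1 / (y * min (annulusModulus a b (N + j + 2)) y)) := by
              rw [one_div_mul_one_div]; congr 1; ring
        _ ≤ c0 * (C ^ j * ∏ i ∈ Finset.range j, (κ (N + i) (orbitCell lam (N + i) z))⁻¹) *
            (C * (κ (N + j) (orbitCell lam (N + j) z))⁻¹) := by
              have : 0 < min (annulusModulus a b (N + j + 2)) y :=
                lt_min hΔ0 (hX0.trans_le hXy)
              have hy0 := hX0.trans_le hXy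
              refine mul_le_mul ih hstep (by positivity) ?_
              have := Finset.prod_nonneg (s := Finset.range j) fun i _ =>
                inv_nonneg.2 (hκ0 (N + i) (orbitCell lam (N + i) z))
              positivity
        _ = _ := by ring
  have hmain := sum_prod_inv_le_one (c := orbitCell lam) (κ := κ)
    (F := itineraryPiece lam a b N σ) (N := N) hκ0
    (fun k hk q S hS hq => h.card_image_orbitCell_le hN (fun z hz => hz.1) hk q S hS hq)
  have hsum1 : ∑ z ∈ S, ∏ i ∈ Finset.range j, (κ (N + i) (orbitCell lam (N + i) z))⁻¹ ≤ 1 := by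
    rcases S.eq_empty_or_nonempty with rfl | ⟨z0, hz0⟩
    · simp
    have hsame : ∀ z ∈ S, ∀ i ≤ N, orbitCell lam i z = orbitCell lam i z0 := fun z hz =>
      itinerary_eq_iff.1 ((hS hz).2.trans (hS hz0).2.symm)
    refine hmain j N le_rfl (orbitCell lam N z0) S hS (fun z hz => hsame z hz N le_rfl) ?_
    intro z hz z' hz' he
    refine hinj hz hz' (itinerary_eq_iff.2 fun i hi => ?_)
    by_cases hiN : i ≤ N
    · rw [hsame z hz i hiN, hsame z' hz' i hiN]
    · exact he i (by omega) hi
  calc _ ≤ ∑ z ∈ S, c0 * (C ^ j * ∏ i ∈ Finset.range j,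
        (κ (N + i) (orbitCell lam (N + i) z))⁻¹) :=
        Finset.sum_le_sum fun z hz => hprod z (hS hz) j
    _ = c0 * C ^ j * ∑ z ∈ S, ∏ i ∈ Finset.range j,
        (κ (N + i) (orbitCell lam (N + i) z))⁻¹ := by
        rw [Finset.mul_sum]; exact Finset.sum_congr rfl fun _ _ => by ring
    _ ≤ c0 * C ^ j * 1 := by gcongr
    _ ≤ max c0 1 ^ (N + j) * C ^ (N + j) := by
        rw [mul_one]
        have e1 : c0 ≤ max c0 1 ^ (N + j) := (le_max_left _ _).trans
          (le_self_pow₀ (le_max_right _ _) (by have := (le_max_right _ _).trans hn; omega))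
        have e2 : C ^ j ≤ C ^ (N + j) := pow_le_pow_right₀ hC1 (by omega)
        gcongr
    _ = _ := (mul_pow _ _ _).symm

/-- The iterate of order n + 1 maps a class into a disc of radius 2 x_{n+1} intersected with a strip
of width Δ_{n+2}. A fine grid there is pulled back by `norm_sub_le_prod`, which contracts by about
1/P_{n+1}: the two side lengths become about 1/P_n and w_n. -/
lemma exists_class_cover {N : ℕ} (σ : List (ℤ × ℤ)) :
    ∃ K : ℝ, 1 ≤ K ∧ ∀ F ⊆ itineraryPiece lam a b N σ, ∀ n, max N 1 ≤ n → ∀ z ∈ F, ∀ r : ℝ, 0 < r →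
      ∃ C : Finset ℂ, (C : Set ℂ) ⊆ F ∧
      {z' ∈ F | itinerary lam n z' = itinerary lam n z} ⊆ ⋃ c ∈ C, closedBall c r ∧
      (C.card : ℝ) ≤ K ^ n * (1 / (modProd (orbitSeq lam a N z) n * r) + 1) *
        (stripWidth a b (orbitSeq lam a N z) n / r + 1) := by
  classical
  have hD := h.D_pos
  -- c1 accounts for the first N factors, where the true moduli were replaced by those of a. It is
  -- uniform because points with the same initial itinerary have moduli comparable up to the factor
  -- 2.
  obtain ⟨c1, hc1, hpre⟩ : ∃ c1 : ℝ, 0 ≤ c1 ∧ ∀ z ∈ itineraryPiece lam a b N σ,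
      ∏ k ∈ Finset.Icc 1 N, (a k / ‖nonautExp lam k z‖) ≤ c1 := by
    rcases (itineraryPiece lam a b N σ).eq_empty_or_nonempty with hemp | ⟨z0, hz0⟩
    · exact ⟨0, le_rfl, fun z hz => by rw [hemp] at hz; exact hz.elim⟩
    refine ⟨∏ k ∈ Finset.Icc 1 N, (2 * a k / ‖nonautExp lam k z0‖),
      Finset.prod_nonneg fun k hk => ?_, fun z hz => Finset.prod_le_prod (fun k hk => ?_)
      fun k hk => ?_⟩
    · have := h.a_pos k (Finset.mem_Icc.1 hk).1
      positivity
    · have := h.a_pos k (Finset.mem_Icc.1 hk).1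
      positivity
    · obtain ⟨hk1, hk2⟩ := Finset.mem_Icc.1 hk
      obtain ⟨i, rfl⟩ : ∃ i, k = i + 1 := Nat.exists_eq_succ_of_ne_zero (by omega)
      have hs := itinerary_eq_iff.1 (hz0.2.trans hz.2.symm) i (by omega)
      have h1 := norm_nonautExp_succ_le_two_mul hs
      have h2 := norm_nonautExp_pos h.lam_ne (i + 1) hk1 z
      have h3 := norm_nonautExp_pos h.lam_ne (i + 1) hk1 z0
      have h4 := h.a_pos (i + 1) hk1
      rw [div_le_div_iff₀ h2 h3]
      nlinarith
  set K1 : ℝ := (32 * c1 + 2) * 4 with hK1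
  have hK1' : 1 ≤ K1 := by linarith
  refine ⟨K1 ^ 2, one_le_pow₀ hK1', fun F hFσ n hn z hz r hr => ?_⟩
  have hn1 : 1 ≤ n := (le_max_right _ _).trans hn
  have hnN : N ≤ n := (le_max_left _ _).trans hn
  have hzσ := hFσ hz
  have hmem := h.orbitSeq_mem hzσ.1
  set x := orbitSeq lam a N z with hx
  have hP := modProd_pos (h.x_pos hmem) n
  have hP' := modProd_pos (h.x_pos hmem) (n + 1)
  have hw := h.stripWidth_pos hmem n
  have hxn : x (n + 1) = ‖nonautExp lam (n + 1) z‖ := orbitSeq_of_lt (by omega)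
  have hxpos := h.x_pos hmem (n + 1) (by omega)
  set Λ : ℝ := ∏ k ∈ Finset.Icc 1 (n + 1), 4 / ‖nonautExp lam k z‖ with hΛ
  have hΛ0 : 0 < Λ := Finset.prod_pos fun k hk => by
    have := norm_nonautExp_pos h.lam_ne k (Finset.mem_Icc.1 hk).1 z
    positivity
  have hΛle : Λ ≤ 4 ^ (n + 1) * c1 / modProd x (n + 1) := by
    rw [le_div_iff₀ hP']
    have h1 : Λ * modProd x (n + 1) =
        4 ^ (n + 1) * ∏ k ∈ Finset.Icc 1 (n + 1), (x k / ‖nonautExp lam k z‖) := by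
      rw [hΛ, modProd, ← Finset.prod_mul_distrib]
      rw [show (4 : ℝ) ^ (n + 1) = ∏ k ∈ Finset.Icc 1 (n + 1), 4 by simp,
        ← Finset.prod_mul_distrib]
      exact Finset.prod_congr rfl fun _ _ => by ring
    have h2 : ∏ k ∈ Finset.Icc 1 (n + 1), (x k / ‖nonautExp lam k z‖) =
        ∏ k ∈ Finset.Icc 1 N, (a k / ‖nonautExp lam k z‖) := by
      rw [← Finset.prod_subset (Finset.Icc_subset_Icc_right (show N ≤ n + 1 by omega))]
      · exact Finset.prod_congr rfl fun k hk => by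
          rw [hx, orbitSeq_of_le (Finset.mem_Icc.1 hk).2]
      · intro k hk hk'
        simp only [Finset.mem_Icc] at hk hk'
        rw [hx, orbitSeq_of_lt (by omega)]
        exact div_self (norm_nonautExp_pos h.lam_ne k hk.1 z).ne'
    rw [h1, h2]
    gcongr
    exact hpre z hzσ
  -- Two points of one grid cell of side 1/η differ by at most 2/η = r/Λ, hence their preimages by
  -- at most r.
  set η : ℝ := 2 * Λ / r with hη
  have hη0 : 0 < η := by positivity
  have hstrip := h.log_div_sub (k := n + 2) (by omega)
  have hΔ := h.modulus (n + 2) (by omega)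
  obtain ⟨T, hT, hcard⟩ := exists_finset_gridCell (h := η)
    (α := Real.log (a (n + 2) / ‖lam (n + 2)‖)) (β := Real.log (b (n + 2) / ‖lam (n + 2)‖))
    (Y := 2 * x (n + 1)) hη0 (by linarith) (by linarith)
  rw [hstrip] at hcard
  set A : Set ℂ := {z' ∈ F | itinerary lam n z' = itinerary lam n z} with hA
  have hcell : ∀ z' ∈ A, gridCell η (nonautExp lam (n + 1) z') ∈ T := fun z' hz' => by
    have h1 := (hFσ hz'.1).1 (n + 2) (by omega)
    have h2 := h.re_mem_strip h1.1 h1.2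
    refine hT _ h2.1 h2.2 ?_
    rw [hxn]
    exact norm_nonautExp_succ_le_two_mul (itinerary_eq_iff.1 hz'.2 n le_rfl)
  -- Covering numbers use centres in the set, so each occupied cell is represented by a point of the
  -- class. The value 0 at unoccupied cells is filtered out below.
  have hpick : ∀ t : ℤ × ℤ, ∃ y, (∃ z' ∈ A, gridCell η (nonautExp lam (n + 1) z') = t) →
      y ∈ A ∧ gridCell η (nonautExp lam (n + 1) y) = t := fun t => by
    by_cases ht : ∃ z' ∈ A, gridCell η (nonautExp lam (n + 1) z') = t
    · obtain ⟨y, hy⟩ := ht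
      exact ⟨y, fun _ => hy⟩
    · exact ⟨0, fun h => absurd h ht⟩
  choose pick hpick using hpick
  refine ⟨(T.filter fun t => ∃ z' ∈ A, gridCell η (nonautExp lam (n + 1) z') = t).image pick,
    ?_, ?_, ?_⟩
  · intro y hy
    simp only [Finset.coe_image, Finset.coe_filter, mem_image, mem_ofPred_eq] at hy
    obtain ⟨t, ⟨-, ht⟩, rfl⟩ := hy
    exact (hpick t ht).1.1
  · intro z' hz'
    set t := gridCell η (nonautExp lam (n + 1) z') with ht
    have hex : ∃ z' ∈ A, gridCell η (nonautExp lam (n + 1) z') = t := ⟨z', hz', rfl⟩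
    have hp := hpick t hex
    refine mem_iUnion₂.2 ⟨pick t, Finset.mem_image_of_mem _
      (Finset.mem_filter.2 ⟨hcell z' hz', hex⟩), ?_⟩
    rw [mem_closedBall, dist_eq_norm]
    have h1 := norm_sub_le_prod h.lam_ne (y := z) (z := z') (z' := pick t) (n + 1)
      (fun k hk => itinerary_eq_iff.1 hz'.2 k (by omega))
      (fun k hk => itinerary_eq_iff.1 hp.1.2 k (by omega))
    have h2 := norm_sub_le_of_gridCell_eq hη0 (hp.2.trans ht).symm
    calc ‖z' - pick t‖ ≤ Λ * ‖nonautExp lam (n + 1) z' - nonautExp lam (n + 1) (pick t)‖ := h1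
      _ ≤ Λ * (2 / η) := by gcongr
      _ = r := by rw [hη]; field_simp
  · have hc : (((T.filter fun t => ∃ z' ∈ A,
        gridCell η (nonautExp lam (n + 1) z') = t).image pick).card : ℝ) ≤ T.card := by
      exact_mod_cast Finset.card_image_le.trans (Finset.card_filter_le _ _)
    refine (hc.trans hcard).trans ?_
    set m := min (annulusModulus a b (n + 2)) (x (n + 1)) with hm
    have hm0 : 0 < m := h.min_pos hmem (n + 1) (by omega)
    have h2 : min (annulusModulus a b (n + 2)) (2 * (2 * x (n + 1))) ≤ 4 * m := by
      have := min_mul_le_mul_min (x := annulusModulus a b (n + 2)) (y := x (n + 1)) (c := 4)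
        (by norm_num) (hD.trans hΔ).le
      rw [show 2 * (2 * x (n + 1)) = 4 * x (n + 1) by ring]; exact this
    have hwm : stripWidth a b x n = m / modProd x (n + 1) := rfl
    have hPx : modProd x (n + 1) = modProd x n * x (n + 1) := modProd_succ x n
    have h4 : (1 : ℝ) ≤ 4 ^ n := one_le_pow₀ (by norm_num)
    have hηle : η ≤ 8 * 4 ^ n * c1 / (modProd x (n + 1) * r) := by
      rw [hη, div_le_div_iff₀ hr (by positivity)]
      rw [le_div_iff₀ hP'] at hΛle
      calc 2 * Λ * (modProd x (n + 1) * r) = 2 * (Λ * modProd x (n + 1)) * r := by ring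
        _ ≤ 2 * (4 ^ (n + 1) * c1) * r := by gcongr
        _ = _ := by rw [pow_succ]; ring
    have hK1n : K1 ^ n = (32 * c1 + 2) ^ n * 4 ^ n := by rw [hK1, mul_pow]
    have hbase : (32 * c1 + 2) * 4 ^ n ≤ K1 ^ n := by
      rw [hK1n]
      gcongr
      exact le_self_pow₀ (by linarith) (by omega)
    have e1 : η * min (annulusModulus a b (n + 2)) (2 * (2 * x (n + 1))) + 2 ≤
        K1 ^ n * (stripWidth a b x n / r + 1) := by
      calc _ ≤ 8 * 4 ^ n * c1 / (modProd x (n + 1) * r) * (4 * m) + 2 * 4 ^ n := by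
            refine add_le_add (mul_le_mul hηle h2 ?_ (by positivity)) (by linarith)
            exact le_min (hD.trans hΔ).le (by linarith)
        _ = 32 * c1 * 4 ^ n * (stripWidth a b x n / r) + 2 * 4 ^ n := by
            rw [hwm]; field_simp; ring
        _ ≤ (32 * c1 + 2) * 4 ^ n * (stripWidth a b x n / r) + (32 * c1 + 2) * 4 ^ n := by
            have : 0 ≤ stripWidth a b x n / r := by positivity
            gcongr <;> linarith
        _ = (32 * c1 + 2) * 4 ^ n * (stripWidth a b x n / r + 1) := by ring
        _ ≤ _ := by gcongr
    have e2 : 2 * η * (2 * x (n + 1)) + 2 ≤ K1 ^ n * (1 / (modProd x n * r) + 1) := by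
      calc _ ≤ 2 * (8 * 4 ^ n * c1 / (modProd x (n + 1) * r)) * (2 * x (n + 1)) + 2 * 4 ^ n := by
            gcongr; linarith
        _ = 32 * c1 * 4 ^ n * (1 / (modProd x n * r)) + 2 * 4 ^ n := by
            rw [hPx]; field_simp; ring
        _ ≤ (32 * c1 + 2) * 4 ^ n * (1 / (modProd x n * r)) + (32 * c1 + 2) * 4 ^ n := by
            gcongr <;> linarith
        _ = (32 * c1 + 2) * 4 ^ n * (1 / (modProd x n * r) + 1) := by ring
        _ ≤ _ := by gcongr
    calc _ ≤ K1 ^ n * (stripWidth a b x n / r + 1) * (K1 ^ n * (1 / (modProd x n * r) + 1)) := by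
          refine mul_le_mul e1 e2 (by positivity) (by positivity)
      _ = _ := by rw [← pow_mul, mul_comm 2 n, pow_mul]; ring

end AnnulusData

end

/-! ### Upper bounds for the dimensions of the escape rate set. -/

section
open Set Metric

lemma packingDim_le_of_countable_cover {X ι : Type*} [MetricSpace X] [Countable ι] [Nonempty ι]
    {A : Set X} {d : ℝ≥0∞} (F : ι → Set X) (hA : A ⊆ ⋃ i, F i) (hF : ∀ i, upperBoxDim (F i) ≤ d) :
    packingDim A ≤ d := by
  obtain ⟨f, hf⟩ := exists_surjective_nat ι
  refine iInf₂_le_of_le (fun n => F (f n)) ?_ (iSup_le fun n => hF _)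
  rwa [hf.iUnion_comp F]

lemma escapeRateSet_subset {lam : ℕ → ℂ} {a b : ℕ → ℝ} (N0 : ℕ) :
    escapeRateSet lam a b ⊆ ⋃ p : {N // N0 ≤ N} × List (ℤ × ℤ),
      itineraryPiece lam a b p.1 p.2 := fun z hz => by
  obtain ⟨N, hN⟩ := eventually_atTop.1 hz
  exact mem_iUnion.2 ⟨⟨⟨max N N0, le_max_right _ _⟩, itinerary lam (max N N0) z⟩,
    fun n hn => hN n ((le_max_left _ _).trans hn), rfl⟩

namespace AnnulusData

variable {lam : ℕ → ℂ} {a b : ℕ → ℝ} {D : ℝ} (h : AnnulusData lam a b D)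
include h

lemma exists_start : ∃ N0, 1 ≤ N0 ∧ (∀ n, N0 ≤ n → 1 ≤ a n) ∧
    ∀ n, N0 ≤ n → ∀ x ∈ seqBox a b, 1 < modProd x n := by
  obtain ⟨N, hN⟩ := eventually_atTop.1 (h.one_le_a.and h.eventually_one_lt_modProd)
  exact ⟨max N 1, le_max_right _ _, fun n hn => (hN n ((le_max_left _ _).trans hn)).1,
    fun n hn => (hN n ((le_max_left _ _).trans hn)).2⟩

lemma modProd_pos_all (n : ℕ) : 0 < modProd a n := modProd_pos h.a_pos n

/-- The bound on the lower limit gives every orbit infinitely many good generations, which is all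
that `dimH_le_of_class_covers` asks for. -/
theorem dimH_escapeRateSet_le {t t' : ℝ} (htt : t < t') (ht' : 0 < t')
    (hφ : ∀ x ∈ seqBox a b, liminf (fun n : ℕ => (phiRatio a b n x : EReal)) atTop < t) :
    dimH (escapeRateSet lam a b) ≤ ENNReal.ofReal (1 + t') := by
  obtain ⟨N0, hN01, hN0, hN0'⟩ := h.exists_start
  refine (dimH_mono (escapeRateSet_subset N0)).trans ?_
  rw [dimH_iUnion]
  refine iSup_le fun ⟨⟨N, hN⟩, σ⟩ => ?_
  obtain ⟨K1, hK1, hW⟩ := h.exists_sum_weight_le (fun n hn => hN0 n (hN.trans hn)) σ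
  obtain ⟨K2, hK2, hcov⟩ := h.exists_class_cover (N := N) σ
  have hmem : ∀ z ∈ itineraryPiece lam a b N σ, orbitSeq lam a N z ∈ seqBox a b :=
    fun z hz => h.orbitSeq_mem hz.1
  refine dimH_le_of_class_covers (τ := itinerary lam) (n0 := max N 1) (K := max K1 K2)
    (P := fun n z => modProd (orbitSeq lam a N z) n)
    (M := fun n z => minProd a b (orbitSeq lam a N z) n)
    (w := fun n z => stripWidth a b (orbitSeq lam a N z) n) (hK1.trans (le_max_left _ _))
    h.modProd_pos_all h.growth (fun n _ z hz => h.modProd_le (hmem z hz) n)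
    (fun n _ z hz => ⟨h.stripWidth_pos (hmem z hz) n, h.stripWidth_le (hmem z hz) n⟩)
    (fun n _ z hz => h.minProd_pos (hmem z hz) n)
    (fun n hn S hS hinj => (hW n hn S hS hinj).trans
      (pow_le_pow_left₀ (by linarith) (le_max_left _ _) n)) ?_ htt ht' ?_
  · intro n hn z hz r hr
    obtain ⟨C, h1, h2, h3⟩ := hcov _ subset_rfl n hn z hz r hr
    refine ⟨C, h1, h2, h3.trans ?_⟩
    have := modProd_pos (h.x_pos (hmem z hz)) n
    have := h.stripWidth_pos (hmem z hz) n
    gcongr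
    exact le_max_right _ _
  · intro z hz
    have h1 := frequently_lt_of_liminf_lt (by isBoundedDefault) (hφ _ (hmem z hz))
    rw [frequently_atTop] at h1 ⊢
    intro m
    obtain ⟨n, hn, hlt⟩ := h1 (max m N0 + 1)
    obtain ⟨k, rfl⟩ : ∃ k, n = k + 1 := Nat.exists_eq_succ_of_ne_zero (by omega)
    refine ⟨k, by have := le_max_left m N0; omega, ?_⟩
    rw [← h.phiRatio_succ_le_iff (hmem z hz)
      (hN0' k (by have := le_max_right m N0; omega) _ (hmem z hz))]
    exact_mod_cast hlt.le

/-- The bound on the upper limit holds from a time depending on the orbit, whereas box dimension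
needs uniformity. Packing dimension permits a countable decomposition, here by the starting time M
and a bound L for P_M. -/
theorem packingDim_escapeRateSet_le {t t' : ℝ} (ht0 : 0 < t) (htt : t < t')
    (hψ : ∀ x ∈ seqBox a b, limsup (fun n : ℕ => (psiRatio a b n x : EReal)) atTop < t) :
    packingDim (escapeRateSet lam a b) ≤ ENNReal.ofReal (1 + t') := by
  obtain ⟨N0, hN01, hN0, hN0'⟩ := h.exists_start
  have hmem : ∀ N σ, ∀ z ∈ itineraryPiece lam a b N σ, orbitSeq lam a N z ∈ seqBox a b :=
    fun N σ z hz => h.orbitSeq_mem hz.1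
  -- The box dimension estimate needs an exponent at most 1. Truncation is harmless because ψ_n ≤ 1
  -- as soon as P_n > 1.
  set s : ℝ := min t 1 with hs
  set piece : ({N // N0 ≤ N} × List (ℤ × ℤ)) × (ℕ × ℕ) → Set ℂ := fun p =>
    {z ∈ itineraryPiece lam a b p.1.1 p.1.2 | p.1.1 ≤ p.2.1 ∧
      (∀ n, p.2.1 ≤ n → psiRatio a b n (orbitSeq lam a p.1.1 z) ≤ t) ∧
      modProd (orbitSeq lam a p.1.1 z) p.2.1 ≤ p.2.2} with hpiece
  have : Nonempty (({N // N0 ≤ N} × List (ℤ × ℤ)) × (ℕ × ℕ)) := ⟨⟨⟨⟨N0, le_rfl⟩, []⟩, 0, 0⟩⟩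
  refine packingDim_le_of_countable_cover piece (fun z hz => ?_) fun ⟨⟨⟨N, hN⟩, σ⟩, M, L⟩ => ?_
  · obtain ⟨p, hp⟩ := mem_iUnion.1 (escapeRateSet_subset N0 hz)
    have h1 := eventually_lt_of_limsup_lt (hψ _ (hmem _ _ z hp))
    obtain ⟨M, hM⟩ := eventually_atTop.1 h1
    obtain ⟨L, hL⟩ := exists_nat_ge (modProd (orbitSeq lam a p.1 z) (max M p.1))
    refine mem_iUnion.2 ⟨⟨p, max M p.1, L⟩, hp, le_max_right _ _, fun n hn => ?_, hL⟩
    exact_mod_cast (hM n ((le_max_left _ _).trans hn)).le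
  · obtain ⟨K1, hK1, hW⟩ := h.exists_sum_weight_le (fun n hn => hN0 n (hN.trans hn)) σ
    obtain ⟨K2, hK2, hcov⟩ := h.exists_class_cover (N := N) σ
    have hsub : piece ⟨⟨⟨N, hN⟩, σ⟩, M, L⟩ ⊆ itineraryPiece lam a b N σ := fun z hz => hz.1
    have hm : ∀ z ∈ piece ⟨⟨⟨N, hN⟩, σ⟩, M, L⟩, orbitSeq lam a N z ∈ seqBox a b :=
      fun z hz => hmem N σ z hz.1
    -- A point of the piece supplies N ≤ M, which the indices alone do not.
    rcases (piece ⟨⟨⟨N, hN⟩, σ⟩, M, L⟩).eq_empty_or_nonempty with hemp | ⟨z0, hz0⟩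
    · rw [hemp]
      refine upperBoxDim_le_of_coveringNumber_le (C := 1) (d := t') (by linarith) ?_
      exact Eventually.of_forall fun r => by simp
    have hNM : N ≤ M := hz0.2.1
    have hn0 : ∀ {n}, M ≤ n → max N 1 ≤ n := fun hn =>
      (max_le hNM (by omega)).trans hn
    refine upperBoxDim_le_of_class_covers (τ := itinerary lam) (n0 := M) (K := max K1 K2)
      (P := fun n z => modProd (orbitSeq lam a N z) n)
      (M := fun n z => minProd a b (orbitSeq lam a N z) n)
      (w := fun n z => stripWidth a b (orbitSeq lam a N z) n) (hK1.trans (le_max_left _ _))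
      h.modProd_pos_all h.growth (fun n _ z hz => h.modProd_le (hm z hz) n)
      (fun n _ z hz => ⟨h.stripWidth_pos (hm z hz) n, h.stripWidth_le (hm z hz) n⟩)
      (fun n _ z hz => h.minProd_pos (hm z hz) n)
      (fun n hn S hS hinj => (hW n (hn0 hn) S (hS.trans hsub) hinj).trans
        (pow_le_pow_left₀ (by linarith) (le_max_left _ _) n)) ?_
      (fun n _ z hz => stripWidth_mul_minProd n)
      (t := s) (le_min ht0.le zero_le_one) (min_le_right _ _)
      ((min_le_left _ _).trans_lt htt) ?_ (L := L) (fun z hz => hz.2.2.2)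
    · intro n hn z hz r hr
      obtain ⟨C, h1, h2, h3⟩ := hcov _ hsub n (hn0 hn) z hz r hr
      refine ⟨C, h1, h2, h3.trans ?_⟩
      have := modProd_pos (h.x_pos (hm z hz)) n
      have := h.stripWidth_pos (hm z hz) n
      gcongr
      exact le_max_right _ _
    · intro n hn z hz
      have h1 := hN0' n (hN.trans (hNM.trans hn)) _ (hm z hz)
      rw [← h.psiRatio_le_iff (hm z hz) h1]
      exact le_min (hz.2.2.1 n hn) (h.psiRatio_le_one (hm z hz) h1)

end AnnulusData

end

/-! ### Many separated boxes in an annulus, inside a vertical strip. -/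

section
open Set Metric

/-- The closed box of width `s` and height `2π` with left midpoint `ζ`. -/
def expBox (s : ℝ) (ζ : ℂ) : Set ℂ :=
  {w | ζ.re ≤ w.re ∧ w.re ≤ ζ.re + s ∧ |w.im - ζ.im| ≤ Real.pi}

/-- A rectangle with a corner on a circle lies in a thin annulus. -/
lemma rectangle_in_annulus {X s c u0 ℓ v0 u v : ℝ} (hX : 0 < X) (hs0 : 0 < s) (hs1 : s ≤ 1)
    (hc0 : 0 < c) (hc : c ≤ s / 8) (hu0 : -X ≤ u0) (hu1 : u0 + ℓ ≤ X) (hℓ : ℓ ≤ c * X)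
    (hv0 : 0 ≤ v0) (hv0s : v0 ^ 2 = X ^ 2 - u0 ^ 2 + 2 * c * X ^ 2)
    (hu : u0 ≤ u ∧ u ≤ u0 + ℓ) (hv : v0 ≤ v ∧ v ≤ v0 + s / 4 * X) :
    X ^ 2 ≤ u ^ 2 + v ^ 2 ∧ u ^ 2 + v ^ 2 ≤ (X * Real.exp s) ^ 2 := by
  -- Across the rectangle u² changes by at most 2cX², which is exactly the slack built into v0².
  have hd : |u ^ 2 - u0 ^ 2| ≤ 2 * c * X ^ 2 := by
    have : u ^ 2 - u0 ^ 2 = (u - u0) * (u + u0) := by ring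
    rw [this, abs_mul]
    have h1 : |u - u0| ≤ c * X := abs_le.2 ⟨by nlinarith, by linarith⟩
    have h2 : |u + u0| ≤ 2 * X := abs_le.2 ⟨by linarith, by linarith⟩
    calc |u - u0| * |u + u0| ≤ c * X * (2 * X) := by gcongr
      _ = _ := by ring
  obtain ⟨hd1, hd2⟩ := abs_le.1 hd
  have hv0X : v0 ≤ 5 / 4 * X := by
    refine abs_le_of_sq_le_sq' ?_ (by positivity) |>.2
    rw [hv0s]
    nlinarith [sq_nonneg u0, sq_nonneg X]
  constructor
  · have : v0 ^ 2 ≤ v ^ 2 := by gcongr; exact hv.1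
    linarith
  · have h1 : v ^ 2 ≤ (v0 + s / 4 * X) ^ 2 := by
      have := hv0.trans hv.1
      gcongr; exact hv.2
    have h2 : (v0 + s / 4 * X) ^ 2 ≤ v0 ^ 2 + s * X ^ 2 := by
      have e1 : v0 * (s / 2 * X) ≤ 5 / 4 * X * (s / 2 * X) := by gcongr
      have e2 : s ^ 2 * X ^ 2 ≤ s * X ^ 2 := by
        have : s ^ 2 ≤ s := by nlinarith
        gcongr
      nlinarith
    have h3 : 1 + 2 * s ≤ Real.exp s ^ 2 := by
      rw [← Real.exp_nat_mul]
      have := Real.add_one_le_exp ((2 : ℕ) * s)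
      push_cast at this ⊢
      linarith
    have h4 : c * X ^ 2 ≤ s / 8 * X ^ 2 := by gcongr
    have h5 : (1 + 2 * s) * X ^ 2 ≤ Real.exp s ^ 2 * X ^ 2 := by gcongr
    nlinarith [sq_nonneg X, mul_pos hs0 (pow_pos hX 2)]

lemma card_filter_lt_le {I : ℕ} {u v : ℝ} (huv : 0 ≤ v - u + 2) (p : ℕ → Prop) [DecidablePred p]
    (hp : ∀ i < I, p i → u ≤ i ∧ (i : ℝ) ≤ v) :
    (((Finset.range I).filter p).card : ℝ) ≤ v - u + 2 := by
  refine le_trans ?_ (card_Icc_floor_le huv)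
  have : (((Finset.range I).filter p).card) ≤ (Finset.Icc ⌊u⌋ ⌊v⌋).card := by
    refine Finset.card_le_card_of_injOn (fun i => (i : ℤ)) (fun i hi => ?_)
      (fun i _ j _ hij => by simpa using hij)
    simp only [Finset.coe_filter, Finset.mem_range, mem_ofPred_eq] at hi
    obtain ⟨h1, h2⟩ := hp i hi.1 hi.2
    simp only [Finset.coe_Icc, mem_Icc]
    exact ⟨by exact_mod_cast (Int.floor_le u).trans h1, Int.le_floor.2 (by exact_mod_cast h2)⟩
  exact_mod_cast this

lemma half_le_natFloor {y : ℝ} (hy : 1 ≤ y) : y / 2 ≤ ⌊y⌋₊ := by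
  have h1 := Nat.lt_floor_add_one y
  have h2 : (1 : ℝ) ≤ ⌊y⌋₊ := by exact_mod_cast Nat.one_le_floor_iff y |>.2 hy
  linarith

/-- The grid with periods `2s` and `4π`. -/
noncomputable def gridPoint (s u0 y0 : ℝ) (p : ℕ × ℕ) : ℂ :=
  ⟨u0 + 2 * s * p.1, y0 + 4 * Real.pi * p.2⟩

lemma gridPoint_injective {s u0 y0 : ℝ} (hs0 : 0 < s) :
    Function.Injective (gridPoint s u0 y0) := fun p p' hpp => by
  have h1 := congrArg Complex.re hpp
  have h2 := congrArg Complex.im hpp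
  simp only [gridPoint, add_right_inj, mul_eq_mul_left_iff, Nat.cast_inj] at h1 h2
  refine Prod.ext (h1.resolve_right (by positivity)) (h2.resolve_right (by positivity))

/-- The periods are twice the side lengths s and 2π of a box, so distinct boxes are s apart
horizontally or 2π apart vertically. -/
lemma le_norm_sub_of_gridPoint_ne {s u0 y0 : ℝ} (hs0 : 0 < s) (hs1 : s ≤ 1) {p p' : ℕ × ℕ}
    (hne : p ≠ p') {w w' : ℂ} (hw : w ∈ expBox s (gridPoint s u0 y0 p))
    (hw' : w' ∈ expBox s (gridPoint s u0 y0 p')) : s ≤ ‖w - w'‖ := by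
  have hπ := Real.pi_gt_three
  have hcast : ∀ {i n : ℕ}, i < n → (i : ℝ) + 1 ≤ n := fun hi => by exact_mod_cast hi
  obtain ⟨h1, h2, h3⟩ := hw
  obtain ⟨h1', h2', h3'⟩ := hw'
  simp only [gridPoint] at h1 h2 h3 h1' h2' h3'
  obtain ⟨h4, h5⟩ := abs_le.1 h3
  obtain ⟨h4', h5'⟩ := abs_le.1 h3'
  have hre := Complex.abs_re_le_norm (w - w')
  have him := Complex.abs_im_le_norm (w - w')
  rw [Complex.sub_re] at hre
  rw [Complex.sub_im] at him
  have hre' := abs_le.1 hre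
  have him' := abs_le.1 him
  rcases lt_trichotomy p.1 p'.1 with hlt | heq | hlt
  · have := hcast hlt
    have : 2 * s * (p.1 + 1) ≤ 2 * s * p'.1 := by gcongr
    linarith
  · rcases lt_trichotomy p.2 p'.2 with hlt | heq2 | hlt
    · have := hcast hlt
      have : 4 * Real.pi * (p.2 + 1) ≤ 4 * Real.pi * p'.2 := by gcongr
      linarith
    · exact absurd (Prod.ext heq heq2) hne
    · have := hcast hlt
      have : 4 * Real.pi * (p'.2 + 1) ≤ 4 * Real.pi * p.2 := by gcongr
      linarith
  · have := hcast hlt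
    have : 2 * s * (p'.1 + 1) ≤ 2 * s * p.1 := by gcongr
    linarith

/-- The ball meets at most a constant times 1 + R rows. It meets at most a constant times 1 + R
columns, and there are at most m/(2s) columns altogether, which gives the minimum. -/
lemma card_meeting_le {s u0 y0 m R : ℝ} {I J : ℕ} {w : ℂ} {T' : Finset ℂ} (hs0 : 0 < s)
    (hmpos : 0 < m) (hI : 2 * s * I ≤ m) (hR : 0 ≤ R)
    (hT' : T' ⊆ (Finset.range I ×ˢ Finset.range J).image (gridPoint s u0 y0))
    (hmeet : ∀ ζ ∈ T', (expBox s ζ ∩ closedBall w R).Nonempty) :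
    (T'.card : ℝ) ≤ 3 * (3 + 1 / s) * ((1 + R) * (1 + min R m)) := by
  have hπ := Real.pi_gt_three
  have hsub : T' ⊆ (((Finset.range I).filter fun i : ℕ =>
        (w.re - R - s - u0) / (2 * s) ≤ i ∧ (i : ℝ) ≤ (w.re + R - u0) / (2 * s)) ×ˢ
      ((Finset.range J).filter fun j : ℕ =>
        (w.im - R - Real.pi - y0) / (4 * Real.pi) ≤ j ∧
          (j : ℝ) ≤ (w.im + R - (y0 - Real.pi)) / (4 * Real.pi))).image (gridPoint s u0 y0) := by
    intro ζ hζ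
    obtain ⟨p, hp, rfl⟩ := Finset.mem_image.1 (hT' hζ)
    simp only [Finset.mem_product, Finset.mem_range] at hp
    obtain ⟨y, ⟨h1, h2, h3⟩, hy⟩ := hmeet _ hζ
    simp only [gridPoint] at h1 h2 h3
    obtain ⟨h4, h5⟩ := abs_le.1 h3
    rw [mem_closedBall, dist_eq_norm] at hy
    have hre := abs_le.1 ((Complex.abs_re_le_norm (y - w)).trans hy)
    have him := abs_le.1 ((Complex.abs_im_le_norm (y - w)).trans hy)
    rw [Complex.sub_re] at hre
    rw [Complex.sub_im] at him
    refine Finset.mem_image_of_mem _ ?_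
    simp only [Finset.mem_product, Finset.mem_filter, Finset.mem_range]
    refine ⟨⟨hp.1, ?_, ?_⟩, hp.2, ?_, ?_⟩
    · rw [div_le_iff₀ (by positivity)]; linarith
    · rw [le_div_iff₀ (by positivity)]; linarith
    · rw [div_le_iff₀ (by positivity)]; linarith
    · rw [le_div_iff₀ (by positivity)]; linarith
  have hcard := (Finset.card_le_card hsub).trans Finset.card_image_le
  rw [Finset.card_product] at hcard
  refine le_trans (Nat.cast_le.2 hcard) ?_
  rw [Nat.cast_mul]
  have d1 : (w.re + R - u0) / (2 * s) - (w.re - R - s - u0) / (2 * s) = R / s + 1 / 2 := by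
    field_simp; ring
  have d2 : (w.im + R - (y0 - Real.pi)) / (4 * Real.pi) - (w.im - R - Real.pi - y0) / (4 * Real.pi) =
      R / (2 * Real.pi) + 1 / 2 := by
    field_simp; ring
  have hRs : 0 ≤ R / s := by positivity
  have hRπ : 0 ≤ R / (2 * Real.pi) := by positivity
  have c1 := card_filter_lt_le (I := I) (u := (w.re - R - s - u0) / (2 * s))
    (v := (w.re + R - u0) / (2 * s)) (by linarith) (fun i : ℕ =>
        (w.re - R - s - u0) / (2 * s) ≤ i ∧ (i : ℝ) ≤ (w.re + R - u0) / (2 * s))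
    (fun i _ hp => hp)
  have c2 := card_filter_lt_le (I := J) (u := (w.im - R - Real.pi - y0) / (4 * Real.pi))
    (v := (w.im + R - (y0 - Real.pi)) / (4 * Real.pi)) (by linarith) (fun j : ℕ =>
        (w.im - R - Real.pi - y0) / (4 * Real.pi) ≤ j ∧
          (j : ℝ) ≤ (w.im + R - (y0 - Real.pi)) / (4 * Real.pi))
    (fun i _ hp => hp)
  have c3 : (((Finset.range I).filter fun i : ℕ =>
        (w.re - R - s - u0) / (2 * s) ≤ i ∧ (i : ℝ) ≤ (w.re + R - u0) / (2 * s)).card : ℝ) ≤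
      m / (2 * s) := by
    have h1 := Finset.card_filter_le (Finset.range I) fun i : ℕ =>
        (w.re - R - s - u0) / (2 * s) ≤ i ∧ (i : ℝ) ≤ (w.re + R - u0) / (2 * s)
    rw [Finset.card_range] at h1
    refine le_trans (Nat.cast_le.2 h1) ?_
    rw [le_div_iff₀ (by positivity)]
    linarith
  rw [d1] at c1
  rw [d2] at c2
  have hs' : 0 < 1 / s := by positivity
  have f1 : (((Finset.range I).filter fun i : ℕ =>
        (w.re - R - s - u0) / (2 * s) ≤ i ∧ (i : ℝ) ≤ (w.re + R - u0) / (2 * s)).card : ℝ) ≤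
      (3 + 1 / s) * (1 + min R m) := by
    rcases le_total R m with hRm | hRm
    · rw [min_eq_left hRm]
      refine c1.trans ?_
      have : R / s = 1 / s * R := by ring
      nlinarith
    · rw [min_eq_right hRm]
      refine c3.trans ?_
      have : m / (2 * s) = 1 / 2 * (1 / s * m) := by field_simp
      have : 0 < 1 / s * m := by positivity
      nlinarith
  have f2 : R / (2 * Real.pi) + 1 / 2 + 2 ≤ 3 * (1 + R) := by
    have : R / (2 * Real.pi) ≤ R := div_le_self hR (by linarith)
    linarith
  calc _ ≤ (3 + 1 / s) * (1 + min R m) * (3 * (1 + R)) := by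
        refine mul_le_mul f1 (c2.trans f2) (Nat.cast_nonneg _) ?_
        have : 0 ≤ min R m := le_min hR hmpos.le
        positivity
    _ = _ := by ring

/-- The annulus `X ≤ |w| ≤ e^s X` contains many separated boxes lying in a given vertical strip
that comes close to the imaginary axis. -/
lemma exists_boxes {q D : ℝ} (hq0 : 0 < q) (hq1 : q < 1) (hD : 0 < D) :
    ∃ s c C A : ℝ, 0 < s ∧ s ≤ 1 ∧ s ≤ D ∧ 0 < c ∧ 0 < C ∧ 1 ≤ A ∧ ∀ X α β : ℝ, A ≤ X →
      D < β - α → α ≤ q * X → -(q * X) ≤ β → ∃ T : Finset ℂ,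
        (∀ ζ ∈ T, ∀ w ∈ expBox s ζ, X ≤ ‖w‖ ∧ ‖w‖ ≤ X * Real.exp s) ∧
        (∀ ζ ∈ T, α ≤ ζ.re ∧ ζ.re + s ≤ β) ∧
        (∀ ζ ∈ T, ∀ ζ' ∈ T, ζ ≠ ζ' → ∀ w ∈ expBox s ζ, ∀ w' ∈ expBox s ζ', s ≤ ‖w - w'‖) ∧
        c * (X * min (β - α) X) ≤ T.card ∧
        (∀ w : ℂ, ∀ R : ℝ, 0 ≤ R → ∀ T' ⊆ T, (∀ ζ ∈ T', (expBox s ζ ∩ closedBall w R).Nonempty) →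
          (T'.card : ℝ) ≤ C * ((1 + R) * (1 + min R (min (β - α) X)))) := by
  classical
  have hπ := Real.pi_gt_three
  have hπ4 := Real.pi_le_four
  -- Since 4s ≤ D, the part of the strip that is used has room for whole periods 2s.
  set s : ℝ := min D 1 / 4 with hs
  have hm0 : 0 < min D 1 := lt_min hD one_pos
  have hs0 : 0 < s := by positivity
  have hs1 : s ≤ 1 := by have := min_le_right D 1; linarith
  have hs4 : 4 * s ≤ D := by have := min_le_left D 1; linarith
  -- The bound s/8 is required by `rectangle_in_annulus`. The bound 1 - q keeps a rectangle of width
  -- c0 X with left edge at most qX to the left of X, and one with left edge -X to the left of -qX ≤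
  -- β.
  set c0 : ℝ := min (s / 8) (1 - q) with hc0
  have hc0p : 0 < c0 := lt_min (by positivity) (by linarith)
  have hc0s : c0 ≤ s / 8 := min_le_left _ _
  have hc0q : c0 ≤ 1 - q := min_le_right _ _
  -- The second term ensures c0 X ≥ 4s, room for columns, and the third sX ≥ 64 ≥ 16π, room for
  -- rows.
  set A : ℝ := 1 + 4 * s / c0 + 64 / s with hA
  refine ⟨s, c0 / (4 * s) * (s / 4 / (8 * Real.pi)), 3 * (3 + 1 / s), A, hs0, hs1, by linarith,
    by positivity, by positivity, ?_, ?_⟩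
  · have : 0 < 4 * s / c0 := by positivity
    have : 0 < 64 / s := by positivity
    linarith
  intro X α β hX hΔ hα hβ
  have hX1 : 1 + 4 * s / c0 + 64 / s ≤ X := hX
  have p1 : 0 < 4 * s / c0 := by positivity
  have p2 : 0 < 64 / s := by positivity
  have hX0 : 0 < X := by linarith
  have hXc : 4 * s ≤ c0 * X := by
    have : 4 * s / c0 ≤ X := by linarith
    rw [div_le_iff₀ hc0p] at this; linarith
  have hXs : 64 ≤ s * X := by
    have : 64 / s ≤ X := by linarith
    rw [div_le_iff₀ hs0] at this; linarith
  set Δ := β - α with hΔdef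
  set ℓ : ℝ := min Δ (c0 * X) with hℓ
  have hℓ1 : ℓ ≤ Δ := min_le_left _ _
  have hℓ2 : ℓ ≤ c0 * X := min_le_right _ _
  have hℓ4 : 4 * s ≤ ℓ := le_min (by linarith) hXc
  have hcX : c0 * X ≤ (1 - q) * X := by gcongr
  have hcX' : c0 * X ≤ X := by nlinarith
  set u0 : ℝ := max α (-X) with hu0
  have hu0α : α ≤ u0 := le_max_left _ _
  have hu0X : -X ≤ u0 := le_max_right _ _
  have hu0β : u0 + ℓ ≤ β := by
    rcases max_cases α (-X) with h | h <;> rw [hu0, h.1] <;> nlinarith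
  have hu1X : u0 + ℓ ≤ X := by
    rcases max_cases α (-X) with h | h <;> rw [hu0, h.1] <;> nlinarith
  have hrad : 0 ≤ X ^ 2 - u0 ^ 2 + 2 * c0 * X ^ 2 := by
    have : u0 ^ 2 ≤ X ^ 2 := sq_le_sq' hu0X (by linarith)
    have : 0 ≤ 2 * c0 * X ^ 2 := by positivity
    linarith
  -- The corner (u0, v0) has squared modulus (1 + 2 c0) X², just outside the circle of radius X.
  set v0 : ℝ := Real.sqrt (X ^ 2 - u0 ^ 2 + 2 * c0 * X ^ 2) with hv0
  have hv0s : v0 ^ 2 = X ^ 2 - u0 ^ 2 + 2 * c0 * X ^ 2 := Real.sq_sqrt hrad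
  set I : ℕ := ⌊ℓ / (2 * s)⌋₊ with hI
  set J : ℕ := ⌊s / 4 * X / (4 * Real.pi)⌋₊ with hJ
  have hI1 : 2 * s * I ≤ ℓ := by
    have := Nat.floor_le (show 0 ≤ ℓ / (2 * s) by apply div_nonneg <;> linarith)
    rw [le_div_iff₀ (by positivity)] at this
    linarith
  have hJ1 : 4 * Real.pi * J ≤ s / 4 * X := by
    have := Nat.floor_le (show 0 ≤ s / 4 * X / (4 * Real.pi) by positivity)
    rw [le_div_iff₀ (by positivity)] at this
    linarith
  -- The shift by π puts the bottom edge of the lowest boxes at height v0, as a box is attached to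
  -- its left midpoint.
  set f : ℕ × ℕ → ℂ := gridPoint s u0 (v0 + Real.pi) with hf
  have hfinj : Function.Injective f := gridPoint_injective hs0
  have hcast : ∀ {i n : ℕ}, i < n → (i : ℝ) + 1 ≤ n := fun hi => by exact_mod_cast hi
  refine ⟨(Finset.range I ×ˢ Finset.range J).image f, ?_, ?_, ?_, ?_, ?_⟩
  · intro ζ hζ w hw
    obtain ⟨p, hp, rfl⟩ := Finset.mem_image.1 hζ
    simp only [Finset.mem_product, Finset.mem_range] at hp
    have hi := hcast hp.1
    have hj := hcast hp.2
    obtain ⟨h1, h2, h3⟩ := hw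
    simp only [hf, gridPoint] at h1 h2 h3
    obtain ⟨h4, h5⟩ := abs_le.1 h3
    have hsi : 2 * s * (p.1 + 1) ≤ 2 * s * I := by gcongr
    have hpj : 4 * Real.pi * (p.2 + 1) ≤ 4 * Real.pi * J := by gcongr
    have hp0 : 0 ≤ 2 * s * p.1 := by positivity
    have hp1 : 0 ≤ 4 * Real.pi * p.2 := by positivity
    have hann := rectangle_in_annulus hX0 hs0 hs1 hc0p hc0s hu0X hu1X hℓ2 (Real.sqrt_nonneg _)
      hv0s (u := w.re) (v := w.im) ⟨by linarith, by linarith⟩ ⟨by linarith, by linarith⟩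
    have hn : ‖w‖ ^ 2 = w.re ^ 2 + w.im ^ 2 := by
      rw [Complex.sq_norm, Complex.normSq_apply]; ring
    rw [← hn] at hann
    exact ⟨abs_le_of_sq_le_sq' hann.1 (norm_nonneg _) |>.2,
      abs_le_of_sq_le_sq' hann.2 (by positivity) |>.2⟩
  · intro ζ hζ
    obtain ⟨p, hp, rfl⟩ := Finset.mem_image.1 hζ
    simp only [Finset.mem_product, Finset.mem_range] at hp
    have hi := hcast hp.1
    have hsi : 2 * s * (p.1 + 1) ≤ 2 * s * I := by gcongr
    have hp0 : 0 ≤ 2 * s * p.1 := by positivity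
    simp only [hf, gridPoint]
    constructor <;> linarith
  · intro ζ hζ ζ' hζ' hne w hw w' hw'
    obtain ⟨p, -, rfl⟩ := Finset.mem_image.1 hζ
    obtain ⟨p', -, rfl⟩ := Finset.mem_image.1 hζ'
    exact le_norm_sub_of_gridPoint_ne hs0 hs1 (fun hpp => hne (congrArg _ hpp)) hw hw'
  · rw [Finset.card_image_of_injective _ hfinj, Finset.card_product, Finset.card_range,
      Finset.card_range]
    push_cast
    have e1 : c0 / (4 * s) * min Δ X ≤ I := by
      refine le_trans ?_ (half_le_natFloor (y := ℓ / (2 * s)) ?_)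
      · have : c0 * min Δ X ≤ ℓ := by
          rw [mul_min_of_nonneg _ _ hc0p.le]
          refine min_le_min ?_ le_rfl
          have : c0 ≤ 1 := by linarith
          exact mul_le_of_le_one_left (by linarith) this
        calc c0 / (4 * s) * min Δ X = c0 * min Δ X / (4 * s) := by ring
          _ ≤ ℓ / (4 * s) := by gcongr
          _ = _ := by ring
      · rw [le_div_iff₀ (by positivity)]; linarith
    have e2 : s / 4 / (8 * Real.pi) * X ≤ J := by
      refine le_trans (le_of_eq ?_) (half_le_natFloor (y := s / 4 * X / (4 * Real.pi)) ?_)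
      · ring
      · rw [le_div_iff₀ (by positivity)]; linarith
    calc _ = c0 / (4 * s) * min Δ X * (s / 4 / (8 * Real.pi) * X) := by ring
      _ ≤ I * J := by gcongr
  · intro w R hR T' hT' hmeet
    refine card_meeting_le hs0 (lt_min (by linarith) hX0) (hI1.trans ?_) hR hT' hmeet
    exact min_le_min le_rfl hcX'

end

/-! ### Box trees, their limit sets, and the mass of balls. -/

section
open Set Metric MeasureTheory

/-- A tree of boxes: every admissible box `ζ` of level `k ≥ N` has a finite set `T k ζ` of
admissible successors which are separated, numerous, evenly spread, and contained in the image of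
the box. -/
structure IsBoxTree (lam : ℕ → ℂ) (Δ : ℕ → ℝ) (s c C : ℝ) (N : ℕ) (V : ℕ → ℂ → Prop)
    (T : ℕ → ℂ → Finset ℂ) : Prop where
  lam_ne : ∀ n, 1 ≤ n → lam n ≠ 0
  s_pos : 0 < s
  s_le_one : s ≤ 1
  c_pos : 0 < c
  C_pos : 0 < C
  modulus_pos : ∀ n, 1 ≤ n → 0 < Δ n
  child_adm : ∀ k, N ≤ k → ∀ ζ, V k ζ → ∀ ζ' ∈ T k ζ, V (k + 1) ζ'
  child_annulus : ∀ k, N ≤ k → ∀ ζ, V k ζ → ∀ ζ' ∈ T k ζ, ∀ w ∈ expBox s ζ',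
    ‖lam (k + 1)‖ * Real.exp ζ.re ≤ ‖w‖ ∧ ‖w‖ ≤ ‖lam (k + 1)‖ * Real.exp ζ.re * Real.exp s
  child_sep : ∀ k, N ≤ k → ∀ ζ, V k ζ → ∀ ζ₁ ∈ T k ζ, ∀ ζ₂ ∈ T k ζ, ζ₁ ≠ ζ₂ →
    ∀ w ∈ expBox s ζ₁, ∀ w' ∈ expBox s ζ₂, s ≤ ‖w - w'‖
  card_ge : ∀ k, N ≤ k → ∀ ζ, V k ζ → c * (‖lam (k + 1)‖ * Real.exp ζ.re *
    min (Δ (k + 2)) (‖lam (k + 1)‖ * Real.exp ζ.re)) ≤ (T k ζ).card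
  card_meeting : ∀ k, N ≤ k → ∀ ζ, V k ζ → ∀ w : ℂ, ∀ R : ℝ, 0 ≤ R → ∀ T' ⊆ T k ζ,
    (∀ ζ' ∈ T', (expBox s ζ' ∩ closedBall w R).Nonempty) → (T'.card : ℝ) ≤
      C * ((1 + R) * (1 + min R (min (Δ (k + 2)) (‖lam (k + 1)‖ * Real.exp ζ.re))))

/-- The inverse branch of `z ↦ lam (k + 1) * exp z` with values near `ζ`. -/
noncomputable def invBranch (lam : ℕ → ℂ) (k : ℕ) (ζ w : ℂ) : ℂ :=
  ζ + Complex.log (w / (lam (k + 1) * Complex.exp ζ))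

/-- The measure distributing unit mass uniformly over `j` generations of boxes. -/
noncomputable def treeMeasure (lam : ℕ → ℂ) (T : ℕ → ℂ → Finset ℂ) : ℕ → ℕ → ℂ → Measure ℂ
  | 0, _, ζ => Measure.dirac ζ
  | j + 1, k, ζ => ((T k ζ).card : ℝ≥0∞)⁻¹ •
      ∑ ζ' ∈ T k ζ, (treeMeasure lam T j (k + 1) ζ').map (invBranch lam k ζ)

/-- The points whose orbit follows `j` generations of boxes. -/
def treeSet (lam : ℕ → ℂ) (s : ℝ) (T : ℕ → ℂ → Finset ℂ) : ℕ → ℕ → ℂ → Set ℂ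
  | 0, _, ζ => expBox s ζ
  | j + 1, k, ζ => {z | z ∈ expBox s ζ ∧
      ∃ ζ' ∈ T k ζ, lam (k + 1) * Complex.exp z ∈ treeSet lam s T j (k + 1) ζ'}

/-- The points whose orbit follows all generations of boxes. -/
def treeLimit (lam : ℕ → ℂ) (s : ℝ) (T : ℕ → ℂ → Finset ℂ) (k : ℕ) (ζ : ℂ) : Set ℂ :=
  ⋂ j, treeSet lam s T j k ζ

lemma measurable_invBranch (lam : ℕ → ℂ) (k : ℕ) (ζ : ℂ) : Measurable (invBranch lam k ζ) := by
  unfold invBranch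
  fun_prop

lemma isClosed_expBox (s : ℝ) (ζ : ℂ) : IsClosed (expBox s ζ) := by
  unfold expBox
  refine IsClosed.inter (isClosed_le continuous_const Complex.continuous_re)
    (IsClosed.inter (isClosed_le Complex.continuous_re continuous_const) ?_)
  exact isClosed_le ((Complex.continuous_im.sub continuous_const).abs) continuous_const

lemma self_mem_expBox {s : ℝ} (hs : 0 ≤ s) (ζ : ℂ) : ζ ∈ expBox s ζ :=
  ⟨le_rfl, by linarith, by simpa using Real.pi_pos.le⟩

lemma norm_sub_le_two_of_mem_expBox {s : ℝ} {ζ w : ℂ} (hs : s ≤ 1) (hw : w ∈ expBox s ζ) :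
    ‖w - ζ‖ ≤ 1 + Real.pi := by
  refine (Complex.norm_le_abs_re_add_abs_im _).trans ?_
  rw [Complex.sub_re, Complex.sub_im]
  exact add_le_add (abs_le.2 ⟨by linarith [hw.1], by linarith [hw.2.1]⟩) hw.2.2

lemma treeSet_subset_expBox (lam : ℕ → ℂ) (s : ℝ) (T : ℕ → ℂ → Finset ℂ) (j k : ℕ) (ζ : ℂ) :
    treeSet lam s T j k ζ ⊆ expBox s ζ := by
  cases j with
  | zero => exact subset_rfl
  | succ j => exact fun z hz => hz.1

lemma isClosed_treeSet (lam : ℕ → ℂ) (s : ℝ) (T : ℕ → ℂ → Finset ℂ) (j : ℕ) :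
    ∀ k ζ, IsClosed (treeSet lam s T j k ζ) := by
  induction j with
  | zero => exact fun k ζ => isClosed_expBox s ζ
  | succ j ih =>
    intro k ζ
    have h1 : treeSet lam s T (j + 1) k ζ = expBox s ζ ∩
        (fun z => lam (k + 1) * Complex.exp z) ⁻¹' ⋃ ζ' ∈ T k ζ, treeSet lam s T j (k + 1) ζ' := by
      ext z; simp [treeSet]
    rw [h1]
    refine (isClosed_expBox s ζ).inter (IsClosed.preimage (by fun_prop) ?_)
    exact (T k ζ).finite_toSet.isClosed_biUnion fun ζ' _ => ih (k + 1) ζ'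

lemma treeSet_succ_subset (lam : ℕ → ℂ) (s : ℝ) (T : ℕ → ℂ → Finset ℂ) (j : ℕ) :
    ∀ k ζ, treeSet lam s T (j + 1) k ζ ⊆ treeSet lam s T j k ζ := by
  induction j with
  | zero => exact fun k ζ z hz => hz.1
  | succ j ih =>
    rintro k ζ z ⟨hz, ζ', hζ', h⟩
    exact ⟨hz, ζ', hζ', ih _ _ h⟩

lemma treeSet_antitone (lam : ℕ → ℂ) (s : ℝ) (T : ℕ → ℂ → Finset ℂ) (k : ℕ) (ζ : ℂ) :
    Antitone fun j => treeSet lam s T j k ζ :=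
  antitone_nat_of_succ_le fun j => treeSet_succ_subset lam s T j k ζ

/-- There are finitely many children. If each of them failed at some depth, all would fail at the
largest of these depths, by nesting. -/
lemma exists_child_mem_treeLimit {lam : ℕ → ℂ} {s : ℝ} {T : ℕ → ℂ → Finset ℂ} {k : ℕ} {ζ z : ℂ}
    (hz : z ∈ treeLimit lam s T k ζ) :
    ∃ ζ' ∈ T k ζ, lam (k + 1) * Complex.exp z ∈ treeLimit lam s T (k + 1) ζ' := by
  classical
  by_contra hcon
  push Not at hcon
  have h1 : ∀ ζ' ∈ T k ζ, ∃ j, lam (k + 1) * Complex.exp z ∉ treeSet lam s T j (k + 1) ζ' :=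
    fun ζ' hζ' => by simpa [treeLimit] using hcon ζ' hζ'
  choose! j hj using h1
  obtain ⟨-, ζ', hζ', hmem⟩ := mem_iInter.1 hz ((T k ζ).sup j + 1)
  exact hj ζ' hζ' (treeSet_antitone lam s T (k + 1) ζ' (Finset.le_sup hζ') hmem)

/-- The segment from z to w lies in the half-plane of real parts at most Re z + 1, where the
derivative is at most e times its modulus at z. -/
lemma norm_exp_sub_le {s : ℝ} (hs : s ≤ 1) {c ζ z w : ℂ} (hz : z ∈ expBox s ζ)
    (hw : w ∈ expBox s ζ) :
    ‖c * Complex.exp w - c * Complex.exp z‖ ≤ 3 * ‖c * Complex.exp z‖ * ‖w - z‖ := by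
  have hconv : Convex ℝ {y : ℂ | y.re ≤ z.re + 1} := convex_halfSpace_re_le _
  have h1 := hconv.norm_image_sub_le_of_norm_hasDerivWithin_le (𝕜 := ℂ) (f := fun y => c * Complex.exp y)
    (f' := fun y => c * Complex.exp y) (x := z) (y := w) (C := 3 * ‖c * Complex.exp z‖)
    (fun y _ => ((Complex.hasDerivAt_exp y).const_mul c).hasDerivWithinAt) (fun y hy => ?_)
    (show z.re ≤ z.re + 1 by linarith)
    (show w.re ≤ z.re + 1 by linarith [hz.1, hw.2.1])
  · exact h1
  · rw [norm_mul, norm_mul, Complex.norm_exp, Complex.norm_exp]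
    have h2 : Real.exp y.re ≤ 3 * Real.exp z.re := by
      have h3 : Real.exp y.re ≤ Real.exp 1 * Real.exp z.re := by
        rw [← Real.exp_add]; exact Real.exp_le_exp.2 (by have : y.re ≤ z.re + 1 := hy; linarith)
      have := Real.exp_one_lt_d9
      have := Real.exp_pos z.re
      nlinarith
    calc ‖c‖ * Real.exp y.re ≤ ‖c‖ * (3 * Real.exp z.re) := by gcongr
      _ = _ := by ring

lemma norm_mul_exp_mem_of_mem_expBox {s : ℝ} {c ζ z : ℂ} (hz : z ∈ expBox s ζ) :
    ‖c‖ * Real.exp ζ.re ≤ ‖c * Complex.exp z‖ ∧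
      ‖c * Complex.exp z‖ ≤ ‖c‖ * Real.exp ζ.re * Real.exp s := by
  rw [norm_mul, Complex.norm_exp]
  refine ⟨mul_le_mul_of_nonneg_left (Real.exp_le_exp.2 hz.1) (norm_nonneg _), ?_⟩
  rw [mul_assoc, ← Real.exp_add]
  gcongr
  exact hz.2.1

namespace IsBoxTree

variable {lam : ℕ → ℂ} {Δ : ℕ → ℝ} {s c C : ℝ} {N : ℕ} {V : ℕ → ℂ → Prop}
  {T : ℕ → ℂ → Finset ℂ} (h : IsBoxTree lam Δ s c C N V T)
include h

/-- This explains the shape of the boxes: the principal logarithm maps the annulus 1 ≤ |w| ≤ e^s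
into a rectangle of width s and height 2π. -/
lemma invBranch_mem {k : ℕ} (hk : N ≤ k) {ζ ζ' w : ℂ} (hζ : V k ζ) (hζ' : ζ' ∈ T k ζ)
    (hw : w ∈ expBox s ζ') :
    invBranch lam k ζ w ∈ expBox s ζ ∧ lam (k + 1) * Complex.exp (invBranch lam k ζ w) = w := by
  have hl := norm_pos_iff.2 (h.lam_ne (k + 1) (by omega))
  obtain ⟨h1, h2⟩ := h.child_annulus k hk ζ hζ ζ' hζ' w hw
  have he : ‖lam (k + 1) * Complex.exp ζ‖ = ‖lam (k + 1)‖ * Real.exp ζ.re := by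
    rw [norm_mul, Complex.norm_exp]
  have hX : 0 < ‖lam (k + 1)‖ * Real.exp ζ.re := by positivity
  have hne : lam (k + 1) * Complex.exp ζ ≠ 0 := norm_pos_iff.1 (he ▸ hX)
  have hw0 : w ≠ 0 := norm_pos_iff.1 (hX.trans_le h1)
  have hn : ‖w / (lam (k + 1) * Complex.exp ζ)‖ = ‖w‖ / (‖lam (k + 1)‖ * Real.exp ζ.re) := by
    rw [norm_div, he]
  refine ⟨⟨?_, ?_, ?_⟩, ?_⟩
  · simp only [invBranch, Complex.add_re, Complex.log_re, hn]
    have := Real.log_nonneg ((one_le_div hX).2 h1)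
    linarith
  · simp only [invBranch, Complex.add_re, Complex.log_re, hn]
    have : Real.log (‖w‖ / (‖lam (k + 1)‖ * Real.exp ζ.re)) ≤ s := by
      rw [Real.log_le_iff_le_exp (div_pos (hX.trans_le h1) hX), div_le_iff₀ hX]
      linarith
    linarith
  · simp only [invBranch, Complex.add_im, Complex.log_im, add_sub_cancel_left]
    exact Complex.abs_arg_le_pi _
  · rw [invBranch, Complex.exp_add, Complex.exp_log (div_ne_zero hw0 hne)]
    field_simp [Complex.exp_ne_zero, h.lam_ne (k + 1) (by omega)]

lemma card_pos {k : ℕ} (hk : N ≤ k) {ζ : ℂ} (hζ : V k ζ) : 0 < (T k ζ).card := by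
  have hl := norm_pos_iff.2 (h.lam_ne (k + 1) (by omega))
  have h1 := h.card_ge k hk ζ hζ
  have h2 := h.modulus_pos (k + 2) (by omega)
  have hc := h.c_pos
  have h3 : 0 < min (Δ (k + 2)) (‖lam (k + 1)‖ * Real.exp ζ.re) := lt_min h2 (by positivity)
  have : (0 : ℝ) < (T k ζ).card := lt_of_lt_of_le (by positivity) h1
  exact_mod_cast this

lemma isProbabilityMeasure_treeMeasure (j : ℕ) : ∀ k, N ≤ k → ∀ ζ, V k ζ →
    IsProbabilityMeasure (treeMeasure lam T j k ζ) := by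
  induction j with
  | zero => intro k _ ζ _; rw [treeMeasure]; infer_instance
  | succ j ih =>
    intro k hk ζ hζ
    refine ⟨?_⟩
    have hcard := h.card_pos hk hζ
    rw [treeMeasure]
    simp only [Measure.smul_apply, Measure.coe_finsetSum, Finset.sum_apply, smul_eq_mul]
    rw [Finset.sum_congr rfl (g := fun _ => 1)]
    · rw [Finset.sum_const, nsmul_eq_mul, mul_one]
      exact ENNReal.inv_mul_cancel (by simpa using Finset.card_pos.1 hcard |>.ne_empty) (by simp)
    · intro ζ' hζ'
      rw [Measure.map_apply (measurable_invBranch _ _ _) MeasurableSet.univ, preimage_univ]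
      have := ih (k + 1) (by omega) ζ' (h.child_adm k hk ζ hζ ζ' hζ')
      exact measure_univ

omit h in
lemma treeMeasure_succ_apply {j k : ℕ} {ζ : ℂ} {B : Set ℂ} (hB : MeasurableSet B) :
    treeMeasure lam T (j + 1) k ζ B = ((T k ζ).card : ℝ≥0∞)⁻¹ *
      ∑ ζ' ∈ T k ζ, treeMeasure lam T j (k + 1) ζ' (invBranch lam k ζ ⁻¹' B) := by
  rw [treeMeasure]
  simp only [Measure.smul_apply, Measure.coe_finsetSum, Finset.sum_apply, smul_eq_mul]
  congr 1
  exact Finset.sum_congr rfl fun ζ' _ => Measure.map_apply (measurable_invBranch _ _ _) hB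

lemma treeMeasure_compl_treeSet (j : ℕ) : ∀ i ≤ j, ∀ k, N ≤ k → ∀ ζ, V k ζ →
    treeMeasure lam T j k ζ (treeSet lam s T i k ζ)ᶜ = 0 := by
  induction j with
  | zero =>
    intro i hi k _ ζ _
    obtain rfl : i = 0 := by omega
    rw [treeMeasure, Measure.dirac_apply' _ (isClosed_treeSet _ _ _ _ _ _).measurableSet.compl]
    simp [treeSet, self_mem_expBox h.s_pos.le ζ]
  | succ j ih =>
    intro i hi k hk ζ hζ
    rw [treeMeasure_succ_apply (isClosed_treeSet _ _ _ _ _ _).measurableSet.compl]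
    rw [Finset.sum_eq_zero, mul_zero]
    intro ζ' hζ'
    refine measure_mono_null ?_ (ih (i - 1) (by omega) (k + 1) (by omega) ζ'
      (h.child_adm k hk ζ hζ ζ' hζ'))
    intro w hw hwS
    refine hw ?_
    have hb := h.invBranch_mem hk hζ hζ' (treeSet_subset_expBox _ _ _ _ _ _ hwS)
    cases i with
    | zero => exact hb.1
    | succ i => exact ⟨hb.1, ζ', hζ', by rw [hb.2]; simpa using hwS⟩

/-- The measure of a child lives on its box, where the inverse branch is undone by the exponential
map. Thus the preimage of a ball sits in a ball enlarged by three times the derivative at z. -/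
lemma treeMeasure_preimage_le {j k : ℕ} (hk : N ≤ k) {ζ ζ' z : ℂ} (hζ : V k ζ)
    (hζ' : ζ' ∈ T k ζ) (hz : z ∈ expBox s ζ) (r : ℝ) :
    treeMeasure lam T j (k + 1) ζ' (invBranch lam k ζ ⁻¹' closedBall z r) ≤
      treeMeasure lam T j (k + 1) ζ' (expBox s ζ' ∩ closedBall (lam (k + 1) * Complex.exp z)
        (3 * ‖lam (k + 1) * Complex.exp z‖ * r)) := by
  have hnull := h.treeMeasure_compl_treeSet j 0 (Nat.zero_le _) (k + 1) (by omega) ζ'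
    (h.child_adm k hk ζ hζ ζ' hζ')
  have hout : treeMeasure lam T j (k + 1) ζ'
      ((invBranch lam k ζ ⁻¹' closedBall z r) \ expBox s ζ') = 0 :=
    measure_mono_null (show _ ⊆ (treeSet lam s T 0 (k + 1) ζ')ᶜ from fun w hw => hw.2) hnull
  rw [← measure_inter_add_sdiff (invBranch lam k ζ ⁻¹' closedBall z r)
    (isClosed_expBox s ζ').measurableSet, hout, add_zero]
  refine measure_mono fun w hw => ⟨hw.2, ?_⟩
  have hb := h.invBranch_mem hk hζ hζ' hw.2
  have h1 := norm_exp_sub_le h.s_le_one (c := lam (k + 1)) hz hb.1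
  rw [hb.2] at h1
  rw [mem_closedBall, dist_eq_norm]
  refine h1.trans ?_
  have h2 : invBranch lam k ζ w ∈ closedBall z r := hw.1
  rw [mem_closedBall, dist_eq_norm] at h2
  gcongr

/-- On a box the image modulus is at most e^s X ≤ 3X; each of the two factors therefore loses at
most 3. -/
lemma mul_le_nine_mul {k : ℕ} {ζ z : ℂ} (hz : z ∈ expBox s ζ) :
    ‖lam (k + 1) * Complex.exp z‖ * min (Δ (k + 2)) ‖lam (k + 1) * Complex.exp z‖ ≤
      9 * (‖lam (k + 1)‖ * Real.exp ζ.re *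
        min (Δ (k + 2)) (‖lam (k + 1)‖ * Real.exp ζ.re)) := by
  obtain ⟨h1, h2⟩ := norm_mul_exp_mem_of_mem_expBox (c := lam (k + 1)) hz
  set X := ‖lam (k + 1)‖ * Real.exp ζ.re with hX
  set x := ‖lam (k + 1) * Complex.exp z‖
  have hX0 : 0 ≤ X := by positivity
  have hx : x ≤ 3 * X := by
    have : Real.exp s ≤ 3 := by
      have h3 := Real.exp_le_exp.2 h.s_le_one
      have := Real.exp_one_lt_d9
      linarith
    nlinarith
  have hΔ := (h.modulus_pos (k + 2) (by omega)).le
  have h4 : min (Δ (k + 2)) x ≤ 3 * min (Δ (k + 2)) X :=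
    (min_le_min le_rfl hx).trans (min_mul_le_mul_min (by norm_num) hΔ)
  calc x * min (Δ (k + 2)) x ≤ 3 * X * (3 * min (Δ (k + 2)) X) :=
        mul_le_mul hx h4 (le_min hΔ (hX0.trans h1)) (by positivity)
    _ = _ := by ring

lemma inv_card_mul_le {k : ℕ} (hk : N ≤ k) {ζ z : ℂ} (hζ : V k ζ) (hz : z ∈ expBox s ζ)
    {t : ℝ} (ht : 0 ≤ t) :
    ((T k ζ).card : ℝ≥0∞)⁻¹ * ENNReal.ofReal t ≤
      ENNReal.ofReal (9 / c * t / (‖lam (k + 1) * Complex.exp z‖ *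
        min (Δ (k + 2)) ‖lam (k + 1) * Complex.exp z‖)) := by
  have hcard : (0 : ℝ) < (T k ζ).card := by exact_mod_cast h.card_pos hk hζ
  have h1 := h.card_ge k hk ζ hζ
  have h2 := h.mul_le_nine_mul (k := k) hz
  have hc := h.c_pos
  have hx : 0 < ‖lam (k + 1) * Complex.exp z‖ :=
    norm_pos_iff.2 (mul_ne_zero (h.lam_ne _ (by omega)) (Complex.exp_ne_zero _))
  have hm : 0 < min (Δ (k + 2)) ‖lam (k + 1) * Complex.exp z‖ :=
    lt_min (h.modulus_pos _ (by omega)) hx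
  rw [← ENNReal.ofReal_natCast, ← ENNReal.ofReal_inv_of_pos hcard,
    ← ENNReal.ofReal_mul (by positivity)]
  refine ENNReal.ofReal_le_ofReal ?_
  rw [inv_mul_eq_div, div_le_div_iff₀ hcard (by positivity)]
  have h3 : ‖lam (k + 1) * Complex.exp z‖ * min (Δ (k + 2)) ‖lam (k + 1) * Complex.exp z‖ ≤
      9 / c * (T k ζ).card := by
    rw [div_mul_eq_mul_div, le_div_iff₀ hc]
    nlinarith
  calc _ ≤ t * (9 / c * (T k ζ).card) := by gcongr
    _ = _ := by ring

/-- The measure of a ball meeting the limit set, in terms of the orbit of its centre. -/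
lemma treeMeasure_closedBall_le (i : ℕ) : ∀ k, N ≤ k → ∀ ζ, V k ζ → ∀ u : ℂ,
    nonautExp lam k u ∈ treeLimit lam s T k ζ → (∀ l, k < l → 1 ≤ ‖nonautExp lam l u‖) →
    ∀ j, i + 1 ≤ j → ∀ r : ℝ, 0 ≤ r →
    r * ∏ l ∈ Finset.Ico (k + 1) (k + 1 + i), 3 * ‖nonautExp lam l u‖ < s →
    treeMeasure lam T j k ζ (closedBall (nonautExp lam k u) r) ≤ ENNReal.ofReal
      ((∏ l ∈ Finset.Ico (k + 1) (k + 1 + i), 9 * (C + 1) / c / (‖nonautExp lam l u‖ *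
        min (Δ (l + 1)) ‖nonautExp lam l u‖)) *
      (9 * (C + 1) / c * ((1 + r * ∏ l ∈ Finset.Ico (k + 1) (k + 2 + i), 3 * ‖nonautExp lam l u‖) *
        (1 + min (r * ∏ l ∈ Finset.Ico (k + 1) (k + 2 + i), 3 * ‖nonautExp lam l u‖)
          (min (Δ (k + 2 + i)) ‖nonautExp lam (k + 1 + i) u‖))) /
        (‖nonautExp lam (k + 1 + i) u‖ *
          min (Δ (k + 2 + i)) ‖nonautExp lam (k + 1 + i) u‖))) := by
  classical
  have hc := h.c_pos
  have hC := h.C_pos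
  induction i with
  | zero =>
    intro k hk ζ hζ u hu hu1 j hj r hr _
    obtain ⟨j, rfl⟩ : ∃ j', j = j' + 1 := Nat.exists_eq_succ_of_ne_zero (by omega)
    have hz : nonautExp lam k u ∈ expBox s ζ :=
      treeSet_subset_expBox _ _ _ 0 _ _ (mem_iInter.1 hu 0)
    simp only [add_zero, Finset.Ico_self, Finset.prod_empty, one_mul]
    rw [show Finset.Ico (k + 1) (k + 2) = {k + 1} from Nat.Ico_succ_singleton _,
      Finset.prod_singleton, nonautExp_succ]
    set z := nonautExp lam k u with hzdef
    set x := ‖lam (k + 1) * Complex.exp z‖ with hx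
    set R : ℝ := r * (3 * x) with hR
    have hR0 : 0 ≤ R := by positivity
    -- Only children whose boxes meet the enlarged ball can carry mass, so the mass is at most the
    -- proportion of such children.
    set T' := (T k ζ).filter fun ζ' =>
      (expBox s ζ' ∩ closedBall (lam (k + 1) * Complex.exp z) R).Nonempty with hT'
    have hX := norm_mul_exp_mem_of_mem_expBox (c := lam (k + 1)) hz
    set X := ‖lam (k + 1)‖ * Real.exp ζ.re with hXdef
    have hX0 : 0 ≤ X := by positivity
    have hcount := h.card_meeting k hk ζ hζ (lam (k + 1) * Complex.exp z) R hR0 T'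
      (Finset.filter_subset _ _) fun ζ' hζ' => (Finset.mem_filter.1 hζ').2
    have hΔ := (h.modulus_pos (k + 2) (by omega)).le
    have hm0 : 0 ≤ min R (min (Δ (k + 2)) x) := le_min hR0 (le_min hΔ (norm_nonneg _))
    have hcount' : (T'.card : ℝ) ≤ (C + 1) * ((1 + R) * (1 + min R (min (Δ (k + 2)) x))) := by
      refine hcount.trans ?_
      have : min R (min (Δ (k + 2)) X) ≤ min R (min (Δ (k + 2)) x) :=
        min_le_min le_rfl (min_le_min le_rfl hX.1)
      have : 0 ≤ min R (min (Δ (k + 2)) X) := le_min hR0 (le_min hΔ hX0)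
      gcongr
      linarith
    rw [treeMeasure_succ_apply isClosed_closedBall.measurableSet]
    calc _ ≤ ((T k ζ).card : ℝ≥0∞)⁻¹ * (T'.card : ℝ≥0∞) := by
          gcongr
          rw [Finset.card_filter, Nat.cast_sum]
          refine Finset.sum_le_sum fun ζ' hζ' => ?_
          refine (h.treeMeasure_preimage_le hk hζ hζ' hz r).trans ?_
          rw [show 3 * ‖lam (k + 1) * Complex.exp z‖ * r = R by rw [hR]; ring]
          split_ifs with hne
          · have := h.isProbabilityMeasure_treeMeasure j (k + 1) (by omega) ζ'
              (h.child_adm k hk ζ hζ ζ' hζ')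
            simpa using prob_le_one
          · rw [not_nonempty_iff_eq_empty.1 hne]; simp
      _ ≤ ((T k ζ).card : ℝ≥0∞)⁻¹ *
          ENNReal.ofReal ((C + 1) * ((1 + R) * (1 + min R (min (Δ (k + 2)) x)))) := by
          gcongr
          rw [← ENNReal.ofReal_natCast]
          exact ENNReal.ofReal_le_ofReal hcount'
      _ ≤ _ := by
          refine (h.inv_card_mul_le hk hζ hz (by positivity)).trans (le_of_eq ?_)
          congr 1; ring
  | succ i ih =>
    intro k hk ζ hζ u hu hu1 j hj r hr hgap
    obtain ⟨j, rfl⟩ : ∃ j', j = j' + 1 := Nat.exists_eq_succ_of_ne_zero (by omega)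
    have hz : nonautExp lam k u ∈ expBox s ζ :=
      treeSet_subset_expBox _ _ _ 0 _ _ (mem_iInter.1 hu 0)
    obtain ⟨ζ₀, hζ₀, hlim⟩ := exists_child_mem_treeLimit hu
    rw [← nonautExp_succ] at hlim
    have hz₀ : nonautExp lam (k + 1) u ∈ expBox s ζ₀ :=
      treeSet_subset_expBox _ _ _ 0 _ _ (mem_iInter.1 hlim 0)
    set x : ℕ → ℝ := fun l => ‖nonautExp lam l u‖ with hx
    set R : ℝ := r * (3 * x (k + 1)) with hR
    have hR0 : 0 ≤ R := by positivity
    have hbot : ∀ {n : ℕ}, k + 1 < n → ∀ f : ℕ → ℝ, ∏ l ∈ Finset.Ico (k + 1) n, f l =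
        f (k + 1) * ∏ l ∈ Finset.Ico (k + 1 + 1) n, f l := fun hn f =>
      Finset.prod_eq_prod_Ico_succ_bot hn f
    -- The smallness condition for r at level k is the one for R = 3 x_{k+1} r at level k + 1.
    have hgap' : R * ∏ l ∈ Finset.Ico (k + 1 + 1) (k + 1 + 1 + i), 3 * x l < s := by
      rw [show k + 1 + (i + 1) = k + 1 + 1 + i by ring, hbot (by omega), ← mul_assoc] at hgap
      exact hgap
    have hone : 1 ≤ ∏ l ∈ Finset.Ico (k + 1 + 1) (k + 1 + 1 + i), 3 * x l := by
      refine Finset.prod_induction _ (fun y : ℝ => 1 ≤ y) (fun _ _ => one_le_mul_of_one_le_of_one_le)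
        le_rfl fun l hl => ?_
      have := hu1 l (by have := (Finset.mem_Ico.1 hl).1; omega)
      simp only [hx]; linarith
    -- R is below the separation of the child boxes, so the enlarged ball meets only the box ζ₀ that
    -- contains its centre. Each such level contributes one factor 1 / card and no counting.
    have hRs : R < s := (le_mul_of_one_le_right hR0 hone).trans_lt hgap'
    have hIH := ih (k + 1) (by omega) ζ₀ (h.child_adm k hk ζ hζ ζ₀ hζ₀) u hlim
      (fun l hl => hu1 l (by omega)) j (by omega) R hR0 hgap'
    have e1 : k + 1 + 1 + i = k + 1 + (i + 1) := by ring
    have e2 : k + 1 + 2 + i = k + 2 + (i + 1) := by ring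
    rw [e1, e2] at hIH
    set B := 9 * (C + 1) / c with hB
    have hprod : R * ∏ l ∈ Finset.Ico (k + 1 + 1) (k + 2 + (i + 1)), 3 * x l =
        r * ∏ l ∈ Finset.Ico (k + 1) (k + 2 + (i + 1)), 3 * x l := by
      rw [hbot (n := k + 2 + (i + 1)) (by omega), ← mul_assoc]
    rw [hprod] at hIH
    rw [treeMeasure_succ_apply isClosed_closedBall.measurableSet]
    have hxpos : ∀ l, k < l → 0 < x l := fun l hl => lt_of_lt_of_le one_pos (hu1 l hl)
    have hmpos : ∀ l, k < l → 0 < min (Δ (l + 1)) (x l) := fun l hl =>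
      lt_min (h.modulus_pos _ (by omega)) (hxpos l hl)
    set t : ℝ := (∏ l ∈ Finset.Ico (k + 1 + 1) (k + 1 + (i + 1)), B / (x l * min (Δ (l + 1)) (x l))) *
      (B * ((1 + r * ∏ l ∈ Finset.Ico (k + 1) (k + 2 + (i + 1)), 3 * x l) *
        (1 + min (r * ∏ l ∈ Finset.Ico (k + 1) (k + 2 + (i + 1)), 3 * x l)
          (min (Δ (k + 2 + (i + 1))) (x (k + 1 + (i + 1)))))) /
        (x (k + 1 + (i + 1)) * min (Δ (k + 2 + (i + 1))) (x (k + 1 + (i + 1))))) with ht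
    have ht0 : 0 ≤ t := by
      have h1 : 0 < x (k + 1 + (i + 1)) := hxpos _ (by omega)
      have h2 : 0 < min (Δ (k + 2 + (i + 1))) (x (k + 1 + (i + 1))) := by
        have := hmpos (k + 1 + (i + 1)) (by omega)
        rwa [show k + 1 + (i + 1) + 1 = k + 2 + (i + 1) by ring] at this
      have h3 : 0 ≤ ∏ l ∈ Finset.Ico (k + 1) (k + 2 + (i + 1)), 3 * x l :=
        Finset.prod_nonneg fun l _ => by positivity
      have h4 : 0 ≤ min (r * ∏ l ∈ Finset.Ico (k + 1) (k + 2 + (i + 1)), 3 * x l)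
          (min (Δ (k + 2 + (i + 1))) (x (k + 1 + (i + 1)))) := le_min (by positivity) h2.le
      have h5 : 0 ≤ ∏ l ∈ Finset.Ico (k + 1 + 1) (k + 1 + (i + 1)),
          B / (x l * min (Δ (l + 1)) (x l)) := Finset.prod_nonneg fun l hl => by
        have := hmpos l (by have := (Finset.mem_Ico.1 hl).1; omega)
        positivity
      positivity
    calc _ ≤ ((T k ζ).card : ℝ≥0∞)⁻¹ * ENNReal.ofReal t := by
          gcongr
          rw [Finset.sum_eq_single_of_mem ζ₀ hζ₀]
          · refine (h.treeMeasure_preimage_le hk hζ hζ₀ hz r).trans (le_trans ?_ hIH)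
            refine measure_mono ?_
            rw [← nonautExp_succ, show 3 * ‖nonautExp lam (k + 1) u‖ * r = R by
              simp only [hR, hx]; ring]
            exact inter_subset_right
          · intro ζ' hζ' hne
            refine le_antisymm ((h.treeMeasure_preimage_le hk hζ hζ' hz r).trans ?_) zero_le
            rw [← nonautExp_succ, show 3 * ‖nonautExp lam (k + 1) u‖ * r = R by
              simp only [hR, hx]; ring]
            have hemp : expBox s ζ' ∩ closedBall (nonautExp lam (k + 1) u) R = ∅ := by
              refine eq_empty_of_forall_notMem fun w hw => ?_
              have h1 := h.child_sep k hk ζ hζ ζ' hζ' ζ₀ hζ₀ hne w hw.1 _ hz₀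
              have h2 := hw.2
              rw [mem_closedBall, dist_eq_norm] at h2
              linarith
            rw [hemp]; simp
      _ ≤ _ := by
          refine (h.inv_card_mul_le hk hζ hz ht0).trans (ENNReal.ofReal_le_ofReal ?_)
          rw [← nonautExp_succ, hbot (n := k + 1 + (i + 1)) (by omega), mul_assoc, ← ht]
          have h1 := hxpos (k + 1) (by omega)
          have h2 := hmpos (k + 1) (by omega)
          change 9 / c * t / (x (k + 1) * min (Δ (k + 1 + 1)) (x (k + 1))) ≤ _
          have : 9 / c ≤ B := by
            rw [hB]; gcongr; linarith
          change _ ≤ B / (x (k + 1) * min (Δ (k + 1 + 1)) (x (k + 1))) * t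
          rw [div_mul_eq_mul_div B]
          gcongr

end IsBoxTree

end

/-! ### The limit measure and its transport to starting points. -/

section
open Set Metric MeasureTheory

lemma isCompact_expBox {s : ℝ} (hs : s ≤ 1) (ζ : ℂ) : IsCompact (expBox s ζ) := by
  refine (isCompact_closedBall ζ (1 + Real.pi)).of_isClosed_subset (isClosed_expBox s ζ) ?_
  intro w hw
  rw [mem_closedBall, dist_eq_norm]
  exact norm_sub_le_two_of_mem_expBox hs hw

/-- A sequence of probability measures carried by a compact set has a limit point, whose values on
open sets are controlled by those of the sequence. -/
lemma exists_limit_measure {Z : Type*} [PseudoEMetricSpace Z] [T2Space Z] [MeasurableSpace Z]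
    [BorelSpace Z] {K : Set Z} (hK : IsCompact K) (ν : ℕ → Measure Z)
    (hν : ∀ j, IsProbabilityMeasure (ν j)) (hνK : ∀ j, ν j Kᶜ = 0) :
    ∃ ν' : Measure Z, IsProbabilityMeasure ν' ∧
      ∀ U, IsOpen U → ∀ m, (∀ᶠ j in atTop, ν j U ≤ m) → ν' U ≤ m := by
  let νs : ℕ → ProbabilityMeasure Z := fun j => ⟨ν j, hν j⟩
  have htight : IsTightMeasureSet {x | ∃ μ ∈ range νs, (μ : Measure Z) = x} := by
    rw [isTightMeasureSet_iff_exists_isCompact_measure_compl_le]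
    refine fun ε _ => ⟨K, hK, ?_⟩
    rintro _ ⟨_, ⟨j, rfl⟩, rfl⟩
    exact (hνK j).trans_le zero_le
  -- The limit is taken along a nonprincipal ultrafilter, so that bounds holding for all large j
  -- persist without passing to subsequences.
  obtain ⟨ν', -, hν'⟩ := (isCompact_closure_of_isTightMeasureSet htight).ultrafilter_le_nhds
    ((hyperfilter ℕ).map νs) (by
      rw [le_principal_iff]
      exact Filter.mem_of_superset (Filter.range_mem_map) subset_closure)
  have ht : Tendsto νs (hyperfilter ℕ) (𝓝 ν') := hν'
  refine ⟨ν', inferInstance, fun U hU m hm => ?_⟩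
  refine (ProbabilityMeasure.le_liminf_measure_open_of_tendsto ht hU).trans ?_
  refine liminf_le_of_frequently_le' (Eventually.frequently ?_)
  exact hm.filter_mono Nat.hyperfilter_le_atTop

lemma contDiff_nonautExp (lam : ℕ → ℂ) (N : ℕ) : ContDiff ℂ 1 (nonautExp lam N) := by
  induction N with
  | zero => exact contDiff_id
  | succ N ih => exact contDiff_const.mul ih.cexp

/-- On annuli, the iterates have bounded measurable right inverses. -/
lemma exists_rightInverse_nonautExp {lam : ℕ → ℂ} (hlam : ∀ n, 1 ≤ n → lam n ≠ 0) (N : ℕ) :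
    ∀ r R : ℝ, 0 < r → ∃ g : ℂ → ℂ, Measurable g ∧ ∃ R₀ : ℝ, ∀ w, r ≤ ‖w‖ → ‖w‖ ≤ R →
      nonautExp lam N (g w) = w ∧ ‖g w‖ ≤ R₀ := by
  induction N with
  | zero => exact fun r R _ => ⟨id, measurable_id, R, fun w _ hw => ⟨rfl, hw⟩⟩
  | succ N ih =>
    intro r R hr
    have hl : 0 < ‖lam (N + 1)‖ := norm_pos_iff.2 (hlam _ (by omega))
    obtain ⟨g, hg, R₀, hgR⟩ := ih 1 (max |Real.log (r / ‖lam (N + 1)‖)|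
      |Real.log (R / ‖lam (N + 1)‖)| + 5 * Real.pi) one_pos
    -- Adding 4πi to the logarithm makes the imaginary part at least 3π, so the chosen preimage has
    -- modulus at least 1 and the induction hypothesis applies with inner radius 1.
    refine ⟨fun w => g (Complex.log (w / lam (N + 1)) + (4 * Real.pi : ℝ) * Complex.I),
      hg.comp (by fun_prop), R₀, fun w hrw hwR => ?_⟩
    have hw : 0 < ‖w‖ := hr.trans_le hrw
    have hpi := Real.pi_gt_three
    have him := abs_le.1 (Complex.abs_arg_le_pi (w / lam (N + 1)))
    have hv1 : 1 ≤ ‖Complex.log (w / lam (N + 1)) + (4 * Real.pi : ℝ) * Complex.I‖ := by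
      refine le_trans ?_ (Complex.abs_im_le_norm _)
      rw [Complex.add_im, Complex.log_im]
      simp only [Complex.mul_im, Complex.ofReal_re, Complex.I_im, Complex.ofReal_im, Complex.I_re]
      refine le_trans ?_ (le_abs_self _)
      linarith
    have hv2 : ‖Complex.log (w / lam (N + 1)) + (4 * Real.pi : ℝ) * Complex.I‖ ≤
        max |Real.log (r / ‖lam (N + 1)‖)| |Real.log (R / ‖lam (N + 1)‖)| + 5 * Real.pi := by
      refine (Complex.norm_le_abs_re_add_abs_im _).trans (add_le_add ?_ ?_)
      · simp only [Complex.add_re, Complex.log_re, Complex.mul_re, Complex.ofReal_re,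
          Complex.I_im, Complex.ofReal_im, Complex.I_re, norm_div]
        simp only [mul_zero, zero_mul, sub_zero, add_zero]
        refine abs_le_max_abs_abs ?_ ?_
        · exact Real.log_le_log (by positivity) (by gcongr)
        · exact Real.log_le_log (by positivity) (by gcongr)
      · rw [Complex.add_im, Complex.log_im]
        simp only [Complex.mul_im, Complex.ofReal_re, Complex.I_im, Complex.ofReal_im, Complex.I_re]
        rw [abs_le]; constructor <;> linarith
    obtain ⟨h1, h2⟩ := hgR _ hv1 hv2
    refine ⟨?_, h2⟩
    rw [nonautExp_succ, h1, Complex.exp_add,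
      Complex.exp_log (div_ne_zero (norm_pos_iff.1 hw) (norm_pos_iff.1 hl)),
      show ((4 * Real.pi : ℝ) : ℂ) * Complex.I = (2 : ℕ) * (2 * Real.pi * Complex.I) by
        push_cast; ring, Complex.exp_nat_mul_two_pi_mul_I]
    field_simp [norm_pos_iff.1 hl]

lemma exists_lipschitz_nonautExp (lam : ℕ → ℂ) (N : ℕ) (R : ℝ) : ∃ L : ℝ, 1 ≤ L ∧
    ∀ u v, ‖u‖ ≤ R → ‖v‖ ≤ R → ‖nonautExp lam N u - nonautExp lam N v‖ ≤ L * ‖u - v‖ := by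
  obtain ⟨K, hK⟩ := (contDiff_nonautExp lam N).locallyLipschitz.locallyLipschitzOn
    |>.exists_lipschitzOnWith_of_compact (isCompact_closedBall (0 : ℂ) R)
  refine ⟨max 1 K, le_max_left _ _, fun u v hu hv => ?_⟩
  have h1 := hK.dist_le_mul u (by simpa using hu) v (by simpa using hv)
  rw [dist_eq_norm, dist_eq_norm] at h1
  exact h1.trans (by gcongr; exact le_max_right _ _)

/-- The measure on the limit set of a box tree, pulled back to the starting points of orbits. -/
theorem IsBoxTree.exists_measure {lam : ℕ → ℂ} {Δ : ℕ → ℝ} {s c C : ℝ} {N : ℕ} {V : ℕ → ℂ → Prop}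
    {T : ℕ → ℂ → Finset ℂ} (h : IsBoxTree lam Δ s c C N V T) {ζ : ℂ} (hζ : V N ζ)
    (hζ1 : ∀ w ∈ expBox s ζ, 1 ≤ ‖w‖) :
    ∃ (μ : Measure ℂ) (E : Set ℂ) (L : ℝ), 1 ≤ L ∧ μ E ≠ 0 ∧
      (∀ u ∈ E, nonautExp lam N u ∈ treeLimit lam s T N ζ) ∧
      ∀ u ∈ E, ∀ r, 0 < r → ∀ m, (∀ᶠ j in atTop,
        treeMeasure lam T j N ζ (closedBall (nonautExp lam N u) (L * r)) ≤ m) →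
        μ (closedBall u r) ≤ m := by
  obtain ⟨ν, hν, hνU⟩ := exists_limit_measure (isCompact_expBox h.s_le_one ζ)
    (fun j => treeMeasure lam T j N ζ)
    (fun j => h.isProbabilityMeasure_treeMeasure j N le_rfl ζ hζ)
    (fun j => h.treeMeasure_compl_treeSet j 0 (Nat.zero_le _) N le_rfl ζ hζ)
  have hνbox : ν (expBox s ζ)ᶜ = 0 := le_antisymm
    (hνU _ (isClosed_expBox s ζ).isOpen_compl 0 (Eventually.of_forall fun j =>
      (h.treeMeasure_compl_treeSet j 0 (Nat.zero_le _) N le_rfl ζ hζ).le)) zero_le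
  have hνlim : ν (treeLimit lam s T N ζ)ᶜ = 0 := by
    rw [treeLimit, compl_iInter, measure_iUnion_null_iff]
    refine fun i => le_antisymm (hνU _ (isClosed_treeSet _ _ _ _ _ _).isOpen_compl 0 ?_) zero_le
    filter_upwards [eventually_ge_atTop i] with j hj
    exact (h.treeMeasure_compl_treeSet j i hj N le_rfl ζ hζ).le
  have hbd : ∀ w ∈ expBox s ζ, ‖w‖ ≤ ‖ζ‖ + (1 + Real.pi) := fun w hw => by
    have h1 := norm_sub_le_two_of_mem_expBox h.s_le_one hw
    have h2 := norm_add_le ζ (w - ζ)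
    rw [add_sub_cancel] at h2
    linarith
  obtain ⟨g, hg, R₀, hgR⟩ := exists_rightInverse_nonautExp h.lam_ne N 1
    (‖ζ‖ + (1 + Real.pi)) one_pos
  obtain ⟨L, hL1, hL⟩ := exists_lipschitz_nonautExp lam N R₀
  have hlimbox : treeLimit lam s T N ζ ⊆ expBox s ζ := fun w hw =>
    treeSet_subset_expBox _ _ _ 0 _ _ (mem_iInter.1 hw 0)
  have hclosed : IsClosed (treeLimit lam s T N ζ) :=
    isClosed_iInter fun j => isClosed_treeSet _ _ _ _ _ _
  set E : Set ℂ := {u | ‖u‖ ≤ R₀} ∩ nonautExp lam N ⁻¹' treeLimit lam s T N ζ with hE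
  have hEm : MeasurableSet E := ((isClosed_le continuous_norm continuous_const).inter
    (hclosed.preimage (contDiff_nonautExp lam N).continuous)).measurableSet
  -- L + 1 instead of L places the image of a closed ball in an open one, since the limit measure is
  -- controlled from above only on open sets.
  refine ⟨ν.map g, E, L + 1, by linarith, ?_, fun u hu => hu.2, fun u hu r hr m hm => ?_⟩
  · rw [Measure.map_apply hg hEm]
    intro h0
    have h1 : ν univ ≤ ν (g ⁻¹' E) + ν (treeLimit lam s T N ζ)ᶜ := by
      refine (measure_mono ?_).trans (measure_union_le _ _)
      intro w _
      by_cases hw : w ∈ treeLimit lam s T N ζ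
      · obtain ⟨h2, h3⟩ := hgR w (hζ1 w (hlimbox hw)) (hbd w (hlimbox hw))
        exact Or.inl ⟨h3, by rw [mem_preimage, h2]; exact hw⟩
      · exact Or.inr hw
    rw [h0, hνlim, measure_univ] at h1
    simp at h1
  · rw [Measure.map_apply hg isClosed_closedBall.measurableSet]
    have h1 : ν (g ⁻¹' closedBall u r) ≤
        ν (ball (nonautExp lam N u) ((L + 1) * r)) + ν (expBox s ζ)ᶜ := by
      refine (measure_mono ?_).trans (measure_union_le _ _)
      intro w hw
      by_cases hwb : w ∈ expBox s ζ
      · obtain ⟨h2, h3⟩ := hgR w (hζ1 w hwb) (hbd w hwb)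
        refine Or.inl ?_
        have h4 := hL (g w) u h3 hu.1
        rw [h2] at h4
        rw [mem_preimage, mem_closedBall, dist_eq_norm] at hw
        rw [mem_ball, dist_eq_norm]
        nlinarith
      · exact Or.inr hwb
    rw [hνbox, add_zero] at h1
    refine h1.trans (hνU _ isOpen_ball m ?_)
    filter_upwards [hm] with j hj
    exact (measure_mono ball_subset_closedBall).trans hj

end

/-! ### Box trees for admissible sequences. -/

section
open Set Metric MeasureTheory

/-- Constants for which every large enough circle meeting a vertical strip of width more than `D`
carries the boxes needed to build box trees. -/
def HasBoxes (q D s c C A : ℝ) : Prop :=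
  0 < s ∧ s ≤ 1 ∧ s ≤ D ∧ 0 < c ∧ 0 < C ∧ 1 ≤ A ∧ ∀ X α β : ℝ, A ≤ X →
    D < β - α → α ≤ q * X → -(q * X) ≤ β → ∃ T : Finset ℂ,
      (∀ ζ ∈ T, ∀ w ∈ expBox s ζ, X ≤ ‖w‖ ∧ ‖w‖ ≤ X * Real.exp s) ∧
      (∀ ζ ∈ T, α ≤ ζ.re ∧ ζ.re + s ≤ β) ∧
      (∀ ζ ∈ T, ∀ ζ' ∈ T, ζ ≠ ζ' → ∀ w ∈ expBox s ζ, ∀ w' ∈ expBox s ζ', s ≤ ‖w - w'‖) ∧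
      c * (X * min (β - α) X) ≤ T.card ∧
      (∀ w : ℂ, ∀ R : ℝ, 0 ≤ R → ∀ T' ⊆ T, (∀ ζ ∈ T', (expBox s ζ ∩ closedBall w R).Nonempty) →
        (T'.card : ℝ) ≤ C * ((1 + R) * (1 + min R (min (β - α) X))))

/-- The box with left edge through `ζ` is mapped into the annulus of level `k + 1`. -/
def IsStripBox (lam : ℕ → ℂ) (a b : ℕ → ℝ) (s : ℝ) (k : ℕ) (ζ : ℂ) : Prop :=
  Real.log (a (k + 1) / ‖lam (k + 1)‖) ≤ ζ.re ∧ ζ.re + s ≤ Real.log (b (k + 1) / ‖lam (k + 1)‖)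

namespace AnnulusData

variable {lam : ℕ → ℂ} {a b : ℕ → ℝ} {D : ℝ} (h : AnnulusData lam a b D)
include h

lemma mem_annulus_of_isStripBox {s : ℝ} {k : ℕ} {ζ z : ℂ} (hζ : IsStripBox lam a b s k ζ)
    (hz : z ∈ expBox s ζ) :
    a (k + 1) ≤ ‖lam (k + 1) * Complex.exp z‖ ∧ ‖lam (k + 1) * Complex.exp z‖ ≤ b (k + 1) := by
  have h1 := norm_pos_iff.2 (h.lam_ne (k + 1) (by omega))
  have h2 := h.a_pos (k + 1) (by omega)
  have h3 := h2.trans (h.a_lt (k + 1) (by omega))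
  rw [norm_mul, Complex.norm_exp]
  constructor
  · rw [← div_le_iff₀' h1, ← Real.log_le_iff_le_exp (by positivity)]
    exact hζ.1.trans hz.1
  · rw [← le_div_iff₀' h1, ← Real.le_log_iff_exp_le (by positivity)]
    exact hz.2.1.trans hζ.2

/-- A strip box of level k has X = |λ_{k+1}| e^(Re ζ) ≥ a_{k+1}. Admissibility at index k + 1 then
says that the strip of the next level starts to the left of qX and ends to the right of -qX, as
`HasBoxes` demands. -/
lemma exists_isBoxTree {q s c C A : ℝ} (hq : 0 < q) (hB : HasBoxes q D s c C A) {N : ℕ}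
    (hadm : ∀ n, N ≤ n → a (n + 1) ≤ ‖lam (n + 1)‖ * Real.exp (q * a n) ∧
      ‖lam (n + 1)‖ * Real.exp (-(q * a n)) ≤ b (n + 1))
    (hA : ∀ n, N ≤ n → A ≤ a n) :
    ∃ T, IsBoxTree lam (annulusModulus a b) s c C N (IsStripBox lam a b s) T := by
  obtain ⟨hs0, hs1, -, hc, hC, -, hex⟩ := hB
  have key : ∀ k ζ, N ≤ k → IsStripBox lam a b s k ζ → _ := fun k ζ hk hζ =>
    hex (‖lam (k + 1)‖ * Real.exp ζ.re) (Real.log (a (k + 2) / ‖lam (k + 2)‖))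
      (Real.log (b (k + 2) / ‖lam (k + 2)‖))
      (by
        have h1 := (h.mem_annulus_of_isStripBox hζ (self_mem_expBox hs0.le ζ)).1
        rw [norm_mul, Complex.norm_exp] at h1
        exact (hA (k + 1) (by omega)).trans h1)
      (by rw [h.log_div_sub (by omega)]; exact h.modulus _ (by omega))
      (by
        have h1 := (h.mem_annulus_of_isStripBox hζ (self_mem_expBox hs0.le ζ)).1
        rw [norm_mul, Complex.norm_exp] at h1
        have h2 := (hadm (k + 1) (by omega)).1
        have h3 := norm_pos_iff.2 (h.lam_ne (k + 2) (by omega))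
        have h4 := h.a_pos (k + 2) (by omega)
        rw [Real.log_le_iff_le_exp (by positivity), div_le_iff₀' h3]
        exact h2.trans (by gcongr))
      (by
        have h1 := (h.mem_annulus_of_isStripBox hζ (self_mem_expBox hs0.le ζ)).1
        rw [norm_mul, Complex.norm_exp] at h1
        have h2 := (hadm (k + 1) (by omega)).2
        have h3 := norm_pos_iff.2 (h.lam_ne (k + 2) (by omega))
        have h4 := (h.a_pos (k + 2) (by omega)).trans (h.a_lt (k + 2) (by omega))
        rw [Real.le_log_iff_exp_le (by positivity), le_div_iff₀' h3]
        refine le_trans ?_ h2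
        gcongr)
  choose! T hT using key
  refine ⟨T, h.lam_ne, hs0, hs1, hc, hC, fun n hn => h.D_pos.trans (h.modulus n hn),
    fun k hk ζ hζ ζ' hζ' => (hT k ζ hk hζ).2.1 ζ' hζ',
    fun k hk ζ hζ => (hT k ζ hk hζ).1, fun k hk ζ hζ => (hT k ζ hk hζ).2.2.1,
    fun k hk ζ hζ => ?_, fun k hk ζ hζ => ?_⟩
  · have := (hT k ζ hk hζ).2.2.2.1
    rwa [h.log_div_sub (by omega)] at this
  · have := (hT k ζ hk hζ).2.2.2.2
    rwa [h.log_div_sub (by omega)] at this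

lemma exists_isStripBox {s : ℝ} (hs : s ≤ D) (k : ℕ) :
    ∃ ζ : ℂ, IsStripBox lam a b s k ζ ∧ ∀ w ∈ expBox s ζ, 1 ≤ ‖w‖ := by
  have h1 := h.modulus (k + 1) (by omega)
  rw [← h.log_div_sub (by omega)] at h1
  -- The imaginary part 10 keeps the whole box at distance at least 1 from the origin, since π ≤ 4.
  refine ⟨⟨Real.log (a (k + 1) / ‖lam (k + 1)‖), 10⟩, ⟨le_rfl, ?_⟩, fun w hw => ?_⟩
  · change Real.log (a (k + 1) / ‖lam (k + 1)‖) + s ≤ _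
    linarith
  · have h2 : |w.im - 10| ≤ Real.pi := hw.2.2
    have h3 := Real.pi_le_four
    refine le_trans ?_ ((le_abs_self _).trans (Complex.abs_im_le_norm w))
    linarith [(abs_le.1 h2).1]

lemma mem_annulus_of_mem_treeLimit {s c C : ℝ} {N : ℕ} {T : ℕ → ℂ → Finset ℂ}
    (hT : IsBoxTree lam (annulusModulus a b) s c C N (IsStripBox lam a b s) T) (i : ℕ) :
    ∀ k, N ≤ k → ∀ ζ, IsStripBox lam a b s k ζ → ∀ u,
      nonautExp lam k u ∈ treeLimit lam s T k ζ →
      a (k + 1 + i) ≤ ‖nonautExp lam (k + 1 + i) u‖ ∧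
        ‖nonautExp lam (k + 1 + i) u‖ ≤ b (k + 1 + i) := by
  induction i with
  | zero =>
    intro k _ ζ hζ u hu
    exact h.mem_annulus_of_isStripBox hζ (treeSet_subset_expBox _ _ _ 0 _ _ (mem_iInter.1 hu 0))
  | succ i ih =>
    intro k hk ζ hζ u hu
    obtain ⟨ζ', hζ', hu'⟩ := exists_child_mem_treeLimit hu
    rw [show k + 1 + (i + 1) = k + 1 + 1 + i by ring]
    exact ih (k + 1) (by omega) ζ' (hT.child_adm k hk ζ hζ ζ' hζ') u hu'

end AnnulusData

lemma modProd_add (x : ℕ → ℝ) (N i : ℕ) :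
    modProd x (N + i) = modProd x N * ∏ l ∈ Finset.Ico (N + 1) (N + 1 + i), x l := by
  induction i with
  | zero => simp
  | succ i ih =>
    rw [← add_assoc, modProd_succ, ih, ← add_assoc, Finset.prod_Ico_succ_top (by omega),
      show N + 1 + i = N + i + 1 by ring]
    ring

lemma minProd_add (a b x : ℕ → ℝ) (N i : ℕ) :
    minProd a b x (N + i) = minProd a b x N *
      ∏ l ∈ Finset.Ico (N + 1) (N + 1 + i), min (annulusModulus a b (l + 1)) (x l) := by
  induction i with
  | zero => simp
  | succ i ih =>
    rw [← add_assoc, minProd_succ, ih, ← add_assoc, Finset.prod_Ico_succ_top (by omega),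
      show N + 1 + i = N + i + 1 by ring]
    ring

end

/-! ### The mass distribution on the escape rate set and the lower bounds. -/

section
open Set Metric MeasureTheory

/-- The constant absorbing all factors in the estimate for the mass of balls. -/
noncomputable def massConst (L p m B s : ℝ) : ℝ :=
  (9 * (1 + B)) ^ 2 * (1 + p * m * (1 + L / p) ^ 2 + L / (p * s))

lemma one_le_massConst {L p m B s : ℝ} (hL : 0 ≤ L) (hp : 0 < p) (hm : 0 < m) (hB : 0 ≤ B)
    (hs : 0 < s) : 1 ≤ massConst L p m B s := by
  have h1 : 0 ≤ p * m * (1 + L / p) ^ 2 := by positivity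
  have h2 : 0 ≤ L / (p * s) := by positivity
  exact one_le_mul_of_one_le_of_one_le (one_le_pow₀ (by linarith)) (by linarith)

/-- This supplies the smallness condition under which a ball follows a single chain of boxes in
`IsBoxTree.treeMeasure_closedBall_le`. -/
lemma mul_lt_of_massConst_pow_mul_le {L p m B s K P r : ℝ} {i n : ℕ} (hL : 0 ≤ L) (hp : 0 < p)
    (hm : 0 < m) (hB : 0 ≤ B) (hs : 0 < s) (hK : massConst L p m B s ≤ K) (hP : 0 < P)
    (hr : 0 < r) (hi : i ≤ n) (hn : 1 ≤ n) (h : K ^ n * r ≤ 1 / P) :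
    L * r * (3 ^ i * (P / p)) < s := by
  set K1 := 1 + p * m * (1 + L / p) ^ 2 + L / (p * s) with hK1
  have h1 : 0 ≤ p * m * (1 + L / p) ^ 2 := by positivity
  have h2 : 0 ≤ L / (p * s) := by positivity
  have h3 : 3 ^ i * (L / (p * s)) < K ^ n := by
    calc 3 ^ i * (L / (p * s)) < 3 ^ i * K1 := by gcongr; linarith
      _ ≤ 3 ^ n * K1 ^ n := by
        have : K1 ≤ K1 ^ n := le_self_pow₀ (by linarith) (by omega)
        have h3 : (3 : ℝ) ^ i ≤ 3 ^ n := pow_le_pow_right₀ (by norm_num) hi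
        gcongr
      _ = (3 * K1) ^ n := by rw [mul_pow]
      _ ≤ (massConst L p m B s) ^ n := by
        rw [massConst, ← hK1]
        gcongr
        nlinarith
      _ ≤ K ^ n := by
        have := one_le_massConst hL hp hm hB hs
        gcongr
  rw [le_div_iff₀ hP] at h
  have h4 : 3 ^ i * (L / (p * s)) * (r * P) < 1 := by
    have : 0 < r * P := by positivity
    nlinarith
  calc L * r * (3 ^ i * (P / p)) = 3 ^ i * (L / (p * s)) * (r * P) * s := by field_simp
    _ < 1 * s := by gcongr
    _ = s := one_mul s

/-- Each bracket loses 3^(i+1) (1 + L/p), so the two together with B^(i+1) lose (9B)^(i+1) (1 +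
L/p)². Since i + 1 ≤ 2n, the square of 9(1 + B) in `massConst` suffices. -/
lemma mul_le_massConst_pow_mul {L p m B s K y w : ℝ} {i n : ℕ} (hL : 0 ≤ L) (hp : 0 < p)
    (hm : 0 < m) (hB : 0 ≤ B) (hs : 0 < s) (hK : massConst L p m B s ≤ K) (hy : 0 ≤ y)
    (hw : 0 ≤ w) (hi : i ≤ n) (hn : 1 ≤ n) :
    B ^ (i + 1) * (p * m) * ((1 + L * 3 ^ (i + 1) / p * y) *
      (1 + min (L * 3 ^ (i + 1) / p * y) w)) ≤ K ^ n * ((1 + y) * (1 + min y w)) := by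
  set K1 := 1 + p * m * (1 + L / p) ^ 2 + L / (p * s) with hK1
  have h1 : 0 ≤ p * m * (1 + L / p) ^ 2 := by positivity
  have h2 : 0 ≤ L / (p * s) := by positivity
  set κ := L * 3 ^ (i + 1) / p with hκ
  set κ' := 3 ^ (i + 1) * (1 + L / p) with hκ'
  have hLp : 0 ≤ L / p := by positivity
  have hκ0 : 0 ≤ κ := by positivity
  have h3 : (1 : ℝ) ≤ 3 ^ (i + 1) := one_le_pow₀ (by norm_num)
  have hκ1 : 1 ≤ κ' := one_le_mul_of_one_le_of_one_le h3 (by linarith)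
  have hκκ : κ ≤ κ' := by
    rw [hκ, hκ', mul_comm L, mul_div_assoc]
    gcongr; linarith
  have hmin : min (κ * y) w ≤ κ' * min y w := by
    rw [mul_min_of_nonneg _ _ (by linarith)]
    exact min_le_min (by gcongr) (le_mul_of_one_le_left hw hκ1)
  have hmin0 : 0 ≤ min y w := le_min hy hw
  have hmin0' : 0 ≤ min (κ * y) w := le_min (by positivity) hw
  have hκy : κ * y ≤ κ' * y := by gcongr
  calc B ^ (i + 1) * (p * m) * ((1 + κ * y) * (1 + min (κ * y) w))
      ≤ B ^ (i + 1) * (p * m) * ((κ' * (1 + y)) * (κ' * (1 + min y w))) := by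
        gcongr
        · linarith
        · linarith
    _ = (9 * B) ^ (i + 1) * (p * m * (1 + L / p) ^ 2) * ((1 + y) * (1 + min y w)) := by
        rw [hκ', show (9 : ℝ) = 3 * 3 by norm_num, mul_pow, mul_pow]; ring
    _ ≤ K ^ n * ((1 + y) * (1 + min y w)) := by
        refine mul_le_mul_of_nonneg_right ?_ (by positivity)
        calc (9 * B) ^ (i + 1) * (p * m * (1 + L / p) ^ 2)
            ≤ (9 * (1 + B)) ^ (2 * n) * K1 ^ n := by
              refine mul_le_mul ?_ ?_ h1 (by positivity)
              · calc (9 * B) ^ (i + 1) ≤ (9 * (1 + B)) ^ (i + 1) := by gcongr; linarith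
                  _ ≤ _ := pow_le_pow_right₀ (by linarith) (by omega)
              · exact le_trans (by linarith) (le_self_pow₀ (a := K1) (by linarith) (by omega))
          _ = (massConst L p m B s) ^ n := by rw [massConst, ← hK1, mul_pow _ K1, pow_mul]
          _ ≤ K ^ n := by
            have := one_le_massConst hL hp hm hB hs
            gcongr

namespace AnnulusData

variable {lam : ℕ → ℂ} {a b : ℕ → ℝ} {D : ℝ} (h : AnnulusData lam a b D)
include h

lemma orbitSeq_mem_of_lt {N : ℕ} {u : ℂ}
    (hu : ∀ n, N < n → a n ≤ ‖nonautExp lam n u‖ ∧ ‖nonautExp lam n u‖ ≤ b n) :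
    orbitSeq lam a N u ∈ seqBox a b := fun k hk => by
  by_cases hkN : k ≤ N
  · rw [orbitSeq_of_le hkN]; exact ⟨le_rfl, (h.a_lt k hk).le⟩
  · rw [orbitSeq_of_lt (not_le.1 hkN)]; exact hu k (by omega)

/-- A measure on a subset of the escape rate set such that the mass of small balls is controlled by
the orbits of their centres. -/
theorem exists_mass_distribution {q s c C A : ℝ} (hq : 0 < q) (hB : HasBoxes q D s c C A)
    (hadm : IsAdmissible lam a b q) (hA : ∀ᶠ n in atTop, A ≤ a n) :
    ∃ (N : ℕ) (μ : Measure ℂ) (E : Set ℂ) (K : ℝ), 1 ≤ K ∧ μ E ≠ 0 ∧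
      (∀ u ∈ E, ∀ n, N < n → a n ≤ ‖nonautExp lam n u‖ ∧ ‖nonautExp lam n u‖ ≤ b n) ∧
      (∀ x ∈ seqBox a b, ∀ k, 1 ≤ k → 1 / K ≤ min (annulusModulus a b (k + 1)) (x k)) ∧
      ∀ n, N ≤ n → ∀ u ∈ E, ∀ r, 0 < r → K ^ n * r ≤ 1 / modProd (orbitSeq lam a N u) n →
        μ (closedBall u r) ≤ ENNReal.ofReal (K ^ n *
          (1 + modProd (orbitSeq lam a N u) (n + 1) * r) *
          (1 + min (modProd (orbitSeq lam a N u) (n + 1) * r)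
            (stripWidth a b (orbitSeq lam a N u) n * modProd (orbitSeq lam a N u) (n + 1))) /
          (modProd (orbitSeq lam a N u) (n + 1) * minProd a b (orbitSeq lam a N u) (n + 1))) := by
  -- N ≥ 1 is requested so that K^n can absorb fixed constants for every n ≥ N.
  obtain ⟨N, hN⟩ := eventually_atTop.1 ((hadm.and hA).and (eventually_ge_atTop 1))
  have hN1 : 1 ≤ N := (hN N le_rfl).2
  obtain ⟨T, hT⟩ := h.exists_isBoxTree hq hB (fun n hn => (hN n hn).1.1) fun n hn => (hN n hn).1.2
  have hA1 : 1 ≤ A := hB.2.2.2.2.2.1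
  obtain ⟨ζ, hζ, hζ1⟩ := h.exists_isStripBox hB.2.2.1 N
  obtain ⟨μ, E, L, hL1, hμE, hElim, hμ⟩ := hT.exists_measure hζ hζ1
  obtain ⟨Km, hKm1, hKm⟩ := h.exists_le_min
  have hann : ∀ u ∈ E, ∀ n, N < n →
      a n ≤ ‖nonautExp lam n u‖ ∧ ‖nonautExp lam n u‖ ≤ b n := fun u hu n hn => by
    obtain ⟨i, rfl⟩ := Nat.exists_eq_add_of_le (show N + 1 ≤ n from hn)
    exact h.mem_annulus_of_mem_treeLimit hT i N le_rfl ζ hζ u (hElim u hu)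
  set B : ℝ := 9 * (C + 1) / c with hBdef
  have hc := hT.c_pos
  have hC := hT.C_pos
  have hs := hT.s_pos
  have hB0 : 0 ≤ B := by positivity
  set p := modProd a N with hp
  set m := minProd a b a N with hm
  have haBox : a ∈ seqBox a b := fun k hk => ⟨le_rfl, (h.a_lt k hk).le⟩
  have hp0 : 0 < p := modProd_pos h.a_pos N
  have hm0 : 0 < m := h.minProd_pos haBox N
  refine ⟨N, μ, E, max Km (massConst L p m B s), le_max_of_le_left hKm1, hμE, hann,
    fun x hx k hk => le_trans ?_ (hKm x hx k hk), fun n hn u hu r hr hKr => ?_⟩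
  · exact one_div_le_one_div_of_le (by linarith) (le_max_left _ _)
  set K := max Km (massConst L p m B s)
  have hKK : massConst L p m B s ≤ K := le_max_right _ _
  obtain ⟨i, rfl⟩ := Nat.exists_eq_add_of_le hn
  set x := orbitSeq lam a N u with hxdef
  have hx : x ∈ seqBox a b := h.orbitSeq_mem_of_lt (hann u hu)
  have hxl : ∀ l, N < l → x l = ‖nonautExp lam l u‖ := fun l hl => orbitSeq_of_lt hl
  have hx1 : ∀ l, N < l → 1 ≤ ‖nonautExp lam l u‖ := fun l hl =>
    hA1.trans (((hN l hl.le).1.2).trans (hann u hu l hl).1)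
  have hP0 : ∀ n, 0 < modProd x n := modProd_pos (h.x_pos hx)
  have hM0 := h.minProd_pos hx
  have hPN : modProd x N = p := modProd_orbitSeq_self
  have hMN : minProd a b x N = m := minProd_orbitSeq_self
  have hprodx : ∀ j, ∏ l ∈ Finset.Ico (N + 1) (N + 1 + j), 3 * ‖nonautExp lam l u‖ =
      3 ^ j * (modProd x (N + j) / p) := fun j => by
    rw [modProd_add, hPN, mul_div_cancel_left₀ _ hp0.ne', Finset.prod_mul_distrib,
      Finset.prod_const, Nat.card_Ico, Nat.add_sub_cancel_left]
    congr 1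
    exact Finset.prod_congr rfl fun l hl => (hxl l (Finset.mem_Ico.1 hl).1).symm
  have hprodm : ∏ l ∈ Finset.Ico (N + 1) (N + 1 + i), B / (‖nonautExp lam l u‖ *
      min (annulusModulus a b (l + 1)) ‖nonautExp lam l u‖) =
      B ^ i / ((modProd x (N + i) / p) * (minProd a b x (N + i) / m)) := by
    rw [modProd_add, hPN, mul_div_cancel_left₀ _ hp0.ne', minProd_add, hMN,
      mul_div_cancel_left₀ _ hm0.ne', ← Finset.prod_mul_distrib, Finset.prod_div_distrib,
      Finset.prod_const, Nat.card_Ico, Nat.add_sub_cancel_left]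
    congr 1
    exact Finset.prod_congr rfl fun l hl => by rw [hxl l (Finset.mem_Ico.1 hl).1]
  refine hμ u hu r hr _ ?_
  filter_upwards [eventually_ge_atTop (i + 1)] with j hj
  have hgap : L * r * ∏ l ∈ Finset.Ico (N + 1) (N + 1 + i), 3 * ‖nonautExp lam l u‖ < s := by
    rw [hprodx]
    exact mul_lt_of_massConst_pow_mul_le (by linarith) hp0 hm0 hB0 hs hKK (hP0 _) hr (by omega)
      (by omega) hKr
  refine (hT.treeMeasure_closedBall_le i N le_rfl ζ hζ u (hElim u hu) hx1 j hj (L * r)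
    (by positivity) hgap).trans (ENNReal.ofReal_le_ofReal ?_)
  rw [← hBdef, hprodm, show N + 2 + i = N + 1 + (i + 1) by ring, hprodx,
    show N + 1 + (i + 1) = N + i + 2 by ring, show N + 1 + i = N + i + 1 by ring,
    ← hxl (N + i + 1) (by omega), ← add_assoc N i 1, h.stripWidth_mul_modProd hx]
  set P' := modProd x (N + i + 1) with hP'
  set W := min (annulusModulus a b (N + i + 2)) (x (N + i + 1)) with hW
  have hW0 : 0 < W := h.min_pos hx (N + i + 1) (by omega)
  have hkey := mul_le_massConst_pow_mul (i := i) (n := N + i) (y := P' * r) (w := W)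
    (by linarith : 0 ≤ L) hp0 hm0 hB0 hs hKK (mul_pos (hP0 _) hr).le hW0.le (by omega) (by omega)
  have hPs : P' = modProd x (N + i) * x (N + i + 1) := modProd_succ _ _
  have hMs : minProd a b x (N + i + 1) = minProd a b x (N + i) * W := minProd_succ _ _ _ _
  have hκ : L * r * (3 ^ (i + 1) * (P' / p)) = L * 3 ^ (i + 1) / p * (P' * r) := by
    field_simp
  rw [hκ]
  set Y := (1 + L * 3 ^ (i + 1) / p * (P' * r)) * (1 + min (L * 3 ^ (i + 1) / p * (P' * r)) W)
  have h1 := hP0 (N + i)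
  have h2 := hM0 (N + i)
  have h3 := h.x_pos hx (N + i + 1) (by omega)
  have h4 : 0 < P' := hP0 _
  have h5 := hM0 (N + i + 1)
  calc _ = B ^ (i + 1) * (p * m) * Y / (P' * minProd a b x (N + i + 1)) := by
        rw [hMs, hPs]; field_simp; ring
    _ ≤ K ^ (N + i) * ((1 + P' * r) * (1 + min (P' * r) W)) /
        (P' * minProd a b x (N + i + 1)) := by gcongr
    _ = _ := by ring

theorem le_dimH_escapeRateSet {q s c C A : ℝ} (hq : 0 < q) (hB : HasBoxes q D s c C A)
    (hadm : IsAdmissible lam a b q) (hA : ∀ᶠ n in atTop, A ≤ a n) {t t' : ℝ} (htt : t' < t)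
    (ht' : 0 < 1 + t')
    (hφ : ∀ x ∈ seqBox a b, (t : EReal) < liminf (fun n : ℕ => (phiRatio a b n x : EReal)) atTop) :
    ENNReal.ofReal (1 + t') ≤ dimH (escapeRateSet lam a b) := by
  obtain ⟨N, μ, E, K, hK, hμE, hann, hKm, hball⟩ := h.exists_mass_distribution hq hB hadm hA
  have hbox : ∀ u ∈ E, orbitSeq lam a N u ∈ seqBox a b := fun u hu => h.orbitSeq_mem_of_lt (hann u hu)
  have haBox : a ∈ seqBox a b := fun k hk => ⟨le_rfl, (h.a_lt k hk).le⟩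
  have hev : ∀ x ∈ seqBox a b, ∀ᶠ n in atTop, 1 < modProd x n ∧ t ≤ phiRatio a b (n + 1) x := by
    intro x hx
    have h1 := (tendsto_add_atTop_nat 1).eventually (eventually_lt_of_lt_liminf (hφ x hx))
    filter_upwards [h1, h.eventually_one_lt_modProd] with n hn hn'
    exact ⟨hn' x hx, by exact_mod_cast hn.le⟩
  have ht1 : t ≤ 1 := by
    obtain ⟨n, hn1, hn2⟩ := (hev a haBox).exists
    exact hn2.trans (h.phiRatio_succ_le_one haBox hn1)
  -- The ball estimate is used with an exponent in [0, 1]. If t is negative, the exponent 0 works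
  -- because K^n M_n ≥ 1.
  refine (le_dimH_of_ball_mass (n0 := N) (t := max t 0) hμE hK (fun n => h.modProd_pos_all n)
    h.growth
    (P := fun n u => modProd (orbitSeq lam a N u) n)
    (M := fun n u => minProd a b (orbitSeq lam a N u) n)
    (w := fun n u => stripWidth a b (orbitSeq lam a N u) n)
    (fun n _ u hu => h.modProd_le (hbox u hu) n)
    (fun n _ u hu => h.stripWidth_pos (hbox u hu) n)
    (fun n _ u hu => h.minProd_pos (hbox u hu) n)
    (fun n _ u hu => ?_) (fun n _ u _ => stripWidth_mul_minProd n) hball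
    (le_max_right _ _) (max_le ht1 zero_le_one) (htt.trans_le (le_max_left _ _)) ht'
    fun u hu => ?_).trans (dimH_mono ?_)
  · rw [h.stripWidth_mul_modProd (hbox u hu)]
    exact hKm _ (hbox u hu) (n + 1) (by omega)
  · have hM := h.minProd_pos (hbox u hu)
    rcases le_total t 0 with ht | ht
    · rw [max_eq_right ht]
      refine Eventually.of_forall fun n => ?_
      simpa using one_le_pow_mul_minProd hK hKm (hbox u hu) n
    · rw [max_eq_left ht]
      filter_upwards [hev _ (hbox u hu)] with n hn
      refine ((h.le_phiRatio_succ_iff (hbox u hu) hn.1).1 hn.2).trans ?_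
      exact le_mul_of_one_le_left (hM n).le (one_le_pow₀ hK)
  · intro u hu
    filter_upwards [eventually_gt_atTop N] with n hn
    exact hann u hu n hn

theorem le_packingDim_escapeRateSet {q s c C A : ℝ} (hq : 0 < q) (hB : HasBoxes q D s c C A)
    (hadm : IsAdmissible lam a b q) (hA : ∀ᶠ n in atTop, A ≤ a n) {t t' : ℝ} (htt : t' < t)
    (hψ : ∀ x ∈ seqBox a b, (t : EReal) < limsup (fun n : ℕ => (psiRatio a b n x : EReal)) atTop) :
    ENNReal.ofReal (1 + t') ≤ packingDim (escapeRateSet lam a b) := by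
  obtain ⟨N, μ, E, K, hK, hμE, hann, hKm, hball⟩ := h.exists_mass_distribution hq hB hadm hA
  have hbox : ∀ u ∈ E, orbitSeq lam a N u ∈ seqBox a b := fun u hu => h.orbitSeq_mem_of_lt (hann u hu)
  have haBox : a ∈ seqBox a b := fun k hk => ⟨le_rfl, (h.a_lt k hk).le⟩
  have hfr : ∀ x ∈ seqBox a b, ∃ᶠ n in atTop, 1 < modProd x n ∧ t ≤ psiRatio a b n x := by
    intro x hx
    have h1 := frequently_lt_of_lt_limsup (by isBoundedDefault) (hψ x hx)
    refine (h1.and_eventually h.eventually_one_lt_modProd).mono fun n hn => ?_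
    exact ⟨hn.2 x hx, by exact_mod_cast hn.1.le⟩
  have ht1 : t ≤ 1 := by
    obtain ⟨n, hn1, hn2⟩ := (hfr a haBox).exists
    exact hn2.trans (h.psiRatio_le_one haBox hn1)
  refine le_packingDim_of_ball_mass (n0 := N) (t := t) (E := E) ?_ hμE hK
    (fun n => h.modProd_pos_all n) h.growth
    (P := fun n u => modProd (orbitSeq lam a N u) n)
    (M := fun n u => minProd a b (orbitSeq lam a N u) n)
    (w := fun n u => stripWidth a b (orbitSeq lam a N u) n)
    (fun n _ u hu => h.modProd_le (hbox u hu) n)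
    (fun n _ u hu => h.stripWidth_pos (hbox u hu) n)
    (fun n _ u hu => h.minProd_pos (hbox u hu) n)
    (fun n _ u hu => ?_) hball ht1 htt fun u hu => ?_
  · intro u hu
    filter_upwards [eventually_gt_atTop N] with n hn
    exact hann u hu n hn
  -- The bound x_{n+1} ≥ 1/K gives P_n ≤ K P_{n+1}.
  · have h1 := (hKm _ (hbox u hu) (n + 1) (by omega)).trans (min_le_right _ _)
    rw [div_le_iff₀ (by linarith)] at h1
    have h2 := modProd_pos (h.x_pos (hbox u hu)) n
    change _ ≤ K * modProd _ (n + 1)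
    rw [modProd_succ]
    nlinarith
  · refine (hfr _ (hbox u hu)).mono fun n hn => ?_
    refine ((h.le_psiRatio_iff (hbox u hu) hn.1).1 hn.2).trans ?_
    exact le_mul_of_one_le_left (h.minProd_pos (hbox u hu) n).le (one_le_pow₀ hK)

end AnnulusData

end

/-! ### From the hypotheses to the standing assumptions, and from real bounds to the theorem. -/

lemma AnnulusData.of_tendsto {lam : ℕ → ℂ} {a b : ℕ → ℝ} {D : ℝ} (hD : 0 < D)
    (hlam : ∀ n, 1 ≤ n → lam n ≠ 0) (hab : ∀ n, 1 ≤ n → 0 < a n ∧ a n < b n)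
    (hgrowth : Tendsto (fun n : ℕ => (∏ k ∈ Finset.Icc 1 n, a k) ^ ((1 : ℝ) / (n : ℝ))) atTop atTop)
    (hmod : ∀ n, 1 ≤ n → D < annulusModulus a b n) (ha : ∀ᶠ n in atTop, 1 ≤ a n) :
    AnnulusData lam a b D where
  D_pos := hD
  lam_ne := hlam
  a_pos n hn := (hab n hn).1
  a_lt n hn := (hab n hn).2
  growth B := by
    filter_upwards [hgrowth.eventually_ge_atTop |B|, eventually_ge_atTop 1] with n hn hn1
    have hp : 0 ≤ modProd a n := (modProd_pos (fun k hk => (hab k hk).1) n).le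
    have hn0 : (n : ℝ) ≠ 0 := by positivity
    calc B ^ n ≤ |B| ^ n := by rw [← abs_pow]; exact le_abs_self _
      _ ≤ (modProd a n ^ ((1 : ℝ) / n)) ^ n := pow_le_pow_left₀ (abs_nonneg B) hn n
      _ = modProd a n := by
        rw [← Real.rpow_natCast, ← Real.rpow_mul hp, one_div_mul_cancel hn0, Real.rpow_one]
  modulus := hmod
  one_le_a := ha

/-- A lower bound for `d` by all `1 + t'` below an extended real `v` bounds `d` below by `1 + v`. -/
lemma one_add_le_of_forall_lt {v : EReal} {d : ℝ≥0∞}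
    (hd : ∀ t t' : ℝ, t' < t → 0 < 1 + t' → (t : EReal) < v → ENNReal.ofReal (1 + t') ≤ d) :
    1 + v ≤ (d : EReal) := by
  by_contra hcon
  push Not at hcon
  obtain ⟨y, hy1, hy2⟩ := EReal.lt_iff_exists_real_btwn.1 hcon
  obtain ⟨z, hz1, hz2⟩ := EReal.lt_iff_exists_real_btwn.1 hy2
  have hy0 : 0 < y := by
    have : (0 : EReal) < y := (EReal.coe_ennreal_nonneg d).trans_lt hy1
    exact_mod_cast this
  have hyz : y < z := by exact_mod_cast hz1
  have hzv : ((z - 1 : ℝ) : EReal) < v := by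
    by_contra hle
    push Not at hle
    refine absurd hz2 (not_lt.2 ?_)
    calc (1 : EReal) + v ≤ 1 + ((z - 1 : ℝ) : EReal) := by gcongr
      _ = ((1 + (z - 1) : ℝ) : EReal) := by rw [EReal.coe_add]; rfl
      _ = z := by congr 1; ring
  have h1 := hd (z - 1) (y - 1) (by linarith) (by linarith) hzv
  rw [add_sub_cancel] at h1
  refine absurd hy1 (not_lt.2 ?_)
  calc (y : EReal) = (ENNReal.ofReal y : EReal) := by
        rw [EReal.coe_ennreal_ofReal, max_eq_left hy0.le]
    _ ≤ d := by exact_mod_cast h1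

/-- An upper bound for `d` by all `1 + t'` above an extended real `v ≥ 0` bounds `d` by `1 + v`. -/
lemma le_one_add_of_forall_lt {v : EReal} {d : ℝ≥0∞} (hv : 0 ≤ v)
    (hd : ∀ t t' : ℝ, 0 < t → t < t' → v < (t : EReal) → d ≤ ENNReal.ofReal (1 + t')) :
    (d : EReal) ≤ 1 + v := by
  by_contra hcon
  push Not at hcon
  obtain ⟨y, hy1, hy2⟩ := EReal.lt_iff_exists_real_btwn.1 hcon
  obtain ⟨z, hz1, hz2⟩ := EReal.lt_iff_exists_real_btwn.1 hy1
  have hzy : z < y := by exact_mod_cast hz2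
  have hvz : v < ((z - 1 : ℝ) : EReal) := by
    by_contra hle
    push Not at hle
    refine absurd hz1 (not_lt.2 ?_)
    calc (z : EReal) = ((1 + (z - 1) : ℝ) : EReal) := by congr 1; ring
      _ = 1 + ((z - 1 : ℝ) : EReal) := by rw [EReal.coe_add]; rfl
      _ ≤ 1 + v := by gcongr
  have hz0 : 0 < z - 1 := by exact_mod_cast hv.trans_lt hvz
  have h1 := hd (z - 1) (y - 1) hz0 (by linarith) hvz
  rw [add_sub_cancel] at h1
  refine absurd hy2 (not_lt.2 ?_)
  calc (d : EReal) ≤ (ENNReal.ofReal y : EReal) := by exact_mod_cast h1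
    _ = y := by rw [EReal.coe_ennreal_ofReal, max_eq_left (by linarith)]

theorem theorem2p2 (q : ℝ) (hq0 : 0 < q) (hq1 : q < 1) (D : ℝ) (hD : 0 < D) :
    ∃ A : ℝ, ∀ (lam : ℕ → ℂ) (a b : ℕ → ℝ),
      (∀ n, 1 ≤ n → lam n ≠ 0) →
      (∀ n, 1 ≤ n → 0 < a n ∧ a n < b n) →
      IsAdmissible lam a b q →
      Tendsto (fun n : ℕ => (∏ k ∈ Finset.Icc 1 n, a k) ^ ((1 : ℝ) / (n : ℝ))) atTop atTop →
      (∀ n, 1 ≤ n → D < annulusModulus a b n) →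
      (A : EReal) < liminf (fun n : ℕ => (a n : EReal)) atTop →
      ((1 : EReal) + (⨅ x ∈ seqBox a b, liminf (fun n : ℕ => (phiRatio a b n x : EReal)) atTop)
          ≤ (dimH (escapeRateSet lam a b) : EReal) ∧
        (dimH (escapeRateSet lam a b) : EReal)
          ≤ 1 + (⨆ x ∈ seqBox a b, liminf (fun n : ℕ => (phiRatio a b n x : EReal)) atTop)) ∧
      ((1 : EReal) + (⨅ x ∈ seqBox a b, limsup (fun n : ℕ => (psiRatio a b n x : EReal)) atTop)
          ≤ (packingDim (escapeRateSet lam a b) : EReal) ∧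
        (packingDim (escapeRateSet lam a b) : EReal)
          ≤ 1 + (⨆ x ∈ seqBox a b, limsup (fun n : ℕ => (psiRatio a b n x : EReal)) atTop)) := by
  obtain ⟨s, c, C, A, hB⟩ := exists_boxes hq0 hq1 hD
  replace hB : HasBoxes q D s c C A := hB
  have hA1 : 1 ≤ A := hB.2.2.2.2.2.1
  refine ⟨A, fun lam a b hlam hab hadm hgrowth hmod hliminf => ?_⟩
  have hA : ∀ᶠ n in atTop, A ≤ a n := by
    filter_upwards [eventually_lt_of_lt_liminf hliminf] with n hn
    exact_mod_cast hn.le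
  have h : AnnulusData lam a b D := AnnulusData.of_tendsto hD hlam hab hgrowth hmod
    (hA.mono fun n hn => hA1.trans hn)
  have ha : a ∈ seqBox a b := fun n hn => ⟨le_rfl, (hab n hn).2.le⟩
  refine ⟨⟨one_add_le_of_forall_lt ?_,
    le_one_add_of_forall_lt ?_ ?_⟩,
    one_add_le_of_forall_lt ?_,
    le_one_add_of_forall_lt ?_ ?_⟩
  · exact fun t t' htt ht' hv => h.le_dimH_escapeRateSet hq0 hB hadm hA htt ht' fun x hx =>
      hv.trans_le (iInf₂_le x hx)
  -- The sequence a itself belongs to the box and witnesses that the supremum is nonnegative.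
  · exact (h.liminf_phiRatio_nonneg ha).trans (le_iSup₂_of_le a ha le_rfl)
  · exact fun t t' ht0 htt hv => h.dimH_escapeRateSet_le htt (ht0.trans htt) fun x hx =>
      (le_iSup₂_of_le x hx le_rfl).trans_lt hv
  · exact fun t t' htt _ hv => h.le_packingDim_escapeRateSet hq0 hB hadm hA htt fun x hx =>
      hv.trans_le (iInf₂_le x hx)
  · exact (h.limsup_psiRatio_nonneg ha).trans (le_iSup₂_of_le a ha le_rfl)
  · exact fun t t' ht0 htt hv => h.packingDim_escapeRateSet_le ht0 htt fun x hx =>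
      (le_iSup₂_of_le x hx le_rfl).trans_lt hv
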